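/- Work over the field $\mathbb{Q}(q)$ of rational functions in an indeterminate $q$. A linear $q$-difference equation is an equation $\sum_{i=0}^{d} a_i(q,q^n)\,J(n+i)=0$ with coefficients $a_i\in\mathbb{Q}(q,Q)$; it is nontrivial if not all $a_i$ are zero. A sequence $J:\mathbb{N}=\{0,1,2,\dots\}\to\mathbb{Q}(q)$ satisfies the equation if it holds for every $n\ge 0$ at which no coefficient $a_i(q,Q)$ has a pole at $Q=q^n$. The sequence is $q$-holonomic if it satisfies some nontrivial linear $q$-difference equation. For $x\in\mathbb{Q}(q)$ and $m\in\mathbb{Z}$ let $(x;q)_m=\prod_{i=0}^{m-1}(1-xq^i)$ if $m\ge 0$ and $(x;q)_m=\prod_{i=1}^{-m}(1-xq^{-i})^{-1}$ if $m<0$. A proper $q$-hypergeometric term is an expression $$c(n,k)=p(q^n,q^k)\,\xi^n\eta^k\,q^{e(n,k)}\,\frac{\prod_{r}(x_r q^{s_r(n,k)};q)_{m_r(n,k)}}{\prod_{t}(y_t q^{u_t(n,k)};q)_{v_t(n,k)}}$$ (finite products), where $p$ is a polynomial in two variables over $\mathbb{Q}(q)$, $\xi,\eta\in\mathbb{Q}(q)\setminus\{0\}$,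 $x_r,y_t\in\mathbb{Q}(q)$, $e$ is an integer-valued quadratic polynomial in $n,k$, and $s_r,m_r,u_t,v_t$ are linear forms $an+bk+c$ with $a,b,c\in\mathbb{Z}$, such that every factor is defined for all integers $0\le k\le n$, i.e. no factor $(x_r q^{s_r};q)_{m_r}$ and no factor $1/(y_t q^{u_t};q)_{v_t}$ involves a division by zero (for $v<0$ one reads $1/(y;q)_v=\prod_{i=1}^{-v}(1-yq^{-i})$, which may be $0$). **Theorem.** (1) Let $c(n,k)$, $0\le k\le n$, be a proper $q$-hypergeometric term, let $(\hat J(n))_{n\ge 0}$ be a $q$-holonomic sequence in $\mathbb{Q}(q)$, and let $$J(n)=\sum_{k=0}^{n}c(n,k)\,\hat J(k)\qquad(n\ge 0).$$ Then $(J(n))$ is $q$-holonomic. (2) A linear $q$-difference equation for $J$ can be constructed from one for $\hat J$ together with $c$: there is an algorithm (a partial recursive function) that takes as input a linear $q$-difference equation and an expression of the above form, both given by finite lists of integers, and that, whenever the equation is nontrivial and the expression is a proper $q$-hypergeometric term $c(n,k)$, terminates and returns a nontrivial linear $q$-difference equation that is satisfied by $J(n)=\sum_{k=0}^{n}c(n,k)\hat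 J(k)$ for every sequence $\hat J$ satisfying the input equation. -/

import Mathlib

namespace QHolonomic

/-- The field `ℚ(q)`. -/
abbrev Kq : Type := RatFunc ℚ

/-- The indeterminate `q` of `ℚ(q)`. -/
noncomputable def q : Kq := RatFunc.X

/-- The field `ℚ(q, Q)`, where `Q` stands for `q ^ n`. -/
abbrev KqQ : Type := RatFunc Kq

/-! ### Linear `q`-difference equations and `q`-holonomic sequences -/

/-- `a(q, Q)` has no pole at `Q = q ^ n`. -/
def DefinedAt (a : KqQ) (n : ℕ) : Prop :=
  a.denom.eval (q ^ n) ≠ 0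

/-- The value `a(q, q ^ n)`. -/
noncomputable def valueAt (a : KqQ) (n : ℕ) : Kq :=
  a.eval (RingHom.id Kq) (q ^ n)

/-- The list `L = [a₀, …, a_d]` represents the linear `q`-difference equation
`∑ i, a_i(q, q ^ n) J(n + i) = 0`. The sequence `J` satisfies it if it holds at every `n ≥ 0` at
which all coefficients are defined (this excludes only finitely many `n`). -/
def Satisfies (J : ℕ → Kq) (L : List KqQ) : Prop :=
  ∀ n : ℕ, (∀ a ∈ L, DefinedAt a n) →
    ∑ i : Fin L.length, valueAt (L.get i) n * J (n + (i : ℕ)) = 0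

/-- The equation is not the trivial equation `0 = 0`. -/
def IsNontrivial (L : List KqQ) : Prop :=
  ∃ a ∈ L, a ≠ 0

/-- `J` satisfies a nontrivial linear `q`-difference equation with coefficients in
`ℚ(q, q ^ n)`. -/
def IsQHolonomic (J : ℕ → Kq) : Prop :=
  ∃ L : List KqQ, IsNontrivial L ∧ Satisfies J L

/-! ### Finite descriptions of rational functions and of equations -/

/-- `coeffEval x [c₀, c₁, …, c_d] = c₀ + c₁ x + ⋯ + c_d x ^ d`. -/
def coeffEval {R : Type*} [Semiring R] (x : R) (l : List R) : R :=
  l.foldr (fun c s => c + x * s) 0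

/-- The element of `ℤ[q]` with the given list of coefficients, constant coefficient first. -/
noncomputable def intPoly (l : List ℤ) : Kq :=
  coeffEval q (l.map fun c => (c : Kq))

/-- A numerator and a denominator in `ℤ[q]`, describing an element of `ℚ(q)`. -/
abbrev RatCode : Type := List ℤ × List ℤ

noncomputable def RatCode.val (r : RatCode) : Kq :=
  intPoly r.1 / intPoly r.2

/-- The element of `ℤ[q][Q]` with the given list of coefficients, constant coefficient first. -/
noncomputable def intPoly₂ (l : List (List ℤ)) : KqQ :=
  coeffEval RatFunc.X (l.map fun c => RatFunc.C (intPoly c))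

/-- The list of the coefficients of a linear `q`-difference equation, each given by a numerator
and a denominator in `ℤ[q][Q]`. -/
abbrev EqCode : Type := List (List (List ℤ) × List (List ℤ))

noncomputable def EqCode.toEq (e : EqCode) : List KqQ :=
  e.map fun c => intPoly₂ c.1 / intPoly₂ c.2

/-! ### Proper `q`-hypergeometric terms -/

/-- The quantum factorial `(x; q)_m`, `m ∈ ℤ`: it is `(1 - x) ⋯ (1 - x q ^ (m - 1))` for `m ≥ 0`
and `1 / ((1 - x q⁻¹) ⋯ (1 - x q ^ m))` for `m < 0`. -/
noncomputable def qFactorial (x : Kq) : ℤ → Kq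
  | Int.ofNat m => ∏ i ∈ Finset.range m, (1 - x * q ^ i)
  | Int.negSucc m => (∏ i ∈ Finset.range (m + 1), (1 - x * q ^ (-((i : ℤ) + 1))))⁻¹

/-- `(x; q)_m` is defined: no factor in its denominator (for `m < 0`) vanishes. -/
def QFactorialDefined (x : Kq) (m : ℤ) : Prop :=
  ∀ j : ℤ, m ≤ j → j < 0 → 1 - x * q ^ j ≠ 0

/-- `1 / (x; q)_m` is defined: no factor of `(x; q)_m` (for `m > 0`) vanishes. For `m < 0` it is
the product `(1 - x q⁻¹) ⋯ (1 - x q ^ m)`, which may be zero, as in `1 / (q; q)_{-1} = 0`. -/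
def InvQFactorialDefined (x : Kq) (m : ℤ) : Prop :=
  ∀ j : ℤ, 0 ≤ j → j < m → 1 - x * q ^ j ≠ 0

/-- The integer linear form `a n + b k + c`. -/
structure LinForm where
  a : ℤ
  b : ℤ
  c : ℤ

def LinForm.val (l : LinForm) (n k : ℕ) : ℤ :=
  l.a * n + l.b * k + l.c

/-- A quantum factorial `(x q ^ s(n,k); q)_{m(n,k)}` with `x ∈ ℚ(q)` and integer linear
forms `s`, `m`. -/
structure QFactor where
  x : RatCode
  s : LinForm
  m : LinForm

/-- The first argument `x q ^ s(n,k)` of the quantum factorial. -/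
noncomputable def QFactor.arg (f : QFactor) (n k : ℕ) : Kq :=
  f.x.val * q ^ f.s.val n k

noncomputable def QFactor.val (f : QFactor) (n k : ℕ) : Kq :=
  qFactorial (f.arg n k) (f.m.val n k)

/-- An integer-valued quadratic function of `n`, `k`:
`nn * n(n-1)/2 + nk * n k + kk * k(k-1)/2 + lin(n, k)`. -/
structure QuadForm where
  nn : ℤ
  nk : ℤ
  kk : ℤ
  lin : LinForm

def QuadForm.val (e : QuadForm) (n k : ℕ) : ℤ :=
  e.nn * (n.choose 2 : ℕ) + e.nk * (n * k) + e.kk * (k.choose 2 : ℕ) + e.lin.val n k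

/-- The expression
`p(q ^ n, q ^ k) * ξ ^ n * η ^ k * q ^ quad(n, k) * ∏ (x q ^ s; q)_m / ∏ (x' q ^ s'; q)_m'`
with a polynomial `p` over `ℚ(q)`, `ξ, η ∈ ℚ(q)`, a quadratic function `quad`, and quantum
factorials of linear forms in `n`, `k`. The entry of `poly` in position `j` is the list of the
coefficients of `(q ^ k) ^ j` as a polynomial in `q ^ n`. -/
structure TermCode where
  poly : List (List RatCode)
  ξ : RatCode
  η : RatCode
  quad : QuadForm
  num : List QFactor
  den : List QFactor

noncomputable def TermCode.val (T : TermCode) (n k : ℕ) : Kq :=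
  coeffEval (q ^ k) (T.poly.map fun l => coeffEval (q ^ n) (l.map RatCode.val)) *
    T.ξ.val ^ n * T.η.val ^ k * q ^ T.quad.val n k *
    (T.num.map fun f => f.val n k).prod * (T.den.map fun f => (f.val n k)⁻¹).prod

/-- The geometric factors do not vanish, and the expression is defined for `0 ≤ k ≤ n`. -/
def TermCode.IsValid (T : TermCode) : Prop :=
  T.ξ.val ≠ 0 ∧ T.η.val ≠ 0 ∧ ∀ n k : ℕ, k ≤ n →
    (∀ f ∈ T.num, QFactorialDefined (f.arg n k) (f.m.val n k)) ∧
    (∀ f ∈ T.den, InvQFactorialDefined (f.arg n k) (f.m.val n k))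

/-- `c(n, k)`, `0 ≤ k ≤ n`, is a proper `q`-hypergeometric term. -/
def IsProperQHypergeometric (c : ℕ → ℕ → Kq) : Prop :=
  ∃ T : TermCode, T.IsValid ∧ ∀ n k : ℕ, k ≤ n → c n k = T.val n k

/-- `J(n) = ∑_{k=0}^n c(n, k) Ĵ(k)`. -/
noncomputable def kernelSum (c : ℕ → ℕ → Kq) (Jhat : ℕ → Kq) (n : ℕ) : Kq :=
  ∑ k ∈ Finset.range (n + 1), c n k * Jhat k

/-! ### The codes as inputs of algorithms -/

def LinForm.equiv : LinForm ≃ ℤ × ℤ × ℤ where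
  toFun l := (l.a, l.b, l.c)
  invFun t := ⟨t.1, t.2.1, t.2.2⟩
  left_inv _ := rfl
  right_inv _ := rfl

instance : Primcodable LinForm := Primcodable.ofEquiv _ LinForm.equiv

def QFactor.equiv : QFactor ≃ RatCode × LinForm × LinForm where
  toFun f := (f.x, f.s, f.m)
  invFun t := ⟨t.1, t.2.1, t.2.2⟩
  left_inv _ := rfl
  right_inv _ := rfl

instance : Primcodable QFactor := Primcodable.ofEquiv _ QFactor.equiv

def QuadForm.equiv : QuadForm ≃ ℤ × ℤ × ℤ × LinForm where
  toFun e := (e.nn, e.nk, e.kk, e.lin)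
  invFun t := ⟨t.1, t.2.1, t.2.2.1, t.2.2.2⟩
  left_inv _ := rfl
  right_inv _ := rfl

instance : Primcodable QuadForm := Primcodable.ofEquiv _ QuadForm.equiv

def TermCode.equiv : TermCode ≃
    List (List RatCode) × RatCode × RatCode × QuadForm × List QFactor × List QFactor where
  toFun T := (T.poly, T.ξ, T.η, T.quad, T.num, T.den)
  invFun t := ⟨t.1, t.2.1, t.2.2.1, t.2.2.2.1, t.2.2.2.2.1, t.2.2.2.2.2⟩
  left_inv _ := rfl
  right_inv _ := rfl

instance : Primcodable TermCode := Primcodable.ofEquiv _ TermCode.equiv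

end QHolonomic

namespace QHolonomic

open Encodable

/-! ### Primitive recursive arithmetic on the integers -/

/-! The proof is an elimination in the manner of Fasenmyer, Wilf and Zeilberger, applied to a
deformation of the summand. Shifting `n` and `k` in a proper term multiplies it, generically, by
rational functions of `Q = q ^ n` and `K = q ^ k`. One seeks coefficients `α i j`, free of `K` and
not all zero, such that `∑ α i j c(n+i, k+j) Ĵ(k+j)` is, up to a common factor, a combination of
shifts of the equation for `Ĵ`. Summation over `k` then yields a recurrence for the sum. Three
things can fail: the shift quotients break down at zeros of quantum factorials, the ends of the
summation contribute, and the summed coefficients `∑_j α i j` may all vanish.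

A new variable `z` cures all three. Every parameter `x` becomes `x z`, so that `(x z q^s; q)_m` is a
quotient of the nowhere vanishing `(x z; q)_{s+m}` and `(x z; q)_s`. An extra factor `(qz; q)_k (qz;
q)_{n-k} / ((q; q)_k (q; q)_{n-k})` is `1` at `z = 1` for `0 ≤ k ≤ n` and vanishes for other `k`,
because `1/(q; q)_s = 0` for `s < 0`; the sum may then run over all integers `k`. A weight `z^(-Yk)`
turns the summed coefficients into `∑_j α i j z^(Yj)`, and some `Y` keeps one of them nonzero
(`exists_weight`). Dividing the summed recurrence by the largest common power of `z - 1` and putting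
`z = 1` leaves a nontrivial equation for `J`. This specialization takes place in the fraction field
of `ℚ(q)[[t]]` with `z = 1 + t`: the deformed sums are power series with constant terms `J(n+i)`
(`sum_result_mul_kernelSum`).

The `α i j` exist by counting (`exists_recurrence`). The degrees in `K` grow only linearly with the
order `N`. The conditions and the unknown cofactors `β` of the given equation agree in number up to
terms linear in `N`, so the `(N+1)^2` unknowns `α` decide for large `N`. A solution with all `α = 0`
would have `β = 0`, since the lowest nonzero coefficient of the equation can be cancelled.

Such a derivation is a finite amount of integer data, and its correctness is a finite list of
identities of Laurent polynomials. The algorithm enumerates candidate certificates until one passes: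
every valid certificate gives a correct equation (`satisfies_output`), and a valid one exists
(`exists_isValid`). The first assertion follows from the second, because every equation has an
integer code (`exists_toEq_eq`). -/

theorem primrec_int_ofNat : Primrec Int.ofNat := by
  refine Primrec.encode_iff.1 (Primrec.nat_double.of_eq fun n => ?_)
  rfl

theorem primrec_int_negSucc : Primrec Int.negSucc := by
  refine Primrec.encode_iff.1 (Primrec.nat_double_succ.of_eq fun n => ?_)
  rfl

/-- Nonnegative integers `n` have the even codes `2n`, and `-(n+1)` has the odd code `2n+1`. The
integer operations below reduce to natural ones through `x = x.toNat - (-x).toNat`. -/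
theorem primrec_int_toNat : Primrec Int.toNat := by
  have h : Primrec fun x : ℤ => if (encode x).bodd then 0 else (encode x).div2 :=
    Primrec.ite (Primrec.eq.comp (Primrec.nat_bodd.comp Primrec.encode) (Primrec.const true))
      (Primrec.const 0) (Primrec.nat_div2.comp Primrec.encode)
  refine h.of_eq fun x => ?_
  cases x with
  | ofNat n =>
    have : encode (n : ℤ) = 2 * n := rfl
    simp [this]
  | negSucc n =>
    have : encode (Int.negSucc n) = 2 * n + 1 := rfl
    simp [this]

theorem primrec_int_toNat_neg : Primrec fun x : ℤ => (-x).toNat := by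
  have h : Primrec fun x : ℤ => if (encode x).bodd then (encode x).div2 + 1 else 0 :=
    Primrec.ite (Primrec.eq.comp (Primrec.nat_bodd.comp Primrec.encode) (Primrec.const true))
      (Primrec.succ.comp (Primrec.nat_div2.comp Primrec.encode)) (Primrec.const 0)
  refine h.of_eq fun x => ?_
  cases x with
  | ofNat n =>
    have : encode (n : ℤ) = 2 * n := rfl
    simp [this]
  | negSucc n =>
    have : encode (Int.negSucc n) = 2 * n + 1 := rfl
    simp [this]

theorem primrec_int_sub_nat : Primrec₂ fun m n : ℕ => (m : ℤ) - n := by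
  have h : Primrec₂ fun m n : ℕ =>
      if n ≤ m then Int.ofNat (m - n) else Int.negSucc (n - m - 1) :=
    Primrec.ite (Primrec.nat_le.comp Primrec.snd Primrec.fst)
      (primrec_int_ofNat.comp (Primrec.nat_sub.comp Primrec.fst Primrec.snd))
      (primrec_int_negSucc.comp (Primrec.nat_sub.comp
        (Primrec.nat_sub.comp Primrec.snd Primrec.fst) (Primrec.const 1)))
  refine h.of_eq fun m n => ?_
  split_ifs with hmn
  · simp [Int.ofNat_sub hmn]
  · rw [Int.negSucc_eq]; omega

theorem primrec_int_add : Primrec₂ ((· + ·) : ℤ → ℤ → ℤ) := by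
  have h : Primrec₂ fun x y : ℤ =>
      ((x.toNat + y.toNat : ℕ) : ℤ) - (((-x).toNat + (-y).toNat : ℕ) : ℤ) :=
    primrec_int_sub_nat.comp
      (Primrec.nat_add.comp (primrec_int_toNat.comp Primrec.fst)
        (primrec_int_toNat.comp Primrec.snd))
      (Primrec.nat_add.comp (primrec_int_toNat_neg.comp Primrec.fst)
        (primrec_int_toNat_neg.comp Primrec.snd))
  exact h.of_eq fun x y => by omega

theorem primrec_int_neg : Primrec (Neg.neg : ℤ → ℤ) := by
  have h : Primrec fun x : ℤ => (((-x).toNat : ℕ) : ℤ) - (x.toNat : ℤ) :=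
    primrec_int_sub_nat.comp primrec_int_toNat_neg primrec_int_toNat
  exact h.of_eq fun x => by omega

theorem primrec_int_mul : Primrec₂ ((· * ·) : ℤ → ℤ → ℤ) := by
  have h : Primrec₂ fun x y : ℤ =>
      ((x.toNat * y.toNat + (-x).toNat * (-y).toNat : ℕ) : ℤ) -
        ((x.toNat * (-y).toNat + (-x).toNat * y.toNat : ℕ) : ℤ) :=
    primrec_int_sub_nat.comp
      (Primrec.nat_add.comp
        (Primrec.nat_mul.comp (primrec_int_toNat.comp Primrec.fst)
          (primrec_int_toNat.comp Primrec.snd))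
        (Primrec.nat_mul.comp (primrec_int_toNat_neg.comp Primrec.fst)
          (primrec_int_toNat_neg.comp Primrec.snd)))
      (Primrec.nat_add.comp
        (Primrec.nat_mul.comp (primrec_int_toNat.comp Primrec.fst)
          (primrec_int_toNat_neg.comp Primrec.snd))
        (Primrec.nat_mul.comp (primrec_int_toNat_neg.comp Primrec.fst)
          (primrec_int_toNat.comp Primrec.snd)))
  refine h.of_eq fun x y => ?_
  have hx : x = (x.toNat : ℤ) - ((-x).toNat : ℤ) := by omega
  have hy : y = (y.toNat : ℤ) - ((-y).toNat : ℤ) := by omega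
  conv_rhs => rw [hx, hy]
  push_cast
  ring

theorem primrec_int_natCast : Primrec (Nat.cast : ℕ → ℤ) := primrec_int_ofNat

theorem primrec_int_natAbs : Primrec Int.natAbs := by
  have h : Primrec fun x : ℤ => x.toNat + (-x).toNat :=
    Primrec.nat_add.comp primrec_int_toNat primrec_int_toNat_neg
  exact h.of_eq fun x => by omega

/-! ### Codes of Laurent polynomials

A Laurent polynomial with integer coefficients in the four variables `q`, `z`, `Q`, `K` is
described by the list of its terms, a term being a coefficient followed by the exponents. -/

abbrev Expo : Type := ℤ × ℤ × ℤ × ℤ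

abbrev LCode : Type := List (ℤ × Expo)

namespace LCode

def mono (a b c d : ℤ) : LCode := [(1, a, b, c, d)]

def const (c : ℤ) : LCode := [(c, 0, 0, 0, 0)]

def mul (l m : LCode) : LCode :=
  l.flatMap fun x => m.map fun y => (x.1 * y.1, x.2.1 + y.2.1, x.2.2.1 + y.2.2.1,
    x.2.2.2.1 + y.2.2.2.1, x.2.2.2.2 + y.2.2.2.2)

def neg (l : LCode) : LCode := l.map fun x => (-x.1, x.2)

def sub (l m : LCode) : LCode := l ++ neg m

def prod (l : List LCode) : LCode := l.foldr mul (const 1)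

def pow (l : LCode) (n : ℕ) : LCode := prod ((List.range n).map fun _ => l)

/-- Replaces `K` by `1`. -/
def dropK (l : LCode) : LCode := l.map fun x => (x.1, x.2.1, x.2.2.1, x.2.2.2.1, 0)

/-- `horner x [c₀, c₁, …] = c₀ + x c₁ + ⋯`. -/
def horner (x : LCode) (l : List LCode) : LCode := l.foldr (fun c s => c ++ mul x s) []

/-- The coefficient at a given exponent. -/
def coeffAt (l : LCode) (m : Expo) : ℤ :=
  l.foldr (fun x s => if x.2 = m then x.1 + s else s) 0

/-- Exponents may be repeated in a code, so like terms are collected; the exponents that occur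
suffice. -/
def IsZero (l : LCode) : Prop := ∀ x ∈ l, coeffAt l x.2 = 0

instance : DecidablePred IsZero := fun _ => inferInstanceAs (Decidable (∀ _ ∈ _, _))

/-! ### Primitive recursiveness of the operations on codes -/

section Primrec

variable {σ τ : Type*} [Primcodable σ] [Primcodable τ]

theorem primrec_mono {a b c d : σ → ℤ} (ha : Primrec a) (hb : Primrec b) (hc : Primrec c)
    (hd : Primrec d) : Primrec fun s => mono (a s) (b s) (c s) (d s) :=
  Primrec.list_cons.comp
    ((Primrec.const 1).pair (ha.pair (hb.pair (hc.pair hd)))) (Primrec.const [])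

theorem primrec_const : Primrec const :=
  Primrec.list_cons.comp (Primrec.id.pair (Primrec.const (0, 0, 0, 0))) (Primrec.const [])

theorem primrec_mul : Primrec₂ mul := by
  refine Primrec.list_flatMap Primrec.fst (Primrec.list_map (Primrec.snd.comp Primrec.fst) ?_)
  have hx : Primrec fun p : ((LCode × LCode) × (ℤ × Expo)) × (ℤ × Expo) => p.1.2 :=
    Primrec.snd.comp Primrec.fst
  have hy : Primrec fun p : ((LCode × LCode) × (ℤ × Expo)) × (ℤ × Expo) => p.2 := Primrec.snd
  have h1 {α β : Type} [Primcodable α] [Primcodable β] : Primrec (Prod.fst : α × β → α) :=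
    Primrec.fst
  have h2 {α β : Type} [Primcodable α] [Primcodable β] : Primrec (Prod.snd : α × β → β) :=
    Primrec.snd
  refine (primrec_int_mul.comp (h1.comp hx) (h1.comp hy)).pair ?_
  refine (primrec_int_add.comp (h1.comp (h2.comp hx)) (h1.comp (h2.comp hy))).pair ?_
  refine (primrec_int_add.comp (h1.comp (h2.comp (h2.comp hx)))
    (h1.comp (h2.comp (h2.comp hy)))).pair ?_
  exact (primrec_int_add.comp (h1.comp (h2.comp (h2.comp (h2.comp hx))))
    (h1.comp (h2.comp (h2.comp (h2.comp hy))))).pair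
    (primrec_int_add.comp (h2.comp (h2.comp (h2.comp (h2.comp hx))))
    (h2.comp (h2.comp (h2.comp (h2.comp hy)))))

theorem primrec_sub : Primrec₂ sub :=
  Primrec.list_append.comp Primrec.fst
    (Primrec.list_map Primrec.snd
      ((primrec_int_neg.comp (Primrec.fst.comp Primrec.snd)).pair (Primrec.snd.comp Primrec.snd)))

theorem primrec_prod : Primrec prod :=
  Primrec.list_foldr Primrec.id (Primrec.const _)
    (primrec_mul.comp (Primrec.fst.comp Primrec.snd) (Primrec.snd.comp Primrec.snd)).to₂

theorem primrec_pow : Primrec₂ pow :=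
  primrec_prod.comp (Primrec.list_map (Primrec.list_range.comp Primrec.snd)
    (Primrec.fst.comp Primrec.fst))

theorem primrec_dropK : Primrec dropK := by
  refine Primrec.list_map Primrec.id ?_
  have hx : Primrec fun p : LCode × (ℤ × Expo) => p.2 := Primrec.snd
  exact (Primrec.fst.comp hx).pair ((Primrec.fst.comp (Primrec.snd.comp hx)).pair
    ((Primrec.fst.comp (Primrec.snd.comp (Primrec.snd.comp hx))).pair
      ((Primrec.fst.comp (Primrec.snd.comp (Primrec.snd.comp (Primrec.snd.comp hx)))).pair
        (Primrec.const 0))))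

theorem primrec_horner : Primrec₂ horner :=
  Primrec.list_foldr Primrec.snd (Primrec.const _)
    (Primrec.list_append.comp (Primrec.fst.comp Primrec.snd)
      (primrec_mul.comp (Primrec.fst.comp Primrec.fst) (Primrec.snd.comp Primrec.snd))).to₂

theorem primrec_coeffAt : Primrec₂ coeffAt :=
  Primrec.list_foldr Primrec.fst (Primrec.const _)
    (Primrec.ite (Primrec.eq.comp (Primrec.snd.comp (Primrec.fst.comp Primrec.snd))
        (Primrec.snd.comp Primrec.fst))
      (primrec_int_add.comp (Primrec.fst.comp (Primrec.fst.comp Primrec.snd))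
        (Primrec.snd.comp Primrec.snd))
      (Primrec.snd.comp Primrec.snd)).to₂

theorem primrecPred_isZero : PrimrecPred IsZero := by
  have h : PrimrecRel fun (x : ℤ × Expo) (l : LCode) => coeffAt l x.2 = 0 :=
    Primrec.eq.comp (primrec_coeffAt.comp Primrec.snd (Primrec.snd.comp Primrec.fst))
      (Primrec.const 0)
  exact (h.forall_mem_list).comp Primrec.id Primrec.id

end Primrec

end LCode

end QHolonomic

namespace QHolonomic

open Encodable

open LCode

/-! ### The certificates -/

/-- The code of an element of `ℤ[q]`. -/
def intCode (l : List ℤ) : LCode := horner (mono 1 0 0 0) (l.map const)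

/-- The code of the value at `x` of an element of `ℤ[q][Q]`. -/
def intCode₂ (x : LCode) (l : List (List ℤ)) : LCode := horner x (l.map intCode)

def AllZero (l : List ℤ) : Prop := ∀ c ∈ l, c = 0

def AllZero₂ (l : List (List ℤ)) : Prop := ∀ m ∈ l, AllZero m

instance : DecidablePred AllZero := fun _ => inferInstanceAs (Decidable (∀ _ ∈ _, _))

instance : DecidablePred AllZero₂ := fun _ => inferInstanceAs (Decidable (∀ _ ∈ _, _))

/-- A numerator of `r.val`, paired with the nonzero denominator `ratDen r`. -/
def ratNum (r : RatCode) : List ℤ := if AllZero r.2 then [] else r.1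

/-- Division by zero has the value `0`, so a code with zero denominator is read as `0 / 1`. -/
def ratDen (r : RatCode) : List ℤ := if AllZero r.2 then [1] else r.2

/-- Horner's rule for fractions, without cancellation. -/
def fracHorner (x : LCode) (l : List (LCode × LCode)) : LCode × LCode :=
  l.foldr (fun c s => (mul c.1 s.2 ++ mul x (mul s.1 c.2), mul c.2 s.2)) ([], const 1)

def polyRow (x : LCode) (l : List RatCode) : LCode × LCode :=
  fracHorner x (l.map fun r => (intCode (ratNum r), intCode (ratDen r)))

/-- The polynomial factor of a term at `(n + i, k + j)`, as a fraction. -/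
def polyCode (p : List (List RatCode)) (i j : ℕ) : LCode × LCode :=
  fracHorner (mono j 0 0 1) (p.map (polyRow (mono i 0 1 0)))

/-- The quotient of the power of `q` at `(n + i, k + j)` by the one at `(n, k)`. -/
def quadCode (e : QuadForm) (i j : ℕ) : LCode :=
  mono (e.nn * ((i * (i - 1) / 2 : ℕ) : ℤ) + e.nk * ((i * j : ℕ) : ℤ) +
      e.kk * ((j * (j - 1) / 2 : ℕ) : ℤ) + e.lin.a * (i : ℤ) + e.lin.b * (j : ℤ)) 0
    (e.nn * (i : ℤ) + e.nk * (j : ℤ)) (e.nk * (i : ℤ) + e.kk * (j : ℤ))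

/-- A function `G` of an integer linear form `a n + b k + c`, subject to
`G (s + 1) = (1 - y q ^ s) G s` (if the last component is `true`) or to
`G s = (1 - y q ^ s) G (s + 1)` (if it is `false`), where `y = x z` or `y = x` according to the
second component. -/
abbrev Elem : Type := RatCode × Bool × (ℤ × ℤ × ℤ) × Bool

/-- `1 - y q ^ (s + t)` multiplied by the denominator of `x`. -/
def elemFactor (e : Elem) (t : ℤ) : LCode :=
  sub (intCode (ratDen e.1)) (mul (intCode (ratNum e.1))
    (mono (e.2.2.1.2.2 + t) (bif e.2.1 then 1 else 0) e.2.2.1.1 e.2.2.1.2.1))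

/-- A bound for `|a i + b j|` over all `i, j ≤ N`; adding it to `a i + b j` gives a number between
`0` and twice the bound. -/
def elemRange (e : Elem) (N : ℕ) : ℕ := (e.2.2.1.1.natAbs + e.2.2.1.2.1.natAbs) * N

def elemShift (e : Elem) (N i j : ℕ) : ℕ :=
  (e.2.2.1.1 * (i : ℤ) + e.2.2.1.2.1 * (j : ℤ) + (elemRange e N : ℤ)).toNat

/-- The factors leading from a base point independent of `i, j` to the shifted argument, so that no
division occurs. Each factor not needed is replaced by the denominator of `x`; the total power of
that denominator is then the same for all `i, j`. -/
def elemCode (N i j : ℕ) (e : Elem) : LCode :=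
  prod ((List.range (2 * elemRange e N)).map fun t =>
    if decide (t < elemShift e N i j) = e.2.2.2 then elemFactor e ((t : ℤ) - (elemRange e N : ℤ))
    else intCode (ratDen e.1))

def LinForm.triple (l : LinForm) : ℤ × ℤ × ℤ := (l.a, l.b, l.c)

def LinForm.addTriple (l m : LinForm) : ℤ × ℤ × ℤ := (l.a + m.a, l.b + m.b, l.c + m.c)

/-- The code of `q`. -/
def qRat : RatCode := ([0, 1], [1])

/-- The four factors of `(qz; q)_k (qz; q)_{n-k} / ((q; q)_k (q; q)_{n-k})`. The reciprocals are
left unperturbed so that they vanish at negative arguments. -/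
def boundaryElems : List Elem :=
  [(qRat, true, (0, 1, 0), true), (qRat, true, (1, -1, 0), true),
    (qRat, false, (0, 1, 0), false), (qRat, false, (1, -1, 0), false)]

/-- This encodes `(x z q^s; q)_m = (x z; q)_{s+m} / (x z; q)_s`, in which each factor depends on a
single linear form. -/
def numElems (f : QFactor) : List Elem :=
  [(f.x, true, f.s.addTriple f.m, true), (f.x, true, f.s.triple, false)]

def denElems (f : QFactor) : List Elem :=
  [(f.x, true, f.s.triple, true), (f.x, true, f.s.addTriple f.m, false)]

def elems (T : TermCode) : List Elem :=
  T.num.flatMap numElems ++ (T.den.flatMap denElems ++ boundaryElems)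

/-- The perturbed term at `(n + i, k + j)`, up to a factor that does not depend on
`i, j ≤ N`. -/
def termCode (T : TermCode) (N i j : ℕ) : LCode :=
  prod [(polyCode T.poly i j).1, pow (intCode T.ξ.1) i, pow (intCode T.ξ.2) (N - i),
    pow (intCode T.η.1) j, pow (intCode T.η.2) (N - j), quadCode T.quad i j,
    prod ((elems T).map (elemCode N i j))]

abbrev CoeffCode : Type := List (List ℤ) × List (List ℤ)

def eqNum (c : CoeffCode) : List (List ℤ) := if AllZero₂ c.2 then [] else c.1

def eqDen (c : CoeffCode) : List (List ℤ) := if AllZero₂ c.2 then [[1]] else c.2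

def eqEntry (P : EqCode) (i : ℕ) : CoeffCode := P.getD i ([], [[1]])

/-- The coefficient `a_i` of an equation at `Q = x`, multiplied by a common multiple of the
denominators, by their product, and by `(1 - q x) (1 - q ^ 2 x) ⋯`. -/
def eqCoeff (P : EqCode) (x : LCode) (i : ℕ) : LCode :=
  prod [intCode₂ x (eqNum (eqEntry P i)),
    prod ((List.range P.length).map fun l =>
      if l = i then const 1 else intCode₂ x (eqDen (eqEntry P l))),
    prod ((List.range P.length).map fun l => intCode₂ x (eqDen (eqEntry P l))),
    prod ((List.range P.length).map fun t => sub (const 1) (mul (mono ((t + 1 : ℕ) : ℤ) 0 0 0) x))]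

/-- The entries are: the order `N` of the recurrence, an exponent `Y`, an exponent `e`, the
coefficients `α` of a recurrence for the summand, the cofactors `β` of the given equation, the
coefficients `A` of the equation for the sum, and remainders `B`. -/
abbrev Cert : Type :=
  ℕ × ℕ × ℕ × List (List LCode) × List LCode × List (List (List ℤ)) × List LCode

namespace Cert

def order (c : Cert) : ℕ := c.1
def weight (c : Cert) : ℕ := c.2.1
def multiplicity (c : Cert) : ℕ := c.2.2.1
def alpha (c : Cert) (i j : ℕ) : LCode := dropK ((c.2.2.2.1.getD j []).getD i [])
def beta (c : Cert) (l : ℕ) : LCode := c.2.2.2.2.1.getD l []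
def result (c : Cert) (i : ℕ) : List (List ℤ) := c.2.2.2.2.2.1.getD i []
def remainder (c : Cert) (i : ℕ) : LCode := c.2.2.2.2.2.2.getD i []

/-- Compares the coefficients of `Ĵ(k+j)` in the recurrence for the summand and in `∑ β_l` times the
equation shifted by `l`. The range of `l` is exactly that for which the shifted equation involves no
`Ĵ(k+j)` with `j > N`, when the equation is nonempty. -/
def termRelation (P : EqCode) (T : TermCode) (c : Cert) (j : ℕ) : LCode :=
  sub ((List.range (c.order + 1)).flatMap fun i => mul (c.alpha i j) (termCode T c.order i j))
    ((List.range (c.order + 2 - P.length)).flatMap fun l =>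
      if l ≤ j then mul (c.beta l) (eqCoeff P (mono (l : ℤ) 0 0 1) (j - l)) else [])

def zSubOne : LCode := sub (mono 0 1 0 0) (const 1)

/-- The vanishing of this code says that `A_i` is the value at `z = 1` of `∑_j α i j z^(Yj)` divided
by `(z - 1)^e`; the exponent `e` is common to all `i`. -/
def sumRelation (c : Cert) (i : ℕ) : LCode :=
  sub ((List.range (c.order + 1)).flatMap fun j =>
      mul (c.alpha i j) (mono 0 ((c.weight * j : ℕ) : ℤ) 0 0))
    (mul (pow zSubOne c.multiplicity)
      (intCode₂ (mono 0 0 1 0) (c.result i) ++ mul zSubOne (c.remainder i)))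

def IsValid (P : EqCode) (T : TermCode) (c : Cert) : Prop :=
  (∀ j < c.order + 1, (termRelation P T c j).IsZero) ∧
    (∀ i < c.order + 1, (sumRelation c i).IsZero) ∧
    ∃ i < c.order + 1, ¬ AllZero₂ (c.result i)

def output (c : Cert) : EqCode := (List.range (c.order + 1)).map fun i => (c.result i, [[1]])

end Cert

/-! ### Primitive recursiveness of checking a certificate, and the search -/

section Primrec

theorem primrec_intCode : Primrec intCode :=
  primrec_horner.comp (Primrec.const _)
    (Primrec.list_map Primrec.id (primrec_const.comp Primrec.snd).to₂)

theorem primrec_intCode₂ : Primrec₂ intCode₂ :=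
  primrec_horner.comp Primrec.fst
    (Primrec.list_map Primrec.snd (primrec_intCode.comp Primrec.snd).to₂)

theorem primrecPred_allZero : PrimrecPred AllZero :=
  PrimrecPred.forall_mem_list (p := fun c : ℤ => c = 0)
    (Primrec.eq.comp Primrec.id (Primrec.const 0))

theorem primrecPred_allZero₂ : PrimrecPred AllZero₂ :=
  PrimrecPred.forall_mem_list (p := AllZero) primrecPred_allZero

theorem primrec_ratNum : Primrec ratNum :=
  Primrec.ite (primrecPred_allZero.comp Primrec.snd) (Primrec.const []) Primrec.fst

theorem primrec_ratDen : Primrec ratDen :=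
  Primrec.ite (primrecPred_allZero.comp Primrec.snd) (Primrec.const [1]) Primrec.snd

theorem primrec_fracHorner : Primrec₂ fracHorner := by
  have hx : Primrec fun p : (LCode × List (LCode × LCode)) × (LCode × LCode) × LCode × LCode =>
    p.1.1 := Primrec.fst.comp Primrec.fst
  have hc : Primrec fun p : (LCode × List (LCode × LCode)) × (LCode × LCode) × LCode × LCode =>
    p.2.1 := Primrec.fst.comp Primrec.snd
  have hs : Primrec fun p : (LCode × List (LCode × LCode)) × (LCode × LCode) × LCode × LCode =>
    p.2.2 := Primrec.snd.comp Primrec.snd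
  exact Primrec.list_foldr Primrec.snd (Primrec.const ([], const 1))
    ((Primrec.list_append.comp (primrec_mul.comp (Primrec.fst.comp hc) (Primrec.snd.comp hs))
    (primrec_mul.comp hx (primrec_mul.comp (Primrec.fst.comp hs) (Primrec.snd.comp hc)))).pair
    (primrec_mul.comp (Primrec.snd.comp hc) (Primrec.snd.comp hs))).to₂

theorem primrec_polyRow : Primrec₂ polyRow :=
  primrec_fracHorner.comp Primrec.fst (Primrec.list_map Primrec.snd
    (((primrec_intCode.comp (primrec_ratNum.comp Primrec.snd)).pair
      (primrec_intCode.comp (primrec_ratDen.comp Primrec.snd))).to₂))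

theorem primrec_polyCode {σ : Type*} [Primcodable σ] {p : σ → List (List RatCode)} {i j : σ → ℕ}
    (hp : Primrec p) (hi : Primrec i) (hj : Primrec j) :
    Primrec fun s => polyCode (p s) (i s) (j s) := by
  refine primrec_fracHorner.comp (primrec_mono (primrec_int_natCast.comp hj) (Primrec.const 0)
    (Primrec.const 0) (Primrec.const 1)) (Primrec.list_map hp ?_)
  exact primrec_polyRow.comp (primrec_mono (primrec_int_natCast.comp (hi.comp Primrec.fst))
    (Primrec.const 0) (Primrec.const 1) (Primrec.const 0)) Primrec.snd

theorem primrec_linForm_triple : Primrec LinForm.triple := Primrec.of_equiv (e := LinForm.equiv)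

theorem primrec_linForm_a : Primrec LinForm.a := Primrec.fst.comp primrec_linForm_triple

theorem primrec_linForm_b : Primrec LinForm.b :=
  Primrec.fst.comp (Primrec.snd.comp primrec_linForm_triple)

theorem primrec_linForm_c : Primrec LinForm.c :=
  Primrec.snd.comp (Primrec.snd.comp primrec_linForm_triple)

theorem primrec_linForm_addTriple : Primrec₂ LinForm.addTriple :=
  (primrec_int_add.comp (primrec_linForm_a.comp Primrec.fst)
    (primrec_linForm_a.comp Primrec.snd)).pair
    ((primrec_int_add.comp (primrec_linForm_b.comp Primrec.fst)
      (primrec_linForm_b.comp Primrec.snd)).pair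
      (primrec_int_add.comp (primrec_linForm_c.comp Primrec.fst)
        (primrec_linForm_c.comp Primrec.snd)))

theorem primrec_quadForm_equiv : Primrec QuadForm.equiv := Primrec.of_equiv

theorem primrec_qFactor_equiv : Primrec QFactor.equiv := Primrec.of_equiv

theorem primrec_termCode_equiv : Primrec TermCode.equiv := Primrec.of_equiv

theorem primrec_quadCode {σ : Type*} [Primcodable σ] {e : σ → QuadForm} {i j : σ → ℕ}
    (he : Primrec e) (hi : Primrec i) (hj : Primrec j) :
    Primrec fun s => quadCode (e s) (i s) (j s) := by
  have h := primrec_quadForm_equiv.comp he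
  have hnn : Primrec fun s => (e s).nn := Primrec.fst.comp h
  have hnk : Primrec fun s => (e s).nk := Primrec.fst.comp (Primrec.snd.comp h)
  have hkk : Primrec fun s => (e s).kk := Primrec.fst.comp (Primrec.snd.comp (Primrec.snd.comp h))
  have hlin : Primrec fun s => (e s).lin :=
    Primrec.snd.comp (Primrec.snd.comp (Primrec.snd.comp h))
  have hi' := primrec_int_natCast.comp hi
  have hj' := primrec_int_natCast.comp hj
  have half {f : σ → ℕ} (hf : Primrec f) :
      Primrec fun s => ((f s * (f s - 1) / 2 : ℕ) : ℤ) :=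
    primrec_int_natCast.comp (Primrec.nat_div.comp (Primrec.nat_mul.comp hf
      (Primrec.nat_sub.comp hf (Primrec.const 1))) (Primrec.const 2))
  have hij : Primrec fun s => ((i s * j s : ℕ) : ℤ) :=
    primrec_int_natCast.comp (Primrec.nat_mul.comp hi hj)
  have add {f g : σ → ℤ} (hf : Primrec f) (hg : Primrec g) : Primrec fun s => f s + g s :=
    primrec_int_add.comp hf hg
  have mul {f g : σ → ℤ} (hf : Primrec f) (hg : Primrec g) : Primrec fun s => f s * g s :=
    primrec_int_mul.comp hf hg
  exact primrec_mono (add (add (add (add (mul hnn (half hi)) (mul hnk hij)) (mul hkk (half hj)))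
    (mul (primrec_linForm_a.comp hlin) hi')) (mul (primrec_linForm_b.comp hlin) hj'))
    (Primrec.const 0) (add (mul hnn hi') (mul hnk hj')) (add (mul hnk hi') (mul hkk hj'))

theorem primrec_elem_a : Primrec fun e : Elem => e.2.2.1.1 :=
  Primrec.fst.comp (Primrec.fst.comp (Primrec.snd.comp Primrec.snd))

theorem primrec_elem_b : Primrec fun e : Elem => e.2.2.1.2.1 :=
  Primrec.fst.comp (Primrec.snd.comp (Primrec.fst.comp (Primrec.snd.comp Primrec.snd)))

theorem primrec_elem_c : Primrec fun e : Elem => e.2.2.1.2.2 :=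
  Primrec.snd.comp (Primrec.snd.comp (Primrec.fst.comp (Primrec.snd.comp Primrec.snd)))

theorem primrec_elemFactor : Primrec₂ elemFactor := by
  have hx : Primrec fun p : Elem × ℤ => p.1.1 := Primrec.fst.comp Primrec.fst
  refine primrec_sub.comp (primrec_intCode.comp (primrec_ratDen.comp hx))
    (primrec_mul.comp (primrec_intCode.comp (primrec_ratNum.comp hx)) (primrec_mono ?_ ?_ ?_ ?_))
  · exact primrec_int_add.comp (primrec_elem_c.comp Primrec.fst) Primrec.snd
  · exact Primrec.cond (Primrec.fst.comp (Primrec.snd.comp Primrec.fst)) (Primrec.const 1)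
      (Primrec.const 0)
  · exact primrec_elem_a.comp Primrec.fst
  · exact primrec_elem_b.comp Primrec.fst

theorem primrec_elemRange : Primrec₂ elemRange :=
  Primrec.nat_mul.comp (Primrec.nat_add.comp
    (primrec_int_natAbs.comp (primrec_elem_a.comp Primrec.fst))
    (primrec_int_natAbs.comp (primrec_elem_b.comp Primrec.fst))) Primrec.snd

theorem primrec_elemShift {σ : Type*} [Primcodable σ] {e : σ → Elem} {N i j : σ → ℕ}
    (he : Primrec e) (hN : Primrec N) (hi : Primrec i) (hj : Primrec j) :
    Primrec fun s => elemShift (e s) (N s) (i s) (j s) :=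
  primrec_int_toNat.comp (primrec_int_add.comp (primrec_int_add.comp
    (primrec_int_mul.comp (primrec_elem_a.comp he) (primrec_int_natCast.comp hi))
    (primrec_int_mul.comp (primrec_elem_b.comp he) (primrec_int_natCast.comp hj)))
    (primrec_int_natCast.comp (primrec_elemRange.comp he hN)))

theorem primrec_elemCode {σ : Type*} [Primcodable σ] {e : σ → Elem} {N i j : σ → ℕ}
    (he : Primrec e) (hN : Primrec N) (hi : Primrec i) (hj : Primrec j) :
    Primrec fun s => elemCode (N s) (i s) (j s) (e s) := by
  have hM : Primrec fun s => elemRange (e s) (N s) := primrec_elemRange.comp he hN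
  refine primrec_prod.comp (Primrec.list_map (Primrec.list_range.comp
    (Primrec.nat_mul.comp (Primrec.const 2) hM)) ?_)
  refine Primrec.ite ?_ ?_ ?_
  · refine Primrec.eq.comp (Primrec.nat_lt.decide.comp Primrec.snd
      ((primrec_elemShift he hN hi hj).comp Primrec.fst)) ?_
    exact Primrec.snd.comp (Primrec.snd.comp (Primrec.snd.comp (he.comp Primrec.fst)))
  · exact primrec_elemFactor.comp (he.comp Primrec.fst)
      (primrec_int_sub_nat.comp Primrec.snd (hM.comp Primrec.fst))
  · exact primrec_intCode.comp (primrec_ratDen.comp (Primrec.fst.comp (he.comp Primrec.fst)))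

theorem primrec_qFactor_x : Primrec QFactor.x := Primrec.fst.comp primrec_qFactor_equiv

theorem primrec_qFactor_s : Primrec QFactor.s :=
  Primrec.fst.comp (Primrec.snd.comp primrec_qFactor_equiv)

theorem primrec_qFactor_m : Primrec QFactor.m :=
  Primrec.snd.comp (Primrec.snd.comp primrec_qFactor_equiv)

theorem primrec_elem_mk {σ : Type*} [Primcodable σ] {x : σ → RatCode} {l : σ → ℤ × ℤ × ℤ}
    (b c : Bool) (hx : Primrec x) (hl : Primrec l) :
    Primrec fun s => ((x s, b, l s, c) : Elem) :=
  hx.pair ((Primrec.const b).pair (hl.pair (Primrec.const c)))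

theorem primrec_numElems : Primrec numElems := by
  have hs := primrec_linForm_triple.comp primrec_qFactor_s
  have hm := primrec_linForm_addTriple.comp primrec_qFactor_s primrec_qFactor_m
  exact Primrec.list_cons.comp (primrec_elem_mk _ _ primrec_qFactor_x hm)
    (Primrec.list_cons.comp (primrec_elem_mk _ _ primrec_qFactor_x hs) (Primrec.const []))

theorem primrec_denElems : Primrec denElems := by
  have hs := primrec_linForm_triple.comp primrec_qFactor_s
  have hm := primrec_linForm_addTriple.comp primrec_qFactor_s primrec_qFactor_m
  exact Primrec.list_cons.comp (primrec_elem_mk _ _ primrec_qFactor_x hs)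
    (Primrec.list_cons.comp (primrec_elem_mk _ _ primrec_qFactor_x hm) (Primrec.const []))

theorem primrec_termCode_poly : Primrec TermCode.poly := Primrec.fst.comp primrec_termCode_equiv

theorem primrec_termCode_ξ : Primrec TermCode.ξ :=
  Primrec.fst.comp (Primrec.snd.comp primrec_termCode_equiv)

theorem primrec_termCode_η : Primrec TermCode.η :=
  Primrec.fst.comp (Primrec.snd.comp (Primrec.snd.comp primrec_termCode_equiv))

theorem primrec_termCode_quad : Primrec TermCode.quad :=
  Primrec.fst.comp (Primrec.snd.comp (Primrec.snd.comp (Primrec.snd.comp primrec_termCode_equiv)))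

theorem primrec_termCode_num : Primrec TermCode.num :=
  Primrec.fst.comp (Primrec.snd.comp (Primrec.snd.comp (Primrec.snd.comp (Primrec.snd.comp
    primrec_termCode_equiv))))

theorem primrec_termCode_den : Primrec TermCode.den :=
  Primrec.snd.comp (Primrec.snd.comp (Primrec.snd.comp (Primrec.snd.comp (Primrec.snd.comp
    primrec_termCode_equiv))))

theorem primrec_elems : Primrec elems :=
  Primrec.list_append.comp
    (Primrec.list_flatMap primrec_termCode_num (primrec_numElems.comp Primrec.snd).to₂)
    (Primrec.list_append.comp
      (Primrec.list_flatMap primrec_termCode_den (primrec_denElems.comp Primrec.snd).to₂)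
      (Primrec.const _))

theorem primrec_termCode {σ : Type*} [Primcodable σ] {T : σ → TermCode} {N i j : σ → ℕ}
    (hT : Primrec T) (hN : Primrec N) (hi : Primrec i) (hj : Primrec j) :
    Primrec fun s => termCode (T s) (N s) (i s) (j s) := by
  have cons {f : σ → LCode} {g : σ → List LCode} (hf : Primrec f) (hg : Primrec g) :
      Primrec fun s => f s :: g s := Primrec.list_cons.comp hf hg
  have pow {f : σ → List ℤ} {g : σ → ℕ} (hf : Primrec f) (hg : Primrec g) :
      Primrec fun s => LCode.pow (intCode (f s)) (g s) :=
    primrec_pow.comp (primrec_intCode.comp hf) hg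
  have hξ := primrec_termCode_ξ.comp hT
  have hη := primrec_termCode_η.comp hT
  refine primrec_prod.comp (cons ?_ (cons ?_ (cons ?_ (cons ?_ (cons ?_ (cons ?_ (cons ?_
    (Primrec.const []))))))))
  · exact Primrec.fst.comp (primrec_polyCode (primrec_termCode_poly.comp hT) hi hj)
  · exact pow (Primrec.fst.comp hξ) hi
  · exact pow (Primrec.snd.comp hξ) (Primrec.nat_sub.comp hN hi)
  · exact pow (Primrec.fst.comp hη) hj
  · exact pow (Primrec.snd.comp hη) (Primrec.nat_sub.comp hN hj)
  · exact primrec_quadCode (primrec_termCode_quad.comp hT) hi hj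
  · exact primrec_prod.comp (Primrec.list_map (primrec_elems.comp hT)
      (primrec_elemCode Primrec.snd (hN.comp Primrec.fst) (hi.comp Primrec.fst)
        (hj.comp Primrec.fst)).to₂)

theorem primrec_eqNum : Primrec eqNum :=
  Primrec.ite (primrecPred_allZero₂.comp Primrec.snd) (Primrec.const []) Primrec.fst

theorem primrec_eqDen : Primrec eqDen :=
  Primrec.ite (primrecPred_allZero₂.comp Primrec.snd) (Primrec.const [[1]]) Primrec.snd

theorem primrec_eqEntry : Primrec₂ eqEntry := Primrec.list_getD _

theorem primrec_eqCoeff {σ : Type*} [Primcodable σ] {P : σ → EqCode} {x : σ → LCode} {i : σ → ℕ}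
    (hP : Primrec P) (hx : Primrec x) (hi : Primrec i) :
    Primrec fun s => eqCoeff (P s) (x s) (i s) := by
  have cons {f : σ → LCode} {g : σ → List LCode} (hf : Primrec f) (hg : Primrec g) :
      Primrec fun s => f s :: g s := Primrec.list_cons.comp hf hg
  have hlen : Primrec fun s => List.range (P s).length :=
    Primrec.list_range.comp (Primrec.list_length.comp hP)
  have hden : Primrec fun p : σ × ℕ => intCode₂ (x p.1) (eqDen (eqEntry (P p.1) p.2)) :=
    primrec_intCode₂.comp (hx.comp Primrec.fst)
      (primrec_eqDen.comp (primrec_eqEntry.comp (hP.comp Primrec.fst) Primrec.snd))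
  refine primrec_prod.comp (cons ?_ (cons ?_ (cons ?_ (cons ?_ (Primrec.const [])))))
  · exact primrec_intCode₂.comp hx (primrec_eqNum.comp (primrec_eqEntry.comp hP hi))
  · exact primrec_prod.comp (Primrec.list_map hlen (Primrec.ite
      (Primrec.eq.comp Primrec.snd (hi.comp Primrec.fst)) (Primrec.const _) hden).to₂)
  · exact primrec_prod.comp (Primrec.list_map hlen hden.to₂)
  · exact primrec_prod.comp (Primrec.list_map hlen (primrec_sub.comp (Primrec.const _)
      (primrec_mul.comp (primrec_mono (primrec_int_natCast.comp (Primrec.succ.comp Primrec.snd))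
        (Primrec.const 0) (Primrec.const 0) (Primrec.const 0)) (hx.comp Primrec.fst))).to₂)

namespace Cert

theorem primrec_order : Primrec order := Primrec.fst

theorem primrec_weight : Primrec weight := Primrec.fst.comp Primrec.snd

theorem primrec_multiplicity : Primrec multiplicity :=
  Primrec.fst.comp (Primrec.snd.comp Primrec.snd)

theorem primrec_alpha {σ : Type*} [Primcodable σ] {c : σ → Cert} {i j : σ → ℕ}
    (hc : Primrec c) (hi : Primrec i) (hj : Primrec j) :
    Primrec fun s => (c s).alpha (i s) (j s) :=
  primrec_dropK.comp ((Primrec.list_getD []).comp ((Primrec.list_getD []).comp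
    (Primrec.fst.comp (Primrec.snd.comp (Primrec.snd.comp (Primrec.snd.comp hc)))) hj) hi)

theorem primrec_beta : Primrec₂ beta :=
  (Primrec.list_getD []).comp (Primrec.fst.comp (Primrec.snd.comp (Primrec.snd.comp
    (Primrec.snd.comp (Primrec.snd.comp Primrec.fst))))) Primrec.snd

theorem primrec_result : Primrec₂ result :=
  (Primrec.list_getD []).comp (Primrec.fst.comp (Primrec.snd.comp (Primrec.snd.comp
    (Primrec.snd.comp (Primrec.snd.comp (Primrec.snd.comp Primrec.fst)))))) Primrec.snd

theorem primrec_remainder : Primrec₂ remainder :=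
  (Primrec.list_getD []).comp (Primrec.snd.comp (Primrec.snd.comp (Primrec.snd.comp
    (Primrec.snd.comp (Primrec.snd.comp (Primrec.snd.comp Primrec.fst)))))) Primrec.snd

theorem primrec_termRelation {σ : Type*} [Primcodable σ] {P : σ → EqCode} {T : σ → TermCode}
    {c : σ → Cert} {j : σ → ℕ} (hP : Primrec P) (hT : Primrec T) (hc : Primrec c)
    (hj : Primrec j) : Primrec fun s => termRelation (P s) (T s) (c s) (j s) := by
  have hN := primrec_order.comp hc
  refine primrec_sub.comp
    (Primrec.list_flatMap (Primrec.list_range.comp (Primrec.succ.comp hN)) ?_)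
    (Primrec.list_flatMap (Primrec.list_range.comp (Primrec.nat_sub.comp
      (Primrec.nat_add.comp hN (Primrec.const 2)) (Primrec.list_length.comp hP))) ?_)
  · exact primrec_mul.comp (primrec_alpha (hc.comp Primrec.fst) Primrec.snd (hj.comp Primrec.fst))
      (primrec_termCode (hT.comp Primrec.fst) (hN.comp Primrec.fst) Primrec.snd
        (hj.comp Primrec.fst))
  refine Primrec.ite (Primrec.nat_le.comp Primrec.snd (hj.comp Primrec.fst)) ?_ (Primrec.const [])
  · exact primrec_mul.comp (primrec_beta.comp (hc.comp Primrec.fst) Primrec.snd)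
      (primrec_eqCoeff (hP.comp Primrec.fst) (primrec_mono
        (primrec_int_natCast.comp Primrec.snd) (Primrec.const 0) (Primrec.const 0)
        (Primrec.const 1)) (Primrec.nat_sub.comp (hj.comp Primrec.fst) Primrec.snd))

theorem primrec_sumRelation : Primrec₂ sumRelation := by
  have hN : Primrec fun p : Cert × ℕ => p.1.order := primrec_order.comp Primrec.fst
  have h1 : Primrec fun p : Cert × ℕ => (List.range (p.1.order + 1)).flatMap fun j =>
      mul (p.1.alpha p.2 j) (mono 0 ((p.1.weight * j : ℕ) : ℤ) 0 0) := by
    refine Primrec.list_flatMap (Primrec.list_range.comp (Primrec.succ.comp hN)) ?_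
    exact primrec_mul.comp (primrec_alpha (Primrec.fst.comp Primrec.fst)
      (Primrec.snd.comp Primrec.fst) Primrec.snd) (primrec_mono (Primrec.const 0)
      (primrec_int_natCast.comp (Primrec.nat_mul.comp
        (primrec_weight.comp (Primrec.fst.comp Primrec.fst)) Primrec.snd)) (Primrec.const 0)
      (Primrec.const 0))
  have h2 : Primrec fun p : Cert × ℕ => pow zSubOne p.1.multiplicity :=
    primrec_pow.comp (Primrec.const zSubOne) (primrec_multiplicity.comp Primrec.fst)
  have h3 : Primrec fun p : Cert × ℕ => intCode₂ (mono 0 0 1 0) (p.1.result p.2) :=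
    primrec_intCode₂.comp (Primrec.const (mono 0 0 1 0)) primrec_result
  have h4 : Primrec fun p : Cert × ℕ => mul zSubOne (p.1.remainder p.2) :=
    primrec_mul.comp (Primrec.const zSubOne) primrec_remainder
  exact primrec_sub.comp h1 (primrec_mul.comp h2 (Primrec.list_append.comp h3 h4))

theorem primrec_output : Primrec output :=
  Primrec.list_map (Primrec.list_range.comp (Primrec.succ.comp primrec_order))
    (Primrec.pair primrec_result (Primrec.const [[1]])).to₂

theorem primrecPred_isValid :
    PrimrecPred fun s : (EqCode × TermCode) × Cert => s.2.IsValid s.1.1 s.1.2 := by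
  have h1 : PrimrecRel fun (j : ℕ) (s : (EqCode × TermCode) × Cert) =>
      (termRelation s.1.1 s.1.2 s.2 j).IsZero :=
    primrecPred_isZero.comp (primrec_termRelation
      (Primrec.fst.comp (Primrec.fst.comp Primrec.snd))
      (Primrec.snd.comp (Primrec.fst.comp Primrec.snd)) (Primrec.snd.comp Primrec.snd) Primrec.fst)
  have h2 : PrimrecRel fun (i : ℕ) (s : (EqCode × TermCode) × Cert) =>
      (sumRelation s.2 i).IsZero :=
    primrecPred_isZero.comp (primrec_sumRelation.comp (Primrec.snd.comp Primrec.snd) Primrec.fst)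
  have h3 : PrimrecRel fun (i : ℕ) (s : (EqCode × TermCode) × Cert) =>
      ¬ AllZero₂ (result s.2 i) :=
    (primrecPred_allZero₂.comp
      (primrec_result.comp (Primrec.snd.comp Primrec.snd) Primrec.fst)).not
  have hr : Primrec fun s : (EqCode × TermCode) × Cert => List.range (s.2.order + 1) :=
    Primrec.list_range.comp (Primrec.succ.comp (primrec_order.comp Primrec.snd))
  have h1' := h1.forall_mem_list.comp hr Primrec.id
  have h2' := h2.forall_mem_list.comp hr Primrec.id
  have h3' := h3.exists_mem_list.comp hr Primrec.id
  refine (h1'.and (h2'.and h3')).of_eq fun s => ?_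
  simp only [List.mem_range, IsValid, id]

instance (P : EqCode) (T : TermCode) : DecidablePred (IsValid P T) := fun _ =>
  inferInstanceAs (Decidable ((∀ _ < _, _) ∧ (∀ _ < _, _) ∧ ∃ _ < _, _))

end Cert

/-- The search for a certificate. -/
def certSearch (s : EqCode × TermCode) : Part EqCode :=
  Nat.rfindOpt fun n => (decode (α := Cert) n).bind fun c =>
    if c.IsValid s.1 s.2 then some c.output else none

theorem partrec_certSearch : Partrec certSearch := by
  refine Partrec.rfindOpt (Primrec₂.to_comp ?_)
  refine Primrec.option_bind (Primrec.decode.comp Primrec.snd) ?_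
  refine Primrec.ite ?_ ?_ (Primrec.const none)
  · exact Cert.primrecPred_isValid.comp
      ((Primrec.fst.comp Primrec.fst).pair Primrec.snd)
  · exact Primrec.option_some.comp (Cert.primrec_output.comp Primrec.snd)

/-- The given certificate only guarantees that the search stops; the one found may be different. -/
theorem exists_mem_certSearch {P : EqCode} {T : TermCode} (h : ∃ c : Cert, c.IsValid P T) :
    ∃ c : Cert, c.IsValid P T ∧ c.output ∈ certSearch (P, T) := by
  obtain ⟨c, hc⟩ := h
  have hd : (certSearch (P, T)).Dom := by
    refine Nat.rfindOpt_dom.2 ⟨encode c, c.output, ?_⟩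
    rw [encodek, Option.bind_some, if_pos hc]
    rfl
  obtain ⟨n, hn⟩ := Nat.rfindOpt_spec (Part.get_mem hd)
  obtain ⟨c', -, hc'⟩ := Option.bind_eq_some_iff.1 hn
  split_ifs at hc' with hv
  refine ⟨c', hv, ?_⟩
  rw [Option.some.inj hc']
  exact Part.get_mem hd

end Primrec

end QHolonomic

namespace QHolonomic

open LCode LaurentPolynomial

/-! ### Evaluation of the codes -/

/-- Laurent polynomials in `q`, `z`, `Q`. -/
abbrev LR : Type := AddMonoidAlgebra ℤ (ℤ × ℤ × ℤ)

/-- Laurent polynomials in `q`, `z`, `Q`, `K`. -/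
abbrev LK : Type := LaurentPolynomial LR

noncomputable def monR (x a b c : ℤ) : LR := .single (a, b, c) x

noncomputable def monK (x a b c d : ℤ) : LK := C (monR x a b c) * T d

theorem monR_mul (x a b c x' a' b' c' : ℤ) :
    monR x a b c * monR x' a' b' c' = monR (x * x') (a + a') (b + b') (c + c') := by
  simp [monR, AddMonoidAlgebra.single_mul_single]

theorem monK_mul (x a b c d x' a' b' c' d' : ℤ) :
    monK x a b c d * monK x' a' b' c' d' =
      monK (x * x') (a + a') (b + b') (c + c') (d + d') := by
  rw [monK, monK, monK, ← monR_mul, map_mul, T_add]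
  ring

theorem monR_neg (x a b c : ℤ) : monR (-x) a b c = -monR x a b c := by
  simp [monR]

theorem monK_neg (x a b c d : ℤ) : monK (-x) a b c d = -monK x a b c d := by
  rw [monK, monK, monR_neg, map_neg]
  ring

theorem monR_one : monR 1 0 0 0 = 1 := rfl

theorem monR_int (x : ℤ) : monR x 0 0 0 = (x : LR) := by
  rw [← zsmul_one, ← monR_one, monR, monR, AddMonoidAlgebra.smul_single]
  simp

namespace LCode

noncomputable def val (l : LCode) : LK :=
  (l.map fun x => monK x.1 x.2.1 x.2.2.1 x.2.2.2.1 x.2.2.2.2).sum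

@[simp] theorem val_nil : val [] = 0 := rfl

theorem val_cons (x : ℤ × Expo) (l : LCode) :
    val (x :: l) = monK x.1 x.2.1 x.2.2.1 x.2.2.2.1 x.2.2.2.2 + val l := by
  simp [val]

@[simp] theorem val_append (l m : LCode) : val (l ++ m) = val l + val m := by
  simp [val]

@[simp] theorem val_mono (a b c d : ℤ) : val (mono a b c d) = monK 1 a b c d := by
  simp [val, mono]

theorem monK_int (c : ℤ) : monK c 0 0 0 0 = (c : LK) := by
  simp [monK, monR_int]

@[simp] theorem val_const (c : ℤ) : val (const c) = (c : LK) := by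
  simp [val, const, monK_int]

@[simp] theorem val_mul (l m : LCode) : val (mul l m) = val l * val m := by
  have h : ∀ x : ℤ × Expo, val (m.map fun y => (x.1 * y.1, x.2.1 + y.2.1, x.2.2.1 + y.2.2.1,
      x.2.2.2.1 + y.2.2.2.1, x.2.2.2.2 + y.2.2.2.2)) =
      monK x.1 x.2.1 x.2.2.1 x.2.2.2.1 x.2.2.2.2 * val m := by
    intro x
    induction m with
    | nil => simp
    | cons y m ih => rw [List.map_cons, val_cons, ih, val_cons, mul_add, monK_mul]
  induction l with
  | nil => simp [mul]
  | cons x l ih =>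
    have : mul (x :: l) m = (m.map fun y => (x.1 * y.1, x.2.1 + y.2.1, x.2.2.1 + y.2.2.1,
      x.2.2.2.1 + y.2.2.2.1, x.2.2.2.2 + y.2.2.2.2)) ++ mul l m := by simp [mul]
    rw [this, val_append, ih, h, val_cons, add_mul]

@[simp] theorem val_neg (l : LCode) : val (neg l) = -val l := by
  induction l with
  | nil => simp [neg]
  | cons x l ih =>
    have : neg (x :: l) = (-x.1, x.2) :: neg l := rfl
    rw [this, val_cons, val_cons, ih, monK_neg]
    ring

@[simp] theorem val_sub (l m : LCode) : val (sub l m) = val l - val m := by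
  simp [sub, sub_eq_add_neg]

@[simp] theorem val_prod (l : List LCode) : val (prod l) = (l.map val).prod := by
  induction l with
  | nil => simp [prod]
  | cons x l ih =>
    have : prod (x :: l) = mul x (prod l) := rfl
    rw [this, val_mul, ih, List.map_cons, List.prod_cons]

@[simp] theorem val_pow (l : LCode) (n : ℕ) : val (pow l n) = val l ^ n := by
  simp [pow]

theorem val_horner (x : LCode) (l : List LCode) :
    val (horner x l) = coeffEval (val x) (l.map val) := by
  induction l with
  | nil => simp [horner, coeffEval]
  | cons c l ih =>
    have : horner x (c :: l) = c ++ mul x (horner x l) := rfl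
    rw [this, val_append, val_mul, ih]
    simp [coeffEval]

theorem val_flatMap {ι : Type*} (l : List ι) (f : ι → LCode) :
    val (l.flatMap f) = (l.map fun i => val (f i)).sum := by
  induction l with
  | nil => simp
  | cons x l ih => simp [ih]

theorem exists_val_dropK (l : LCode) : ∃ r : LR, val (dropK l) = C r := by
  induction l with
  | nil => exact ⟨0, by simp [dropK]⟩
  | cons x l ih =>
    obtain ⟨r, hr⟩ := ih
    refine ⟨monR x.1 x.2.1 x.2.2.1 x.2.2.2.1 + r, ?_⟩
    have : dropK (x :: l) = (x.1, x.2.1, x.2.2.1, x.2.2.2.1, 0) :: dropK l := rfl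
    rw [this, val_cons, hr, map_add]
    simp [monK]

theorem coeff_monK (x a b c d : ℤ) (a' b' c' d' : ℤ) :
    ((monK x a b c d).coeff d').coeff (a', b', c') =
      if (a, b, c, d) = (a', b', c', d') then x else 0 := by
  simp only [monK, monR, ← single_eq_C_mul_T, AddMonoidAlgebra.coeff_single, Finsupp.single_apply,
    Prod.mk.injEq]
  by_cases hd : d = d'
  · subst hd
    simp [Finsupp.single_apply]
  · simp [hd]

theorem coeff_val (l : LCode) (m : Expo) :
    ((val l).coeff m.2.2.2).coeff (m.1, m.2.1, m.2.2.1) = coeffAt l m := by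
  induction l with
  | nil => simp [coeffAt]
  | cons x l ih =>
    have : coeffAt (x :: l) m = if x.2 = m then x.1 + coeffAt l m else coeffAt l m := rfl
    rw [this, val_cons, ← ih]
    simp only [AddMonoidAlgebra.coeff_add, Finsupp.add_apply, coeff_monK]
    by_cases h : x.2 = m
    · simp [h]
    · simp [h]

/-- Laurent monomials are linearly independent over `ℤ`, and a coefficient at an exponent absent
from the list is zero. This makes the validity of a certificate decidable. -/
theorem isZero_iff (l : LCode) : IsZero l ↔ val l = 0 := by
  constructor
  · intro h
    have key : ∀ m : Expo, coeffAt l m = 0 := by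
      intro m
      by_cases hm : ∃ x ∈ l, x.2 = m
      · obtain ⟨x, hx, rfl⟩ := hm
        exact h x hx
      · push Not at hm
        have : ∀ l' : LCode, (∀ x ∈ l', x.2 ≠ m) → coeffAt l' m = 0 := by
          intro l' hl'
          induction l' with
          | nil => rfl
          | cons x l' ih =>
            have e : coeffAt (x :: l') m =
              if x.2 = m then x.1 + coeffAt l' m else coeffAt l' m := rfl
            rw [e, if_neg (hl' x (by simp)), ih fun y hy => hl' y (by simp [hy])]
        exact this l hm
    ext d ⟨a, b, c⟩
    have := coeff_val l (a, b, c, d)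
    rw [key] at this
    simpa using this
  · intro h x _
    rw [← coeff_val, h]
    simp

theorem exists_val_eq_C (r : LR) : ∃ l : LCode, dropK l = l ∧ val l = C r := by
  have hadd : ∀ r s : LR, (∃ l : LCode, dropK l = l ∧ val l = C r) →
      (∃ l : LCode, dropK l = l ∧ val l = C s) →
      ∃ l : LCode, dropK l = l ∧ val l = C (r + s) := by
    rintro r s ⟨l, hl, hl'⟩ ⟨m, hm, hm'⟩
    refine ⟨l ++ m, ?_, ?_⟩
    · have : dropK (l ++ m) = dropK l ++ dropK m := List.map_append
      rw [this, hl, hm]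
    · rw [val_append, hl', hm', map_add]
  induction r using AddMonoidAlgebra.induction_linear with
  | zero => exact ⟨[], rfl, by simp⟩
  | add p q hp hq => exact hadd _ _ hp hq
  | single m x => exact ⟨[(x, m.1, m.2.1, m.2.2, 0)], rfl, by simp [val, monK, monR]⟩

theorem exists_val_eq (r : LK) : ∃ l : LCode, val l = r := by
  induction r using LaurentPolynomial.induction_on' with
  | add p q hp hq =>
    obtain ⟨l, rfl⟩ := hp
    obtain ⟨m, rfl⟩ := hq
    exact ⟨l ++ m, val_append l m⟩
  | C_mul_T d r =>
    obtain ⟨l, -, hl⟩ := exists_val_eq_C r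
    exact ⟨mul l (mono 0 0 0 d), by rw [val_mul, hl]; simp [monK, monR_one]⟩

end LCode

end QHolonomic

namespace QHolonomic

open LCode

/-! ### Polynomials given by lists of integers -/

section CoeffEval

variable {R S : Type*} [Semiring R] [Semiring S]

@[simp] theorem coeffEval_nil (x : R) : coeffEval x [] = 0 := rfl

@[simp] theorem coeffEval_cons (x c : R) (l : List R) :
    coeffEval x (c :: l) = c + x * coeffEval x l := rfl

theorem map_coeffEval (f : R →+* S) (x : R) (l : List R) :
    f (coeffEval x l) = coeffEval (f x) (l.map f) := by
  induction l with
  | nil => simp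
  | cons c l ih => simp [ih]

theorem coeffEval_eq_zero (x : R) (l : List R) (h : ∀ c ∈ l, c = 0) : coeffEval x l = 0 := by
  induction l with
  | nil => rfl
  | cons c l ih => simp [h c (by simp), ih fun c hc => h c (by simp [hc])]

theorem eq_zero_of_coeffEval_X_eq_zero (l : List R)
    (h : coeffEval (Polynomial.X : Polynomial R) (l.map Polynomial.C) = 0) : ∀ c ∈ l, c = 0 := by
  induction l with
  | nil => simp
  | cons c l ih =>
    rw [List.map_cons, coeffEval_cons] at h
    have h0 : c = 0 := by simpa using congrArg (fun p => Polynomial.coeff p 0) h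
    subst h0
    have h1 : coeffEval (Polynomial.X : Polynomial R) (l.map Polynomial.C) = 0 := by
      ext n
      simpa using congrArg (fun p => Polynomial.coeff p (n + 1)) h
    simpa using ih h1

theorem exists_coeffEval_X_eq (p : Polynomial R) :
    ∃ l : List R, p = coeffEval Polynomial.X (l.map Polynomial.C) := by
  induction hn : p.natDegree using Nat.strong_induction_on generalizing p with
  | _ n ih =>
    by_cases h0 : n = 0
    · refine ⟨[p.coeff 0], ?_⟩
      rw [Polynomial.eq_C_of_natDegree_eq_zero (hn.trans h0)]
      simp
    · obtain ⟨l, hl⟩ := ih p.divX.natDegree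
        (by rw [Polynomial.natDegree_divX_eq_natDegree_tsub_one]; omega) p.divX rfl
      refine ⟨p.coeff 0 :: l, ?_⟩
      rw [List.map_cons, coeffEval_cons, ← hl, add_comm, Polynomial.X_mul_divX_add]

end CoeffEval

theorem intPoly_eq (l : List ℤ) : intPoly l = coeffEval q (l.map (Int.castRingHom Kq)) := by
  unfold intPoly
  congr 1
  induction l with
  | nil => rfl
  | cons a l ih => simpa using ih

theorem intPoly_eq_algebraMap (l : List ℤ) :
    intPoly l = algebraMap (Polynomial ℚ) Kq
      (coeffEval Polynomial.X ((l.map (Int.castRingHom ℚ)).map Polynomial.C)) := by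
  rw [map_coeffEval, intPoly_eq, RatFunc.algebraMap_X, List.map_map, List.map_map]
  congr 1
  refine List.map_congr_left fun c _ => ?_
  simp

theorem intPoly_eq_zero_iff (l : List ℤ) : intPoly l = 0 ↔ AllZero l := by
  constructor
  · intro h c hc
    rw [intPoly_eq_algebraMap,
      map_eq_zero_iff _ (RatFunc.algebraMap_injective ℚ)] at h
    simpa using eq_zero_of_coeffEval_X_eq_zero _ h _ (List.mem_map_of_mem hc)
  · intro h
    rw [intPoly_eq]
    refine coeffEval_eq_zero _ _ fun c hc => ?_
    obtain ⟨a, ha, rfl⟩ := List.mem_map.1 hc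
    simp [h a ha]

/-- The element of `ℚ(q)[Q]` with the given list of coefficients. -/
noncomputable def poly₂ (l : List (List ℤ)) : Polynomial Kq :=
  coeffEval Polynomial.X ((l.map intPoly).map Polynomial.C)

theorem intPoly₂_eq_algebraMap (l : List (List ℤ)) :
    intPoly₂ l = algebraMap (Polynomial Kq) KqQ (poly₂ l) := by
  rw [poly₂, map_coeffEval, intPoly₂, RatFunc.algebraMap_X, List.map_map, List.map_map]
  congr 1

theorem poly₂_eq_zero_iff (l : List (List ℤ)) : poly₂ l = 0 ↔ AllZero₂ l := by
  constructor
  · intro h m hm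
    exact (intPoly_eq_zero_iff m).1
      (eq_zero_of_coeffEval_X_eq_zero _ h _ (List.mem_map_of_mem hm))
  · intro h
    refine coeffEval_eq_zero _ _ fun c hc => ?_
    rw [List.map_map] at hc
    obtain ⟨a, ha, rfl⟩ := List.mem_map.1 hc
    simp [(intPoly_eq_zero_iff a).2 (h a ha)]

theorem intPoly₂_eq_zero_iff (l : List (List ℤ)) : intPoly₂ l = 0 ↔ AllZero₂ l := by
  rw [intPoly₂_eq_algebraMap, map_eq_zero_iff _ (RatFunc.algebraMap_injective Kq),
    poly₂_eq_zero_iff]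

theorem eval_poly₂ (x : Kq) (l : List (List ℤ)) :
    (poly₂ l).eval x = coeffEval x (l.map intPoly) := by
  have := map_coeffEval (Polynomial.evalRingHom x) Polynomial.X ((l.map intPoly).map Polynomial.C)
  rw [List.map_map] at this
  simpa [poly₂, Function.comp_def] using this

/-- The reduced denominator divides `b`, so it cannot vanish where `b` does not. -/
theorem definedAt_div {a b : Polynomial Kq} {n : ℕ} (hb : b.eval (q ^ n) ≠ 0) :
    DefinedAt (algebraMap _ KqQ a / algebraMap _ KqQ b) n := by
  intro h
  obtain ⟨c, hc⟩ := RatFunc.denom_div_dvd a b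
  apply hb
  rw [hc, Polynomial.eval_mul, h, zero_mul]

theorem valueAt_div {a b : Polynomial Kq} {n : ℕ} (hb : b.eval (q ^ n) ≠ 0) :
    valueAt (algebraMap _ KqQ a / algebraMap _ KqQ b) n = a.eval (q ^ n) / b.eval (q ^ n) := by
  have hb0 : b ≠ 0 := by rintro rfl; simp at hb
  have hd : (algebraMap _ KqQ a / algebraMap _ KqQ b).denom.eval (q ^ n) ≠ 0 := definedAt_div hb
  have h := (RatFunc.num_mul_eq_mul_denom_iff (x := algebraMap _ KqQ a / algebraMap _ KqQ b)
    hb0).2 rfl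
  have h' := congrArg (Polynomial.eval (q ^ n)) h
  rw [Polynomial.eval_mul, Polynomial.eval_mul] at h'
  rw [valueAt, RatFunc.eval, Polynomial.eval₂_id, Polynomial.eval₂_id, div_eq_div_iff hd hb, h']

theorem q_ne_zero : q ≠ 0 := RatFunc.X_ne_zero

theorem q_pow_injective : Function.Injective fun n : ℕ => q ^ n := by
  intro m n h
  have : (Polynomial.X ^ m : Polynomial ℚ) = Polynomial.X ^ n := by
    apply RatFunc.algebraMap_injective
    simpa [q] using h
  simpa using congrArg Polynomial.natDegree this

theorem q_zpow_ne_one {n : ℤ} (hn : n ≠ 0) : q ^ n ≠ 1 := by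
  intro h
  have key : ∀ m : ℕ, q ^ m = 1 → m = 0 := fun m hm => q_pow_injective (by simpa using hm)
  rcases Int.eq_nat_or_neg n with ⟨m, rfl | rfl⟩
  · exact hn (by simp [key m (by simpa using h)])
  · exact hn (by simp [key m (by simpa using h)])

/-! ### Clearing the denominators of an equation -/

theorem eqDen_ne_zero (c : CoeffCode) : poly₂ (eqDen c) ≠ 0 := by
  unfold eqDen
  split_ifs with h
  · rw [Ne, poly₂_eq_zero_iff]
    intro h'
    simpa using h' [1] (by simp) 1 (by simp)
  · rwa [Ne, poly₂_eq_zero_iff]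

theorem eqNum_div_eqDen (c : CoeffCode) :
    intPoly₂ c.1 / intPoly₂ c.2 =
      algebraMap _ KqQ (poly₂ (eqNum c)) / algebraMap _ KqQ (poly₂ (eqDen c)) := by
  unfold eqNum eqDen
  split_ifs with h
  · rw [(intPoly₂_eq_zero_iff c.2).2 h]
    simp [poly₂]
  · rw [intPoly₂_eq_algebraMap, intPoly₂_eq_algebraMap]

/-- The polynomial underlying `eqCoeff`. -/
noncomputable def eqPoly (P : EqCode) (i : ℕ) : Polynomial Kq :=
  poly₂ (eqNum (eqEntry P i)) *
    ((∏ l ∈ Finset.range P.length, if l = i then 1 else poly₂ (eqDen (eqEntry P l))) *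
    ((∏ l ∈ Finset.range P.length, poly₂ (eqDen (eqEntry P l))) *
      ∏ t ∈ Finset.range P.length, (1 - Polynomial.C (q ^ (t + 1)) * Polynomial.X)))

/-- The extension of a sequence by zero to the negative integers. -/
def extend {α : Type*} [Zero α] (J : ℕ → α) (m : ℤ) : α := if m < 0 then 0 else J m.toNat

theorem extend_natCast {α : Type*} [Zero α] (J : ℕ → α) (n : ℕ) : extend J n = J n := by
  simp [extend]

theorem extend_of_neg {α : Type*} [Zero α] (J : ℕ → α) {m : ℤ} (h : m < 0) : extend J m = 0 := by
  simp [extend, h]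

/-- The multiplied equation holds at every integer for the extension of `J` by zero. The extra
factors of `eqPoly` vanish wherever the original equation could fail: the second product of
denominators at poles, the factors `1 - q^(t+1) Q` at the negative integers from which the equation
reaches nonnegative ones. -/
theorem sum_eqPoly_mul_extend {P : EqCode} {J : ℕ → Kq} (hJ : Satisfies J P.toEq) (m : ℤ) :
    ∑ i ∈ Finset.range P.length, (eqPoly P i).eval (q ^ m) * extend J (m + i) = 0 := by
  by_cases hm : m < 0
  · refine Finset.sum_eq_zero fun i hi => ?_
    by_cases hmi : m + i < 0
    · rw [extend_of_neg _ hmi, mul_zero]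
    · have : (∏ t ∈ Finset.range P.length,
          (1 - Polynomial.C (q ^ (t + 1)) * Polynomial.X)).eval (q ^ m) = 0 := by
        rw [Polynomial.eval_prod]
        -- With `t + 1 = -m` the factor `1 - q^(t+1) q^m` is zero; `m + i ≥ 0` with `i` below the
        -- length keeps `t` in range.
        refine Finset.prod_eq_zero (i := (-m - 1).toNat) ?_ ?_
        · rw [Finset.mem_range] at hi ⊢; omega
        · have : q ^ ((-m - 1).toNat + 1) * q ^ m = 1 := by
            rw [← zpow_natCast, ← zpow_add₀ q_ne_zero]
            rw [show (((-m - 1).toNat + 1 : ℕ) : ℤ) + m = 0 by omega, zpow_zero]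
          simp only [Polynomial.eval_sub, Polynomial.eval_one, Polynomial.eval_mul,
            Polynomial.eval_C, Polynomial.eval_X, this, sub_self]
      simp only [eqPoly, Polynomial.eval_mul, this, mul_zero, zero_mul]
  · obtain ⟨n, rfl⟩ := Int.eq_ofNat_of_zero_le (not_lt.1 hm)
    by_cases hD : (∏ l ∈ Finset.range P.length, poly₂ (eqDen (eqEntry P l))).eval (q ^ n) = 0
    · refine Finset.sum_eq_zero fun i hi => ?_
      simp only [eqPoly, Polynomial.eval_mul, zpow_natCast, hD, mul_zero, zero_mul]
    · have hd : ∀ l < P.length, (poly₂ (eqDen (eqEntry P l))).eval (q ^ n) ≠ 0 := by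
        intro l hl h
        apply hD
        rw [Polynomial.eval_prod]
        exact Finset.prod_eq_zero (Finset.mem_range.2 hl) h
      have hlen : P.toEq.length = P.length := by simp [EqCode.toEq]
      have hget : ∀ i (hi : i < P.length), P.toEq[i]'(by omega) =
          algebraMap _ KqQ (poly₂ (eqNum (eqEntry P i))) /
            algebraMap _ KqQ (poly₂ (eqDen (eqEntry P i))) := by
        intro i hi
        have : eqEntry P i = P[i] := by simp [eqEntry, List.getD, hi]
        rw [← eqNum_div_eqDen, this]
        simp [EqCode.toEq]
      have h := hJ n (by
        intro a ha
        obtain ⟨i, hi, rfl⟩ := List.mem_iff_getElem.1 ha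
        rw [hget i (by omega)]
        exact definedAt_div (hd i (by omega)))
      have h2 : ∑ i ∈ Finset.range P.length, (poly₂ (eqNum (eqEntry P i))).eval (q ^ n) /
          (poly₂ (eqDen (eqEntry P i))).eval (q ^ n) * J (n + i) = 0 := by
        rw [← h, Finset.sum_fin_eq_sum_range]
        refine Finset.sum_congr (by rw [hlen]) fun i hi => ?_
        rw [Finset.mem_range] at hi
        have hi' : i < P.length := by omega
        rw [dif_pos (by omega), List.get_eq_getElem]
        simp only [hget i hi']
        rw [valueAt_div (hd i hi')]
      have h3 : ∀ i ∈ Finset.range P.length, (eqPoly P i).eval (q ^ (n : ℤ)) * extend J (n + i) =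
          ((∏ l ∈ Finset.range P.length, poly₂ (eqDen (eqEntry P l))).eval (q ^ n) ^ 2 *
            (∏ t ∈ Finset.range P.length,
              (1 - Polynomial.C (q ^ (t + 1)) * Polynomial.X)).eval (q ^ n)) *
          ((poly₂ (eqNum (eqEntry P i))).eval (q ^ n) /
          (poly₂ (eqDen (eqEntry P i))).eval (q ^ n) * J (n + i)) := by
        intro i hi
        have e : (∏ l ∈ Finset.range P.length, poly₂ (eqDen (eqEntry P l))) =
            poly₂ (eqDen (eqEntry P i)) * (∏ l ∈ Finset.range P.length,
              if l = i then 1 else poly₂ (eqDen (eqEntry P l))) := by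
          rw [← Finset.mul_prod_erase _ _ hi,
            ← Finset.mul_prod_erase _ (fun l => if l = i then 1 else _) hi, if_pos rfl, one_mul]
          congr 1
          refine Finset.prod_congr rfl fun l hl => ?_
          rw [if_neg (Finset.ne_of_mem_erase hl)]
        have hdi := hd i (Finset.mem_range.1 hi)
        have e2 := congrArg (Polynomial.eval (q ^ n)) e
        rw [Polynomial.eval_mul] at e2
        have e3 : extend J ((n : ℤ) + i) = J (n + i) := by
          rw [← Nat.cast_add, extend_natCast]
        rw [e3]
        simp only [eqPoly, Polynomial.eval_mul, zpow_natCast]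
        rw [e2]
        field_simp
      rw [Finset.sum_congr rfl h3, ← Finset.mul_sum, h2, mul_zero]

end QHolonomic

namespace QHolonomic

open LCode

/-! ### The evaluation at a lattice point -/

section Evaluation

variable {F : Type*} [Field F]

/-- The character `(a, b, c) ↦ q ^ (a + n c) z ^ b`. -/
noncomputable def evalChar (q z : Fˣ) (n : ℤ) : Multiplicative (ℤ × ℤ × ℤ) →* F where
  toFun m := ((q ^ (m.toAdd.1 + n * m.toAdd.2.2) * z ^ m.toAdd.2.1 : Fˣ) : F)
  map_one' := by simp
  map_mul' m m' := by
    rw [← Units.val_mul]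
    congr 1
    simp only [toAdd_mul, Prod.fst_add, Prod.snd_add, mul_add, zpow_add]
    simp only [mul_left_comm, mul_assoc]

/-- The evaluation of Laurent polynomials at `Q = q ^ n`, `K = q ^ k`. -/
noncomputable def evalHom (q z : Fˣ) (n k : ℤ) : LK →+* F :=
  LaurentPolynomial.eval₂ (AddMonoidAlgebra.lift ℤ F _ (evalChar q z n) : LR →+* F) (q ^ k)

theorem evalHom_monK (q z : Fˣ) (n k x a b c d : ℤ) :
    evalHom q z n k (monK x a b c d) = x * (q : F) ^ (a + n * c + k * d) * (z : F) ^ b := by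
  rw [monK, evalHom, LaurentPolynomial.eval₂_C_mul_T, monR]
  rw [RingHom.coe_coe, AddMonoidAlgebra.lift_single]
  simp only [evalChar, MonoidHom.coe_mk, OneHom.coe_mk, toAdd_ofAdd, zsmul_eq_mul]
  rw [zpow_add₀ q.ne_zero, zpow_mul (q : F) k d]
  push_cast
  ring

/-- Coefficients free of `K` do not change with `k`, which is why they can be taken out of the sum
over `k`. -/
theorem evalHom_C (q z : Fˣ) (n k k' : ℤ) (r : LR) :
    evalHom q z n k (LaurentPolynomial.C r) = evalHom q z n k' (LaurentPolynomial.C r) := by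
  rw [evalHom, evalHom, LaurentPolynomial.eval₂_C, LaurentPolynomial.eval₂_C]

end Evaluation

/-! ### The perturbed term -/

section Pochhammer

variable {F : Type*} [Field F]

/-- The quantum factorial in an arbitrary field. -/
noncomputable def qPoch (q y : F) : ℤ → F
  | Int.ofNat m => ∏ i ∈ Finset.range m, (1 - y * q ^ i)
  | Int.negSucc m => (∏ i ∈ Finset.range (m + 1), (1 - y * q ^ (-((i : ℤ) + 1))))⁻¹

theorem qPoch_zero (q y : F) : qPoch q y 0 = 1 := by
  change qPoch q y (Int.ofNat 0) = 1
  simp [qPoch]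

theorem qPoch_natCast (q y : F) (m : ℕ) :
    qPoch q y (m : ℤ) = ∏ i ∈ Finset.range m, (1 - y * q ^ i) := rfl

theorem qPoch_succ {q y : F} (hy : ∀ s : ℤ, s < 0 → 1 - y * q ^ s ≠ 0) (s : ℤ) :
    qPoch q y (s + 1) = (1 - y * q ^ s) * qPoch q y s := by
  match s with
  | Int.ofNat m =>
    change qPoch q y (Int.ofNat (m + 1)) = _
    simp only [qPoch, Finset.prod_range_succ, Int.ofNat_eq_natCast, zpow_natCast]
    ring
  | Int.negSucc 0 =>
    have h := hy (-1) (by omega)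
    rw [show Int.negSucc 0 + 1 = 0 from rfl, qPoch_zero, show Int.negSucc 0 = -1 from rfl]
    change _ = _ * qPoch q y (Int.negSucc 0)
    simp only [qPoch]
    simp [mul_inv_cancel₀ (by simpa using h : (1 - y * q⁻¹) ≠ 0)]
  | Int.negSucc (m + 1) =>
    have h := hy (Int.negSucc (m + 1)) (Int.negSucc_lt_zero _)
    rw [show Int.negSucc (m + 1) + 1 = Int.negSucc m from rfl]
    simp only [qPoch]
    rw [Finset.prod_range_succ _ (m + 1), mul_inv]
    have e : Int.negSucc (m + 1) = -(((m + 1 : ℕ) : ℤ) + 1) := by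
      rw [Int.negSucc_eq]
    rw [e] at h ⊢
    rw [mul_comm _ (1 - y * q ^ (-(((m + 1 : ℕ) : ℤ) + 1)))⁻¹, mul_inv_cancel_left₀ h]

theorem qPoch_ne_zero {q y : F} (hy : ∀ s : ℤ, 1 - y * q ^ s ≠ 0) (s : ℤ) : qPoch q y s ≠ 0 := by
  cases s with
  | ofNat m =>
    refine Finset.prod_ne_zero_iff.2 fun i _ => ?_
    simpa using hy i
  | negSucc m =>
    exact inv_ne_zero (Finset.prod_ne_zero_iff.2 fun i _ => hy _)

theorem qPoch_shift {q y : F} (hq : q ≠ 0) (hy : ∀ s : ℤ, 1 - y * q ^ s ≠ 0) (s m : ℤ) :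
    qPoch q (y * q ^ s) m = qPoch q y (s + m) * (qPoch q y s)⁻¹ := by
  have hy' : ∀ t : ℤ, 1 - y * q ^ s * q ^ t ≠ 0 := fun t => by
    rw [mul_assoc, ← zpow_add₀ hq]; exact hy _
  have h1 := fun t => qPoch_succ (fun t _ => hy' t) t
  have h2 := fun t => qPoch_succ (fun t _ => hy t) t
  have h0 := qPoch_ne_zero hy s
  induction m using Int.induction_on with
  | zero => simp [qPoch_zero, h0]
  | succ m ih => rw [h1, ih, ← add_assoc, h2, zpow_add₀ hq]; ring
  | pred m ih =>
    have e1 := h1 (-m - 1)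
    have e2 := h2 (s + (-m - 1))
    rw [sub_add_cancel] at e1
    rw [show s + (-(m : ℤ) - 1) + 1 = s + -m by ring] at e2
    apply mul_left_cancel₀ (hy' (-m - 1))
    rw [← e1, ih, e2, zpow_add₀ hq]
    ring

theorem eq_prod_mul_of_succ {f G : ℤ → F} (h : ∀ s, G (s + 1) = f s * G s) (s : ℤ) (r : ℕ) :
    G (s + r) = (∏ t ∈ Finset.range r, f (s + t)) * G s := by
  induction r with
  | zero => simp
  | succ r ih =>
    rw [Finset.prod_range_succ, Nat.cast_succ, ← add_assoc, h, ih]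
    ring

/-- For reciprocals the recurrence runs downwards, so all values are products starting from the
upper end of the range. -/
theorem eq_prod_mul_of_pred {f G : ℤ → F} (h : ∀ s, G s = f s * G (s + 1)) (s : ℤ) {r m : ℕ}
    (hr : r ≤ m) : G (s + r) = (∏ t ∈ Finset.Ico r m, f (s + t)) * G (s + m) := by
  induction m, hr using Nat.le_induction with
  | base => simp
  | succ m hm ih =>
    rw [Finset.prod_Ico_succ_top hm, ih, h (s + m), Nat.cast_succ, ← add_assoc]
    ring

theorem prod_range_ite_lt (d : F) (f : ℕ → F) {r m : ℕ} (h : r ≤ m) :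
    (∏ t ∈ Finset.range m, if t < r then d * f t else d) =
      d ^ m * ∏ t ∈ Finset.range r, f t := by
  rw [← Finset.prod_range_mul_prod_Ico _ h,
    Finset.prod_congr rfl fun t ht => if_pos (Finset.mem_range.1 ht),
    Finset.prod_congr (rfl : Finset.Ico r m = _) fun t ht =>
      if_neg (not_lt.2 (Finset.mem_Ico.1 ht).1), Finset.prod_mul_distrib]
  simp only [Finset.prod_const, Finset.card_range, Nat.card_Ico]
  rw [mul_right_comm, ← pow_add, Nat.add_sub_of_le h]

theorem prod_range_ite_not_lt (d : F) (f : ℕ → F) {r m : ℕ} (h : r ≤ m) :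
    (∏ t ∈ Finset.range m, if t < r then d else d * f t) =
      d ^ m * ∏ t ∈ Finset.Ico r m, f t := by
  rw [← Finset.prod_range_mul_prod_Ico _ h,
    Finset.prod_congr rfl fun t ht => if_pos (Finset.mem_range.1 ht),
    Finset.prod_congr (rfl : Finset.Ico r m = _) fun t ht =>
      if_neg (not_lt.2 (Finset.mem_Ico.1 ht).1), Finset.prod_mul_distrib]
  simp only [Finset.prod_const, Finset.card_range, Nat.card_Ico]
  rw [← mul_assoc, ← pow_add, Nat.add_sub_of_le h]

end Pochhammer

/-! ### Evaluation of the codes of the term and its factors -/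

section Term

variable {F : Type*} [Field F] (κ : Kq →+* F) (z : Fˣ)

/-- The image of `q`. -/
noncomputable def qUnit : Fˣ := Units.map (κ : Kq →* F) (Units.mk0 q q_ne_zero)

@[simp] theorem coe_qUnit : ((qUnit κ : Fˣ) : F) = κ q := rfl

/-- The evaluation of codes at `(n, k)`. -/
noncomputable def ev (n k : ℤ) : LK →+* F := evalHom (qUnit κ) z n k

theorem ev_monK (n k x a b c d : ℤ) :
    ev κ z n k (monK x a b c d) = x * κ q ^ (a + n * c + k * d) * (z : F) ^ b := by
  rw [ev, evalHom_monK, coe_qUnit]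

theorem ev_intCode (n k : ℤ) (l : List ℤ) : ev κ z n k (intCode l).val = κ (intPoly l) := by
  rw [intCode, val_horner, map_coeffEval, intPoly_eq, map_coeffEval, val_mono, ev_monK]
  simp only [List.map_map]
  congr 1
  · simp
  · refine List.map_congr_left fun c _ => ?_
    simp

theorem ev_intCode₂ (n k : ℤ) (x : LCode) (y : Kq) (hx : ev κ z n k x.val = κ y)
    (l : List (List ℤ)) : ev κ z n k (intCode₂ x l).val = κ ((poly₂ l).eval y) := by
  rw [intCode₂, val_horner, map_coeffEval, eval_poly₂, map_coeffEval, hx]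
  simp only [List.map_map]
  congr 1
  refine List.map_congr_left fun c _ => ?_
  simp [ev_intCode]

theorem ratDen_ne_zero (r : RatCode) : intPoly (ratDen r) ≠ 0 := by
  unfold ratDen
  split_ifs with h
  · rw [Ne, intPoly_eq_zero_iff]
    intro h'
    simpa using h' 1 (by simp)
  · rwa [Ne, intPoly_eq_zero_iff]

theorem ratNum_div_ratDen (r : RatCode) : intPoly (ratNum r) / intPoly (ratDen r) = r.val := by
  unfold ratNum ratDen
  split_ifs with h
  · rw [RatCode.val, (intPoly_eq_zero_iff r.2).2 h]
    simp [(intPoly_eq_zero_iff []).2 (by simp [AllZero])]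
  · rfl

/-- Since nothing is cancelled, the denominator is the product of all given denominators and does
not involve `x`. For a term it is therefore the same at all shifts and can be dropped. -/
theorem ev_fracHorner (φ : LK →+* F) (x : LCode) (l : List (LCode × LCode))
    (h : ∀ c ∈ l, φ c.2.val ≠ 0) :
    φ (fracHorner x l).2.val = (l.map fun c => φ c.2.val).prod ∧
    φ (fracHorner x l).1.val = (l.map fun c => φ c.2.val).prod *
      coeffEval (φ x.val) (l.map fun c => φ c.1.val / φ c.2.val) := by
  induction l with
  | nil => simp [fracHorner]
  | cons c l ih =>
    obtain ⟨h2, h1⟩ := ih fun c hc => h c (by simp [hc])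
    have hc := h c (by simp)
    have e : fracHorner x (c :: l) = (mul c.1 (fracHorner x l).2 ++
      mul x (mul (fracHorner x l).1 c.2), mul c.2 (fracHorner x l).2) := rfl
    rw [e]
    simp only [val_append, val_mul, map_add, map_mul, h1, h2, List.map_cons, List.prod_cons,
      coeffEval_cons]
    refine ⟨trivial, ?_⟩
    field_simp

/-- The common denominator used in `polyCode`. -/
noncomputable def polyDen (p : List (List RatCode)) : F :=
  (p.map fun l => (l.map fun r => κ (intPoly (ratDen r))).prod).prod

noncomputable def polyVal (p : List (List RatCode)) (n k : ℤ) : F :=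
  coeffEval (κ q ^ k) (p.map fun l => coeffEval (κ q ^ n) (l.map fun r => κ r.val))

theorem polyRowDen_ne_zero (l : List RatCode) :
    (l.map fun r => κ (intPoly (ratDen r))).prod ≠ 0 := by
  rw [Ne, List.prod_eq_zero_iff, List.mem_map]
  rintro ⟨r, -, hr⟩
  exact ratDen_ne_zero r ((map_eq_zero κ).1 hr)

theorem polyDen_ne_zero (p : List (List RatCode)) : polyDen κ p ≠ 0 := by
  rw [polyDen, Ne, List.prod_eq_zero_iff, List.mem_map]
  rintro ⟨l, -, hl⟩
  exact polyRowDen_ne_zero κ l hl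

theorem ev_polyRow (n k : ℤ) (i : ℕ) (l : List RatCode) :
    ev κ z n k (polyRow (mono i 0 1 0) l).2.val = (l.map fun r => κ (intPoly (ratDen r))).prod ∧
    ev κ z n k (polyRow (mono i 0 1 0) l).1.val =
      (l.map fun r => κ (intPoly (ratDen r))).prod *
        coeffEval (κ q ^ (n + i)) (l.map fun r => κ r.val) := by
  have h := ev_fracHorner (ev κ z n k) (mono i 0 1 0)
    (l.map fun r => (intCode (ratNum r), intCode (ratDen r))) (by
      intro c hc
      obtain ⟨r, -, rfl⟩ := List.mem_map.1 hc
      rw [ev_intCode]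
      exact fun h => ratDen_ne_zero r ((map_eq_zero κ).1 h))
  simp only [List.map_map, Function.comp_def, ev_intCode, ← map_div₀, ratNum_div_ratDen, val_mono,
    ev_monK] at h
  rw [polyRow, h.1, h.2]
  refine ⟨rfl, ?_⟩
  simp [add_comm]

theorem ev_polyCode (n k : ℤ) (i j : ℕ) (p : List (List RatCode)) :
    ev κ z n k (polyCode p i j).1.val = polyDen κ p * polyVal κ p (n + i) (k + j) := by
  have h := (ev_fracHorner (ev κ z n k) (mono j 0 0 1) (p.map (polyRow (mono i 0 1 0))) (by
      intro c hc
      obtain ⟨l, -, rfl⟩ := List.mem_map.1 hc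
      rw [(ev_polyRow κ z n k i l).1]
      exact polyRowDen_ne_zero κ l)).2
  rw [polyCode, h]
  simp only [List.map_map, Function.comp_def, (ev_polyRow κ z n k i _).1,
    (ev_polyRow κ z n k i _).2, val_mono, ev_monK, polyDen, polyVal,
    mul_div_cancel_left₀ _ (polyRowDen_ne_zero κ _)]
  simp [add_comm]

/-- The quadratic form of the exponent at integral arguments. -/
def quadVal (e : QuadForm) (n k : ℤ) : ℤ :=
  e.nn * (n * (n - 1) / 2) + e.nk * (n * k) + e.kk * (k * (k - 1) / 2) +
    (e.lin.a * n + e.lin.b * k + e.lin.c)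

theorem int_triangle_add (n m : ℤ) :
    (n + m) * (n + m - 1) / 2 = n * (n - 1) / 2 + m * (m - 1) / 2 + n * m := by
  obtain ⟨a, ha⟩ := (Int.even_mul_pred_self n).two_dvd
  obtain ⟨b, hb⟩ := (Int.even_mul_pred_self m).two_dvd
  have : (n + m) * (n + m - 1) = 2 * (a + b + n * m) := by linear_combination ha + hb
  rw [this, ha, hb]
  simp

theorem natCast_triangle (i : ℕ) : ((i * (i - 1) / 2 : ℕ) : ℤ) = (i : ℤ) * ((i : ℤ) - 1) / 2 := by
  cases i with
  | zero => simp
  | succ i => push_cast; simp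

theorem ev_quadCode (n k : ℤ) (i j : ℕ) (e : QuadForm) :
    ev κ z n k (quadCode e i j).val * κ q ^ quadVal e n k =
      κ q ^ quadVal e (n + i) (k + j) := by
  have hq : κ q ≠ 0 := (map_ne_zero κ).2 q_ne_zero
  rw [quadCode, val_mono, ev_monK, Int.cast_one, one_mul, zpow_zero, mul_one, ← zpow_add₀ hq]
  congr 1
  rw [natCast_triangle, natCast_triangle, quadVal, quadVal, int_triangle_add n i,
    int_triangle_add k j]
  push_cast
  ring

/-- The parameter `y` of an elementary factor. -/
noncomputable def elemParam (e : Elem) : F := κ e.1.val * (bif e.2.1 then (z : F) else 1)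

/-- The function described by an elementary factor. -/
noncomputable def elemFun (e : Elem) (s : ℤ) : F :=
  if e.2.1 then
    if e.2.2.2 then qPoch (κ q) (elemParam κ z e) s else (qPoch (κ q) (elemParam κ z e) s)⁻¹
  else if s < 0 then 0 else (qPoch (κ q) (elemParam κ z e) s)⁻¹

def elemForm (e : Elem) (n k : ℤ) : ℤ := e.2.2.1.1 * n + e.2.2.1.2.1 * k + e.2.2.1.2.2

/-- `elemFun κ z e` satisfies the recurrence attached to `e`. -/
def ElemRec (e : Elem) : Prop :=
  if e.2.2.2 then ∀ s : ℤ, elemFun κ z e (s + 1) =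
    (1 - elemParam κ z e * κ q ^ s) * elemFun κ z e s
  else ∀ s : ℤ, elemFun κ z e s = (1 - elemParam κ z e * κ q ^ s) * elemFun κ z e (s + 1)

theorem ev_elemFactor (n k : ℤ) (e : Elem) (t : ℤ) :
    ev κ z n k (elemFactor e t).val = κ (intPoly (ratDen e.1)) *
      (1 - elemParam κ z e * κ q ^ (elemForm e n k + t)) := by
  have hd : κ (intPoly (ratDen e.1)) ≠ 0 := (map_ne_zero κ).2 (ratDen_ne_zero e.1)
  rw [elemFactor, val_sub, val_mul, map_sub, map_mul, ev_intCode, ev_intCode, val_mono, ev_monK,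
    elemParam, ← ratNum_div_ratDen, map_div₀, elemForm]
  have : e.2.2.1.2.2 + t + n * e.2.2.1.1 + k * e.2.2.1.2.1 =
    e.2.2.1.1 * n + e.2.2.1.2.1 * k + e.2.2.1.2.2 + t := by ring
  rw [this]
  cases e.2.1 <;> simp <;> field_simp

/-- The starting point is the lower end of the range for upward recurrences and the upper end for
downward ones. -/
noncomputable def elemBase (e : Elem) (N : ℕ) (n k : ℤ) : F :=
  elemFun κ z e (if e.2.2.2 then elemForm e n k - elemRange e N else elemForm e n k + elemRange e N)

theorem ev_elemCode {e : Elem} (he : ElemRec κ z e) (n k : ℤ) {N i j : ℕ} (hi : i ≤ N)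
    (hj : j ≤ N) :
    ev κ z n k (elemCode N i j e).val * elemBase κ z e N n k =
      κ (intPoly (ratDen e.1)) ^ (2 * elemRange e N) *
        elemFun κ z e (elemForm e (n + i) (k + j)) := by
  have habs : |e.2.2.1.1 * (i : ℤ) + e.2.2.1.2.1 * (j : ℤ)| ≤ elemRange e N := by
    refine (abs_add_le _ _).trans ?_
    rw [elemRange, abs_mul, abs_mul, Nat.abs_cast, Nat.abs_cast]
    push_cast
    have hi' : (i : ℤ) ≤ N := by exact_mod_cast hi
    have hj' : (j : ℤ) ≤ N := by exact_mod_cast hj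
    rw [add_mul]
    gcongr
  have hr : (elemShift e N i j : ℤ) = e.2.2.1.1 * (i : ℤ) + e.2.2.1.2.1 * (j : ℤ) +
      elemRange e N := by
    rw [elemShift, Int.toNat_of_nonneg]
    have := (abs_le.1 habs).1
    omega
  have hr2 : elemShift e N i j ≤ 2 * elemRange e N := by
    have := (abs_le.1 habs).2
    omega
  have hform : elemForm e (n + i) (k + j) =
      elemForm e n k - elemRange e N + (elemShift e N i j : ℤ) := by
    rw [hr, elemForm, elemForm]
    ring
  have hcode : ev κ z n k (elemCode N i j e).val = ∏ t ∈ Finset.range (2 * elemRange e N),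
      if decide (t < elemShift e N i j) = e.2.2.2 then κ (intPoly (ratDen e.1)) *
        (1 - elemParam κ z e * κ q ^ (elemForm e n k - elemRange e N + (t : ℤ)))
      else κ (intPoly (ratDen e.1)) := by
    rw [elemCode, val_prod, map_list_prod, List.map_map, List.map_map, ← List.prod_toFinset _
      List.nodup_range, List.toFinset_range]
    refine Finset.prod_congr rfl fun t _ => ?_
    simp only [Function.comp_apply]
    split_ifs
    · rw [ev_elemFactor]
      congr 4
      ring
    · rw [ev_intCode]
  rw [hcode, hform]
  unfold ElemRec at he
  unfold elemBase
  cases hs : e.2.2.2 with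
  | true =>
    rw [hs, if_pos rfl] at he
    simp only [decide_eq_true_eq, if_true]
    rw [prod_range_ite_lt _ _ hr2, mul_assoc, eq_prod_mul_of_succ he]
  | false =>
    rw [hs, if_neg (by simp)] at he
    simp only [decide_eq_false_iff_not, ite_not, Bool.false_eq_true, if_false]
    rw [prod_range_ite_not_lt _ _ hr2, mul_assoc, eq_prod_mul_of_pred he _ hr2]
    congr 3
    push_cast
    ring

/-- The perturbed term. -/
noncomputable def termFun (T : TermCode) (n k : ℤ) : F :=
  polyVal κ T.poly n k * κ T.ξ.val ^ n * κ T.η.val ^ k * κ q ^ quadVal T.quad n k *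
    ((elems T).map fun e => elemFun κ z e (elemForm e n k)).prod

noncomputable def termUnit (T : TermCode) (N : ℕ) : F :=
  polyDen κ T.poly * κ (intPoly T.ξ.2) ^ N * κ (intPoly T.η.2) ^ N *
    ((elems T).map fun e => κ (intPoly (ratDen e.1)) ^ (2 * elemRange e N)).prod

/-- This factor may vanish, because the boundary factors do; unlike `termUnit` it is never
cancelled. -/
noncomputable def termBase (T : TermCode) (N : ℕ) (n k : ℤ) : F :=
  κ T.ξ.val ^ n * κ T.η.val ^ k * κ q ^ quadVal T.quad n k *
    ((elems T).map fun e => elemBase κ z e N n k).prod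

theorem intPoly_snd_ne_zero {r : RatCode} (h : r.val ≠ 0) : intPoly r.2 ≠ 0 := by
  intro h'
  exact h (by rw [RatCode.val, h', div_zero])

theorem termUnit_ne_zero {T : TermCode} (hξ : T.ξ.val ≠ 0) (hη : T.η.val ≠ 0) (N : ℕ) :
    termUnit κ T N ≠ 0 := by
  refine mul_ne_zero (mul_ne_zero (mul_ne_zero (polyDen_ne_zero κ _) (pow_ne_zero _ ?_))
    (pow_ne_zero _ ?_)) ?_
  · exact (map_ne_zero κ).2 (intPoly_snd_ne_zero hξ)
  · exact (map_ne_zero κ).2 (intPoly_snd_ne_zero hη)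
  · rw [Ne, List.prod_eq_zero_iff, List.mem_map]
    rintro ⟨e, -, he⟩
    exact pow_ne_zero _ ((map_ne_zero κ).2 (ratDen_ne_zero e.1)) he

theorem ev_pow_mul_pow (n k : ℤ) {r : RatCode} (hr : r.val ≠ 0) {N i : ℕ} (hi : i ≤ N) (m : ℤ) :
    ev κ z n k (pow (intCode r.1) i).val * ev κ z n k (pow (intCode r.2) (N - i)).val *
      κ r.val ^ m = κ (intPoly r.2) ^ N * κ r.val ^ (m + i) := by
  have h0 : κ r.val ≠ 0 := (map_ne_zero κ).2 hr
  have h2 : κ (intPoly r.2) ≠ 0 := (map_ne_zero κ).2 (intPoly_snd_ne_zero hr)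
  have h1 : κ (intPoly r.1) = κ r.val * κ (intPoly r.2) := by
    rw [← map_mul, RatCode.val, div_mul_cancel₀ _ (intPoly_snd_ne_zero hr)]
  rw [val_pow, val_pow, map_pow, map_pow, ev_intCode, ev_intCode, h1, zpow_add₀ h0, zpow_natCast,
    mul_pow, ← Nat.add_sub_of_le hi, pow_add, Nat.add_sub_cancel_left]
  ring

theorem ev_termCode {T : TermCode} (hξ : T.ξ.val ≠ 0) (hη : T.η.val ≠ 0)
    (he : ∀ e ∈ elems T, ElemRec κ z e) (n k : ℤ) {N i j : ℕ} (hi : i ≤ N) (hj : j ≤ N) :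
    ev κ z n k (termCode T N i j).val * termBase κ z T N n k =
      termUnit κ T N * termFun κ z T (n + i) (k + j) := by
  have hprod : ev κ z n k (prod ((elems T).map (elemCode N i j))).val *
      ((elems T).map fun e => elemBase κ z e N n k).prod =
      ((elems T).map fun e => κ (intPoly (ratDen e.1)) ^ (2 * elemRange e N)).prod *
      ((elems T).map fun e => elemFun κ z e (elemForm e (n + i) (k + j))).prod := by
    rw [val_prod, map_list_prod, List.map_map, List.map_map, ← List.prod_map_mul,
      ← List.prod_map_mul]
    congr 1
    refine List.map_congr_left fun e hel => ?_
    exact ev_elemCode κ z (he e hel) n k hi hj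
  rw [termCode, val_prod, map_list_prod]
  simp only [List.map_cons, List.map_nil, List.prod_cons, List.prod_nil, mul_one]
  rw [termBase, termUnit, termFun, ev_polyCode]
  have h1 := ev_pow_mul_pow κ z n k hξ hi n
  have h2 := ev_pow_mul_pow κ z n k hη hj k
  have h3 := ev_quadCode κ z n k i j T.quad
  calc _ = polyDen κ T.poly * polyVal κ T.poly (n + i) (k + j) *
        (ev κ z n k (pow (intCode T.ξ.1) i).val * ev κ z n k (pow (intCode T.ξ.2) (N - i)).val *
          κ T.ξ.val ^ n) *
        (ev κ z n k (pow (intCode T.η.1) j).val * ev κ z n k (pow (intCode T.η.2) (N - j)).val *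
          κ T.η.val ^ k) *
        (ev κ z n k (quadCode T.quad i j).val * κ q ^ quadVal T.quad n k) *
        (ev κ z n k (prod ((elems T).map (elemCode N i j))).val *
          ((elems T).map fun e => elemBase κ z e N n k).prod) := by ring
    _ = _ := by rw [h1, h2, h3, hprod]; ring

end Term

end QHolonomic

namespace QHolonomic

open LCode

/-! ### Recurrence and support of the perturbed summand -/

section Soundness

variable {F : Type*} [Field F]

theorem ev_eqCoeff (κ : Kq →+* F) (z : Fˣ) (n k : ℤ) (P : EqCode) (l i : ℕ) :
    ev κ z n k (eqCoeff P (mono (l : ℤ) 0 0 1) i).val =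
      κ ((eqPoly P i).eval (q ^ (k + l))) := by
  have hx : ev κ z n k (mono (l : ℤ) 0 0 1).val = κ (q ^ (k + l)) := by
    rw [val_mono, ev_monK, map_zpow₀]
    simp [add_comm]
  have hrange : ∀ f : ℕ → LCode, ev κ z n k (prod ((List.range P.length).map f)).val =
      ∏ l ∈ Finset.range P.length, ev κ z n k (f l).val := by
    intro f
    rw [val_prod, map_list_prod, List.map_map, List.map_map,
      ← List.prod_toFinset _ List.nodup_range, List.toFinset_range]
    rfl
  rw [eqCoeff, val_prod, map_list_prod]
  simp only [List.map_cons, List.map_nil, List.prod_cons, List.prod_nil, mul_one]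
  rw [hrange, hrange, hrange, eqPoly, ev_intCode₂ κ z n k _ _ hx]
  simp only [Polynomial.eval_mul, Polynomial.eval_prod, map_mul, map_prod]
  congr 2
  · refine Finset.prod_congr rfl fun l _ => ?_
    split_ifs
    · simp
    · rw [ev_intCode₂ κ z n k _ _ hx]
  · congr 1
    · exact Finset.prod_congr rfl fun l _ => ev_intCode₂ κ z n k _ _ hx _
    · refine Finset.prod_congr rfl fun t _ => ?_
      rw [val_sub, val_mul, map_sub, map_mul, hx, val_mono, ev_monK]
      simp only [val_const, Int.cast_one, map_one, mul_zero, add_zero, zpow_zero, mul_one, one_mul,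
        zpow_natCast, Polynomial.eval_sub, Polynomial.eval_one, Polynomial.eval_mul,
        Polynomial.eval_pow, Polynomial.eval_C, Polynomial.eval_X, map_sub, map_mul, map_pow]

theorem eqPoly_of_length_le {P : EqCode} {i : ℕ} (h : P.length ≤ i) : eqPoly P i = 0 := by
  have : eqEntry P i = ([], [[1]]) := by
    simp [eqEntry, List.getD, h]
  have h0 : poly₂ (eqNum (eqEntry P i)) = 0 := by
    rw [this]
    simp [eqNum, poly₂]
  rw [eqPoly, h0, zero_mul]

theorem sum_range_ite_sub {M : Type*} [AddCommMonoid M] (g : ℕ → M) {l m N : ℕ} (h : l + m ≤ N)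
    (hg : ∀ i, m ≤ i → g i = 0) :
    (∑ j ∈ Finset.range N, if l ≤ j then g (j - l) else 0) = ∑ i ∈ Finset.range m, g i := by
  rw [← Finset.sum_filter]
  have : (Finset.range N).filter (fun j => l ≤ j) = Finset.Ico l N := by
    ext j
    simp only [Finset.mem_filter, Finset.mem_range, Finset.mem_Ico]
    omega
  rw [this, Finset.sum_Ico_eq_sum_range]
  simp only [Nat.add_sub_cancel_left]
  symm
  refine Finset.sum_subset (fun i hi => ?_) fun i _ hi => hg i ?_
  · rw [Finset.mem_range] at hi ⊢
    omega
  · simpa using hi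

theorem sum_list_range {M : Type*} [AddCommMonoid M] (f : ℕ → M) (n : ℕ) :
    ((List.range n).map f).sum = ∑ i ∈ Finset.range n, f i := by
  rw [← List.sum_toFinset _ List.nodup_range, List.toFinset_range]

theorem val_termRelation (P : EqCode) (T : TermCode) (c : Cert) (j : ℕ) :
    (Cert.termRelation P T c j).val =
      (∑ i ∈ Finset.range (c.order + 1), (c.alpha i j).val * (termCode T c.order i j).val) -
      ∑ l ∈ Finset.range (c.order + 2 - P.length), if l ≤ j then
        (c.beta l).val * (eqCoeff P (mono (l : ℤ) 0 0 1) (j - l)).val else 0 := by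
  rw [Cert.termRelation, val_sub, val_flatMap, val_flatMap, sum_list_range, sum_list_range]
  congr 1
  · exact Finset.sum_congr rfl fun i _ => val_mul _ _
  · refine Finset.sum_congr rfl fun i _ => ?_
    split_ifs
    · exact val_mul _ _
    · rfl

theorem val_sumRelation (c : Cert) (i : ℕ) :
    (Cert.sumRelation c i).val =
      (∑ j ∈ Finset.range (c.order + 1),
        (c.alpha i j).val * monK 1 0 ((c.weight * j : ℕ) : ℤ) 0 0) -
      (monK 1 0 1 0 0 - 1) ^ c.multiplicity *
        ((intCode₂ (mono 0 0 1 0) (c.result i)).val +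
          (monK 1 0 1 0 0 - 1) * (c.remainder i).val) := by
  have hz : Cert.zSubOne.val = monK 1 0 1 0 0 - 1 := by
    rw [Cert.zSubOne, val_sub, val_mono, val_const, Int.cast_one]
  rw [Cert.sumRelation, val_sub, val_flatMap, sum_list_range, val_mul, val_pow, val_append,
    val_mul, hz]
  congr 1
  exact Finset.sum_congr rfl fun i _ => by rw [val_mul, val_mono]

variable {κ : Kq →+* F} {z : Fˣ}

/-- By the term relations, the left side times `termUnit` is `termBase` times a combination of
shifted equations for the zero-extended `J`. It holds at all integers `n, k`, including points where
the term vanishes. -/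
theorem sum_alpha_mul_termFun {P : EqCode} {T : TermCode} {c : Cert} (hξ : T.ξ.val ≠ 0)
    (hη : T.η.val ≠ 0) (he : ∀ e ∈ elems T, ElemRec κ z e) (hc : c.IsValid P T) {J : ℕ → Kq}
    (hJ : Satisfies J P.toEq) (n k : ℤ) :
    ∑ j ∈ Finset.range (c.order + 1), ∑ i ∈ Finset.range (c.order + 1),
      ev κ z n 0 (c.alpha i j).val * termFun κ z T (n + i) (k + j) * κ (extend J (k + j)) = 0 := by
  have hα : ∀ i j, ev κ z n 0 (c.alpha i j).val = ev κ z n k (c.alpha i j).val := by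
    intro i j
    obtain ⟨r, hr⟩ := exists_val_dropK ((c.2.2.2.1.getD j []).getD i [])
    rw [Cert.alpha, hr]
    exact evalHom_C _ _ _ _ _ _
  simp only [hα]
  have hrel : ∀ j ∈ Finset.range (c.order + 1),
      (∑ i ∈ Finset.range (c.order + 1), ev κ z n k (c.alpha i j).val *
        ev κ z n k (termCode T c.order i j).val) * κ (extend J (k + j)) =
      ∑ l ∈ Finset.range (c.order + 2 - P.length), ev κ z n k (c.beta l).val *
        (if l ≤ j then κ ((eqPoly P (j - l)).eval (q ^ (k + l)) *
          extend J (k + l + (j - l : ℕ))) else 0) := by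
    intro j hj
    have h := (isZero_iff _).1 (hc.1 j (Finset.mem_range.1 hj))
    rw [val_termRelation, sub_eq_zero] at h
    have h' := congrArg (ev κ z n k) h
    simp only [map_sum, map_mul] at h'
    rw [h', Finset.sum_mul]
    refine Finset.sum_congr rfl fun l _ => ?_
    split_ifs with hlj
    · rw [map_mul, ev_eqCoeff, map_mul, mul_assoc]
      congr 4
      omega
    · simp
  have hzero : ∑ j ∈ Finset.range (c.order + 1), (∑ i ∈ Finset.range (c.order + 1),
      ev κ z n k (c.alpha i j).val * ev κ z n k (termCode T c.order i j).val) *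
        κ (extend J (k + j)) = 0 := by
    rw [Finset.sum_congr rfl hrel, Finset.sum_comm]
    refine Finset.sum_eq_zero fun l hl => ?_
    rw [Finset.mem_range] at hl
    rw [← Finset.mul_sum, sum_range_ite_sub (fun i => κ ((eqPoly P i).eval (q ^ (k + l)) *
      extend J (k + l + (i : ℕ)))) (m := P.length) (by omega), ← map_sum,
      sum_eqPoly_mul_extend hJ, map_zero, mul_zero]
    intro i hi
    rw [eqPoly_of_length_le hi]
    simp
  apply mul_left_cancel₀ (termUnit_ne_zero κ hξ hη c.order)
  rw [mul_zero, Finset.mul_sum]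
  have : ∀ j ∈ Finset.range (c.order + 1), termUnit κ T c.order *
      ∑ i ∈ Finset.range (c.order + 1), ev κ z n k (c.alpha i j).val *
        termFun κ z T (n + i) (k + j) * κ (extend J (k + j)) =
      termBase κ z T c.order n k * ((∑ i ∈ Finset.range (c.order + 1),
        ev κ z n k (c.alpha i j).val * ev κ z n k (termCode T c.order i j).val) *
        κ (extend J (k + j))) := by
    intro j hj
    rw [Finset.mul_sum, Finset.sum_mul, Finset.mul_sum]
    refine Finset.sum_congr rfl fun i hi => ?_
    have h := ev_termCode κ z hξ hη he n k (Nat.lt_succ_iff.1 (Finset.mem_range.1 hi))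
      (Nat.lt_succ_iff.1 (Finset.mem_range.1 hj))
    linear_combination (-ev κ z n k (c.alpha i j).val * κ (extend J (k + j))) * h
  rw [Finset.sum_congr rfl this, ← Finset.mul_sum, hzero, mul_zero]

theorem prod_map_elems (f : Elem → F) (T : TermCode) :
    ((elems T).map f).prod = (T.num.map fun g => ((numElems g).map f).prod).prod *
      ((T.den.map fun g => ((denElems g).map f).prod).prod * (boundaryElems.map f).prod) := by
  have h : ∀ (g : QFactor → List Elem) (l : List QFactor),
      ((l.flatMap g).map f).prod = (l.map fun x => ((g x).map f).prod).prod := by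
    intro g l
    induction l with
    | nil => simp
    | cons x l ih => simp [ih]
  rw [elems, List.map_append, List.map_append, List.prod_append, List.prod_append, h, h]

/-- One of the factors `1/(q; q)_k`, `1/(q; q)_{n-k}` is zero. -/
theorem termFun_eq_zero (T : TermCode) {n k : ℤ} (h : k < 0 ∨ n < k) :
    termFun κ z T n k = 0 := by
  have : (boundaryElems.map fun e => elemFun κ z e (elemForm e n k)).prod = 0 := by
    rw [List.prod_eq_zero_iff, List.mem_map]
    rcases h with h | h
    · refine ⟨(qRat, false, (0, 1, 0), false), by simp [boundaryElems], ?_⟩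
      simp [elemFun, elemForm, h]
    · refine ⟨(qRat, false, (1, -1, 0), false), by simp [boundaryElems], ?_⟩
      have : n + -k < 0 := by omega
      simp [elemFun, elemForm, this]
  rw [termFun, prod_map_elems, this, mul_zero, mul_zero, mul_zero]

theorem qRat_val : qRat.val = q := by
  simp [RatCode.val, qRat, intPoly_eq]

theorem one_sub_q_mul_ne_zero {s : ℤ} (hs : s ≠ -1) : 1 - q * q ^ s ≠ 0 := by
  rw [← zpow_one_add₀ q_ne_zero, sub_ne_zero]
  exact (q_zpow_ne_one (by omega)).symm

/-- For perturbed factors no `1 - x z q^s` vanishes, as `z` is not the inverse of an element of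
`ℚ(q)`. The only unperturbed ones are the reciprocals `1/(q; q)_s`, for which the extension by zero
has to be checked. -/
theorem elemRec_of_mem (hz : ∀ x : Kq, κ x * z ≠ 1) {T : TermCode} {e : Elem}
    (he : e ∈ elems T) : ElemRec κ z e := by
  have hgen : ∀ x : Kq, ∀ s : ℤ, 1 - κ x * z * κ q ^ s ≠ 0 := by
    intro x s h
    apply hz (x * q ^ s)
    rw [map_mul, map_zpow₀]
    linear_combination -h
  have hcases : e.2.1 = true ∨ (e.1 = qRat ∧ e.2.1 = false ∧ e.2.2.2 = false) := by
    simp only [elems, List.mem_append, List.mem_flatMap, numElems, denElems, boundaryElems,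
      List.mem_cons, List.not_mem_nil, or_false] at he
    rcases he with ⟨f, -, rfl | rfl⟩ | ⟨f, -, rfl | rfl⟩ | rfl | rfl | rfl | rfl <;> simp
  obtain ⟨x, b, l, s⟩ := e
  rcases hcases with h | ⟨h1, h2, h3⟩
  · simp only at h
    subst h
    have hy := hgen x.val
    cases s with
    | true =>
      simp only [ElemRec, elemFun, elemParam, cond_true, if_true]
      exact fun s => qPoch_succ (fun t _ => hy t) s
    | false =>
      simp only [ElemRec, elemFun, elemParam, cond_true, if_true, Bool.false_eq_true, if_false]
      intro s
      rw [qPoch_succ (fun t _ => hy t) s, mul_inv, mul_inv_cancel_left₀ (hy s)]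
  · simp only at h1 h2 h3
    subst h1 h2 h3
    simp only [ElemRec, elemFun, elemParam, cond_false, Bool.false_eq_true, if_false, mul_one,
      qRat_val]
    intro s
    have hq : ∀ s : ℤ, s ≠ -1 → 1 - κ q * κ q ^ s ≠ 0 := by
      intro s hs
      rw [← map_zpow₀, ← map_mul, ← map_one κ, ← map_sub]
      exact (map_ne_zero κ).2 (one_sub_q_mul_ne_zero hs)
    rcases lt_trichotomy s (-1) with h | rfl | h
    · rw [if_pos (by omega), if_pos (by omega), mul_zero]
    -- At `s = -1` the factor `1 - q q^(-1)` is zero, which matches the jump from the value `0` at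
    -- `-1` to `1` at `0`.
    · have : κ q ≠ 0 := (map_ne_zero κ).2 q_ne_zero
      simp [this]
    · rw [if_neg (by omega), if_neg (by omega)]
      obtain ⟨m, rfl⟩ := Int.eq_ofNat_of_zero_le (show 0 ≤ s by omega)
      rw [← Nat.cast_succ, qPoch_natCast, qPoch_natCast, Finset.prod_range_succ, mul_inv]
      have := hq m (by omega)
      rw [zpow_natCast] at this ⊢
      rw [mul_comm _ (1 - κ q * κ q ^ m)⁻¹, mul_inv_cancel_left₀ this]

end Soundness

end QHolonomic

namespace QHolonomic

open LCode

/-! ### Specialization of the perturbation parameter -/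

section Regular

variable (F : Type*) [Field F] [Algebra (PowerSeries Kq) F]

/-- `x` is the image of a power series with constant term `v`. -/
def Reg {F : Type*} [Field F] [Algebra (PowerSeries Kq) F] (x : F) (v : Kq) : Prop :=
  ∃ s : PowerSeries Kq, algebraMap _ F s = x ∧ PowerSeries.constantCoeff s = v

noncomputable def kappa : Kq →+* F := (algebraMap (PowerSeries Kq) F).comp PowerSeries.C

variable {F}

theorem reg_kappa (x : Kq) : Reg (kappa F x) x := ⟨PowerSeries.C x, rfl, by simp⟩

theorem reg_zero : Reg (0 : F) 0 := ⟨0, map_zero _, map_zero _⟩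

theorem reg_one : Reg (1 : F) 1 := ⟨1, map_one _, map_one _⟩

theorem Reg.add {x y : F} {v w : Kq} : Reg x v → Reg y w → Reg (x + y) (v + w) := by
  rintro ⟨s, rfl, rfl⟩ ⟨t, rfl, rfl⟩
  exact ⟨s + t, map_add _ _ _, map_add _ _ _⟩

theorem Reg.sub {x y : F} {v w : Kq} : Reg x v → Reg y w → Reg (x - y) (v - w) := by
  rintro ⟨s, rfl, rfl⟩ ⟨t, rfl, rfl⟩
  exact ⟨s - t, map_sub _ _ _, map_sub _ _ _⟩

theorem Reg.mul {x y : F} {v w : Kq} : Reg x v → Reg y w → Reg (x * y) (v * w) := by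
  rintro ⟨s, rfl, rfl⟩ ⟨t, rfl, rfl⟩
  exact ⟨s * t, map_mul _ _ _, map_mul _ _ _⟩

theorem Reg.inv {x : F} {v : Kq} (hv : v ≠ 0) : Reg x v → Reg x⁻¹ v⁻¹ := by
  rintro ⟨s, rfl, rfl⟩
  refine ⟨s⁻¹, ?_, PowerSeries.constantCoeff_inv s⟩
  have h : algebraMap (PowerSeries Kq) F s * algebraMap (PowerSeries Kq) F s⁻¹ = 1 := by
    rw [← map_mul, PowerSeries.mul_inv_cancel s hv, map_one]
  exact eq_inv_of_mul_eq_one_right h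

theorem Reg.pow {x : F} {v : Kq} (h : Reg x v) (n : ℕ) : Reg (x ^ n) (v ^ n) := by
  induction n with
  | zero => simpa using reg_one
  | succ n ih => rw [pow_succ, pow_succ]; exact ih.mul h

theorem Reg.zpow {x : F} {v : Kq} (h : Reg x v) (hv : v ≠ 0) (n : ℤ) : Reg (x ^ n) (v ^ n) := by
  cases n with
  | ofNat n => simpa using h.pow n
  | negSucc n =>
    rw [zpow_negSucc, zpow_negSucc]
    exact (h.pow _).inv (pow_ne_zero _ hv)

theorem reg_sum {ι : Type*} (s : Finset ι) {x : ι → F} {v : ι → Kq}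
    (h : ∀ i ∈ s, Reg (x i) (v i)) : Reg (∑ i ∈ s, x i) (∑ i ∈ s, v i) := by
  classical
  induction s using Finset.induction_on with
  | empty => simpa using reg_zero
  | insert i s hi ih =>
    rw [Finset.sum_insert hi, Finset.sum_insert hi]
    exact (h i (by simp)).add (ih fun j hj => h j (by simp [hj]))

theorem reg_prod {ι : Type*} (s : Finset ι) {x : ι → F} {v : ι → Kq}
    (h : ∀ i ∈ s, Reg (x i) (v i)) : Reg (∏ i ∈ s, x i) (∏ i ∈ s, v i) := by
  classical
  induction s using Finset.induction_on with
  | empty => simpa using reg_one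
  | insert i s hi ih =>
    rw [Finset.prod_insert hi, Finset.prod_insert hi]
    exact (h i (by simp)).mul (ih fun j hj => h j (by simp [hj]))

theorem reg_list_prod {ι : Type*} (l : List ι) {x : ι → F} {v : ι → Kq}
    (h : ∀ i ∈ l, Reg (x i) (v i)) : Reg (l.map x).prod (l.map v).prod := by
  induction l with
  | nil => simpa using reg_one
  | cons i l ih =>
    rw [List.map_cons, List.map_cons, List.prod_cons, List.prod_cons]
    exact (h i (by simp)).mul (ih fun j hj => h j (by simp [hj]))

theorem polyVal_kappa (p : List (List RatCode)) (n k : ℕ) :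
    polyVal (kappa F) p n k = kappa F
      (coeffEval (q ^ k) (p.map fun l => coeffEval (q ^ n) (l.map RatCode.val))) := by
  rw [map_coeffEval, polyVal, List.map_map]
  simp only [Function.comp_def, map_coeffEval, List.map_map, zpow_natCast, map_pow]

variable [IsFractionRing (PowerSeries Kq) F]

theorem Reg.eq_zero {x : F} {v : Kq} (h : Reg x v) (hx : x = 0) : v = 0 := by
  obtain ⟨s, rfl, rfl⟩ := h
  rw [map_eq_zero_iff _ (IsFractionRing.injective (PowerSeries Kq) F)] at hx
  rw [hx, map_zero]

variable (F) in
noncomputable def zUnit : Fˣ :=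
  Units.mk0 (algebraMap (PowerSeries Kq) F (1 + PowerSeries.X)) (by
    rw [Ne, map_eq_zero_iff _ (IsFractionRing.injective (PowerSeries Kq) F)]
    intro h
    simpa using congrArg PowerSeries.constantCoeff h)

variable (F) in
-- In `x (1 + t) = 1` the constant terms give `x = 1` and the linear terms give `x = 0`.
theorem kappa_mul_zUnit_ne_one (x : Kq) : kappa F x * zUnit F ≠ 1 := by
  intro h
  have h' : algebraMap (PowerSeries Kq) F (PowerSeries.C x * (1 + PowerSeries.X)) =
      algebraMap (PowerSeries Kq) F 1 := by
    rw [map_mul, map_one]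
    exact h
  have e := IsFractionRing.injective (PowerSeries Kq) F h'
  have e0 := congrArg (PowerSeries.coeff 0) e
  have e1 := congrArg (PowerSeries.coeff 1) e
  simp [mul_add, PowerSeries.coeff_one] at e0 e1
  simp [e0] at e1

theorem zUnit_sub_one_ne_zero : (zUnit F : F) - 1 ≠ 0 := by
  intro h
  apply kappa_mul_zUnit_ne_one F 1
  rw [map_one, one_mul]
  linear_combination h

theorem reg_zUnit : Reg (zUnit F : F) 1 := ⟨1 + PowerSeries.X, rfl, by simp⟩

theorem exists_reg_ev (n k : ℤ) (l : LCode) : ∃ v, Reg (ev (kappa F) (zUnit F) n k l.val) v := by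
  induction l with
  | nil => exact ⟨0, by simpa using reg_zero⟩
  | cons x l ih =>
    obtain ⟨v, hv⟩ := ih
    rw [val_cons, map_add, ev_monK]
    have h := ((reg_kappa (F := F) x.1).mul ((reg_kappa q).zpow q_ne_zero
      (x.2.1 + n * x.2.2.2.1 + k * x.2.2.2.2))).mul (reg_zUnit.zpow one_ne_zero x.2.2.1)
    rw [map_intCast] at h
    exact ⟨_, h.add hv⟩

theorem reg_factor (x : Kq) (t : ℤ) :
    Reg (1 - kappa F x * zUnit F * kappa F q ^ t) (1 - x * q ^ t) := by
  have h := reg_one.sub (((reg_kappa (F := F) x).mul reg_zUnit).mul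
    ((reg_kappa (F := F) q).zpow q_ne_zero t))
  rwa [mul_one] at h

/-- Definedness says precisely that the factors in the denominator stay nonzero at `z = 1`, so they
are invertible power series. -/
theorem reg_qPoch {x : Kq} {m : ℤ} (h : QFactorialDefined x m) :
    Reg (qPoch (kappa F q) (kappa F x * zUnit F) m) (qFactorial x m) := by
  cases m with
  | ofNat m =>
    refine reg_prod _ fun i _ => ?_
    simpa using reg_factor (F := F) x i
  | negSucc m =>
    refine (reg_prod _ fun i _ => reg_factor x _).inv (Finset.prod_ne_zero_iff.2 fun i hi => ?_)
    rw [Finset.mem_range] at hi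
    exact h _ (by rw [Int.negSucc_eq]; omega) (by omega)

theorem reg_qPoch_inv {x : Kq} {m : ℤ} (h : InvQFactorialDefined x m) :
    Reg (qPoch (kappa F q) (kappa F x * zUnit F) m)⁻¹ (qFactorial x m)⁻¹ := by
  cases m with
  | ofNat m =>
    refine Reg.inv (Finset.prod_ne_zero_iff.2 fun i hi => ?_) (reg_prod _ fun i _ => ?_)
    · rw [Finset.mem_range] at hi
      simpa using h i (by omega) (by simpa using hi)
    · simpa using reg_factor (F := F) x i
  | negSucc m =>
    simp only [qPoch, qFactorial, inv_inv]
    exact reg_prod _ fun i _ => reg_factor x _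

theorem quadVal_natCast (e : QuadForm) (n k : ℕ) : quadVal e n k = e.val n k := by
  rw [quadVal, QuadForm.val, LinForm.val, Nat.choose_two_right, Nat.choose_two_right,
    natCast_triangle, natCast_triangle]

theorem reg_boundary {m : ℕ} :
    Reg (qPoch (kappa F q) (kappa F q * zUnit F) m * (qPoch (kappa F q) (kappa F q) m)⁻¹) 1 := by
  have h1 : Reg (qPoch (kappa F q) (kappa F q * zUnit F) m) (qFactorial q m) :=
    reg_qPoch (fun j hj hj' => absurd (hj'.trans_le (Int.natCast_nonneg m)) (not_lt.2 hj))
  have h2 : qPoch (kappa F q) (kappa F q) m = kappa F (qFactorial q m) := by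
    rw [qPoch_natCast, show qFactorial q (m : ℤ) = ∏ i ∈ Finset.range m, (1 - q * q ^ i) from rfl,
      map_prod]
    simp
  have h3 : qFactorial q m ≠ 0 := by
    refine Finset.prod_ne_zero_iff.2 fun i _ => ?_
    simpa using one_sub_q_mul_ne_zero (s := i) (by omega)
  have h := h1.mul ((reg_kappa (F := F) _).inv h3)
  rwa [mul_inv_cancel₀ h3, ← h2] at h

/-- The separate `(x z; q)_{s+m}` and `1/(x z; q)_s` may have poles at `z = 1`. They are first
recombined into `(x z q^s; q)_m`, which is regular there by validity; the boundary product
specializes to `1`. -/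
theorem reg_termFun {T : TermCode} (hT : T.IsValid) {n k : ℕ} (hk : k ≤ n) :
    Reg (termFun (kappa F) (zUnit F) T n k) (T.val n k) := by
  obtain ⟨hξ, hη, hdef⟩ := hT
  obtain ⟨hnum, hden⟩ := hdef n k hk
  have hgen : ∀ x : Kq, ∀ s : ℤ, 1 - kappa F x * zUnit F * kappa F q ^ s ≠ 0 := by
    intro x s h
    apply kappa_mul_zUnit_ne_one F (x * q ^ s)
    rw [map_mul, map_zpow₀]
    linear_combination -h
  have hq : kappa F q ≠ 0 := (map_ne_zero _).2 q_ne_zero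
  have harg : ∀ f : QFactor, kappa F f.x.val * zUnit F * kappa F q ^ f.s.val n k =
      kappa F (f.arg n k) * zUnit F := by
    intro f
    rw [QFactor.arg, map_mul, map_zpow₀]
    ring
  have hform : ∀ f : QFactor, ∀ b c, elemForm (f.x, b, f.s.addTriple f.m, c) n k =
      f.s.val n k + f.m.val n k := by
    intro f b c
    simp only [elemForm, LinForm.addTriple, LinForm.val]
    ring
  have hpoch : ∀ f : QFactor, qPoch (kappa F q) (kappa F f.x.val * zUnit F)
      (f.s.val n k + f.m.val n k) *
      (qPoch (kappa F q) (kappa F f.x.val * zUnit F) (f.s.val n k))⁻¹ =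
      qPoch (kappa F q) (kappa F (f.arg n k) * zUnit F) (f.m.val n k) := by
    intro f
    rw [← qPoch_shift hq (hgen _), harg]
  have h1 : Reg ((T.num.map fun g => ((numElems g).map fun e =>
      elemFun (kappa F) (zUnit F) e (elemForm e n k)).prod).prod)
      ((T.num.map fun f => f.val n k).prod) := by
    refine reg_list_prod _ fun f hf => ?_
    simp only [numElems, List.map_cons, List.map_nil, List.prod_cons, List.prod_nil, mul_one,
      hform]
    have h := reg_qPoch (F := F) (hnum f hf)
    rw [← hpoch] at h
    exact h
  have h2 : Reg ((T.den.map fun g => ((denElems g).map fun e =>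
      elemFun (kappa F) (zUnit F) e (elemForm e n k)).prod).prod)
      ((T.den.map fun f => (f.val n k)⁻¹).prod) := by
    refine reg_list_prod _ fun f hf => ?_
    simp only [denElems, List.map_cons, List.map_nil, List.prod_cons, List.prod_nil, mul_one,
      hform]
    have h := reg_qPoch_inv (F := F) (hden f hf)
    rw [← hpoch, mul_inv, inv_inv, mul_comm] at h
    exact h
  have h3 : Reg ((boundaryElems.map fun e =>
      elemFun (kappa F) (zUnit F) e (elemForm e n k)).prod) 1 := by
    have e1 : (1 : ℤ) * n + -1 * k + 0 = ((n - k : ℕ) : ℤ) := by push_cast [hk]; ring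
    have e2 : (0 : ℤ) * n + 1 * k + 0 = (k : ℤ) := by ring
    have h := (reg_boundary (F := F) (m := k)).mul (reg_boundary (F := F) (m := n - k))
    rw [one_mul] at h
    convert h using 1
    simp only [boundaryElems, List.map_cons, List.map_nil, List.prod_cons, List.prod_nil, mul_one,
      elemForm, e1, e2, elemFun, elemParam, qRat_val, cond_true, cond_false, if_true,
      Bool.false_eq_true, if_false, not_lt.2 (Int.natCast_nonneg _)]
    ring
  rw [termFun, prod_map_elems, polyVal_kappa, quadVal_natCast]
  have h := (((((reg_kappa (F := F) (coeffEval (q ^ k) (T.poly.map fun l =>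
    coeffEval (q ^ n) (l.map RatCode.val)))).mul ((reg_kappa T.ξ.val).zpow hξ n)).mul
    ((reg_kappa T.η.val).zpow hη k)).mul ((reg_kappa q).zpow q_ne_zero (T.quad.val n k))).mul
    (h1.mul (h2.mul h3)))
  convert h using 1
  rw [TermCode.val, zpow_natCast, zpow_natCast]
  ring

/-- The interval contains every shift by `j ≤ N` of the support, so it serves as a finite substitute
for summation over all integers. -/
theorem sum_Ico_shift {M : Type*} [AddCommMonoid M] {g : ℤ → M} {N n j m : ℕ} (hj : j ≤ N)
    (hm : m ≤ n + N) (hg : ∀ k : ℤ, k < 0 ∨ (m : ℤ) < k → g k = 0) :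
    ∑ k ∈ Finset.Ico (-N : ℤ) (n + N + 1), g (k + j) = ∑ k ∈ Finset.range (m + 1), g k := by
  symm
  refine Finset.sum_bij_ne_zero (fun k _ _ => (k : ℤ) - j) ?_ ?_ ?_ ?_
  · intro k hk _
    rw [Finset.mem_range] at hk
    rw [Finset.mem_Ico]
    omega
  · intro a _ _ b _ _ h
    omega
  · intro k hk h0
    have h : ¬ (k + j < 0 ∨ (m : ℤ) < k + j) := fun h => h0 (hg _ h)
    push Not at h
    have e : (((k + j).toNat : ℕ) : ℤ) = k + j := Int.toNat_of_nonneg h.1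
    refine ⟨(k + j).toNat, ?_, ?_, ?_⟩
    · rw [Finset.mem_range]
      omega
    · rwa [e]
    · omega
  · intro k _ _
    rw [sub_add_cancel]

end Regular

/-- The recurrence for the perturbed summand is summed over `k`, divided by `(z - 1)^e`, and
specialized at `z = 1`, where the remainders `B_i` disappear. -/
theorem sum_result_mul_kernelSum (F : Type*) [Field F] [Algebra (PowerSeries Kq) F]
    [IsFractionRing (PowerSeries Kq) F] {P : EqCode} {T : TermCode} {c : Cert} (hT : T.IsValid)
    (hc : c.IsValid P T) {J : ℕ → Kq} (hJ : Satisfies J P.toEq) (n : ℕ) :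
    ∑ i ∈ Finset.range (c.order + 1), (poly₂ (c.result i)).eval (q ^ n) *
      kernelSum T.val J (n + i) = 0 := by
  let κ := kappa F
  let z := zUnit F
  have hz0 : (z : F) ≠ 0 := z.ne_zero
  have he : ∀ e ∈ elems T, ElemRec κ z e := fun e h =>
    elemRec_of_mem (kappa_mul_zUnit_ne_one F) h
  -- The weight `z^(-Yk)` is invisible at `z = 1`, but it multiplies the coefficient of the shift by
  -- `j` by `z^(Yj)`.
  let G : ℕ → ℤ → F := fun i k =>
    termFun κ z T (n + i) k * κ (extend J k) * (z : F) ^ (-(c.weight : ℤ) * k)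
  have hG0 : ∀ i : ℕ, ∀ k : ℤ, k < 0 ∨ ((n + i : ℕ) : ℤ) < k → G i k = 0 := by
    intro i k h
    simp only [G]
    rw [termFun_eq_zero T (by simpa using h), zero_mul, zero_mul]
  let a : ℕ → ℕ → F := fun i j => ev κ z n 0 (c.alpha i j).val
  have hrec : ∀ k : ℤ, ∑ j ∈ Finset.range (c.order + 1), ∑ i ∈ Finset.range (c.order + 1),
      a i j * (z : F) ^ (c.weight * j) * G i (k + j) = 0 := by
    intro k
    have h := sum_alpha_mul_termFun (κ := κ) (z := z) hT.1 hT.2.1 he hc hJ n k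
    have h' := congrArg (fun x => x * (z : F) ^ (-(c.weight : ℤ) * k)) h
    simp only [zero_mul, Finset.sum_mul] at h'
    rw [← h']
    refine Finset.sum_congr rfl fun j _ => Finset.sum_congr rfl fun i _ => ?_
    have e : (z : F) ^ (-(c.weight : ℤ) * k) =
        (z : F) ^ (c.weight * j) * (z : F) ^ (-(c.weight : ℤ) * (k + j)) := by
      rw [← zpow_natCast, ← zpow_add₀ hz0]
      congr 1
      push_cast
      ring
    rw [e]
    simp only [a, G]
    ring
  let S : ℕ → F := fun i => ∑ k ∈ Finset.range (n + i + 1), G i k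
  have hS : ∑ i ∈ Finset.range (c.order + 1),
      (∑ j ∈ Finset.range (c.order + 1), a i j * (z : F) ^ (c.weight * j)) * S i = 0 := by
    have h : ∑ k ∈ Finset.Ico (-c.order : ℤ) (n + c.order + 1),
        ∑ j ∈ Finset.range (c.order + 1), ∑ i ∈ Finset.range (c.order + 1),
          a i j * (z : F) ^ (c.weight * j) * G i (k + j) = 0 :=
      Finset.sum_eq_zero fun k _ => hrec k
    rw [Finset.sum_comm] at h
    rw [← h]
    simp only [Finset.sum_mul]
    rw [Finset.sum_comm]
    refine Finset.sum_congr rfl fun j hj => ?_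
    rw [Finset.sum_comm]
    refine Finset.sum_congr rfl fun i hi => ?_
    rw [Finset.mem_range] at hi hj
    rw [← Finset.mul_sum, sum_Ico_shift (by omega) (by omega) (hG0 i)]
  have hrel : ∀ i ∈ Finset.range (c.order + 1),
      ∑ j ∈ Finset.range (c.order + 1), a i j * (z : F) ^ (c.weight * j) =
      ((z : F) - 1) ^ c.multiplicity * (κ ((poly₂ (c.result i)).eval (q ^ n)) +
        ((z : F) - 1) * ev κ z n 0 (c.remainder i).val) := by
    intro i hi
    have h := (isZero_iff _).1 (hc.2.1 i (Finset.mem_range.1 hi))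
    rw [val_sumRelation, sub_eq_zero] at h
    have h' := congrArg (ev κ z n 0) h
    have hx : ev κ z n 0 (mono 0 0 1 0).val = κ (q ^ n) := by
      rw [val_mono, ev_monK]
      simp
    simp only [map_sum, map_mul, map_pow, map_sub, map_add, map_one, ev_monK,
      ev_intCode₂ κ z n 0 _ _ hx] at h'
    simpa only [Int.cast_one, one_mul, mul_zero, add_zero, zpow_zero, zpow_natCast, zpow_one]
      using h'
  have hcancel : ∑ i ∈ Finset.range (c.order + 1),
      (κ ((poly₂ (c.result i)).eval (q ^ n)) +
        ((z : F) - 1) * ev κ z n 0 (c.remainder i).val) * S i = 0 := by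
    apply mul_left_cancel₀ (pow_ne_zero c.multiplicity (zUnit_sub_one_ne_zero (F := F)))
    rw [mul_zero, Finset.mul_sum, ← hS]
    refine Finset.sum_congr rfl fun i hi => ?_
    rw [hrel i hi, mul_assoc]
  have hSreg : ∀ i, Reg (S i) (kernelSum T.val J (n + i)) := by
    intro i
    refine reg_sum _ fun k hk => ?_
    rw [Finset.mem_range] at hk
    have h1 := reg_termFun (F := F) hT (n := n + i) (k := k) (by omega)
    have h := (h1.mul (reg_kappa (F := F) (J k))).mul
      (reg_zUnit.zpow one_ne_zero (-(c.weight : ℤ) * k))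
    rw [one_zpow, mul_one] at h
    simp only [G, extend_natCast]
    push_cast at h
    exact h
  -- A vanishing power series has vanishing constant term; that constant term is the desired sum.
  refine Reg.eq_zero (F := F) (reg_sum _ fun i _ => ?_) hcancel
  obtain ⟨v, hv⟩ := exists_reg_ev (F := F) n 0 (c.remainder i)
  have h := ((reg_kappa (F := F) ((poly₂ (c.result i)).eval (q ^ n))).add
    ((reg_zUnit.sub reg_one).mul hv)).mul (hSreg i)
  rwa [sub_self, zero_mul, add_zero] at h

theorem poly₂_one : poly₂ [[1]] = 1 := by
  simp [poly₂, intPoly_eq]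

theorem toEq_output (c : Cert) : EqCode.toEq c.output =
    (List.range (c.order + 1)).map fun i => algebraMap _ KqQ (poly₂ (c.result i)) /
      algebraMap _ KqQ (poly₂ [[1]]) := by
  rw [EqCode.toEq, Cert.output, List.map_map]
  refine List.map_congr_left fun i _ => ?_
  simp only [Function.comp_apply, intPoly₂_eq_algebraMap]

theorem satisfies_output {P : EqCode} {T : TermCode} {c : Cert} (hT : T.IsValid)
    (hc : c.IsValid P T) {J : ℕ → Kq} (hJ : Satisfies J P.toEq) :
    Satisfies (kernelSum T.val J) (EqCode.toEq c.output) := by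
  intro n _
  have h1 : (poly₂ [[1]]).eval (q ^ n) ≠ 0 := by simp [poly₂_one]
  rw [← sum_result_mul_kernelSum (FractionRing (PowerSeries Kq)) hT hc hJ n,
    Finset.sum_fin_eq_sum_range]
  refine Finset.sum_congr (by simp [toEq_output]) fun i hi => ?_
  rw [Finset.mem_range] at hi
  rw [dif_pos (by simpa [toEq_output] using hi), List.get_eq_getElem]
  simp only [toEq_output, List.getElem_map, List.getElem_range]
  rw [valueAt_div h1, poly₂_one]
  simp

theorem isNontrivial_output {P : EqCode} {T : TermCode} {c : Cert} (hc : c.IsValid P T) :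
    IsNontrivial (EqCode.toEq c.output) := by
  obtain ⟨i, hi, h⟩ := hc.2.2
  refine ⟨_, by rw [toEq_output]; exact List.mem_map_of_mem (List.mem_range.2 hi), ?_⟩
  rw [poly₂_one, map_one, div_one, ← intPoly₂_eq_algebraMap, Ne, intPoly₂_eq_zero_iff]
  exact h

end QHolonomic

namespace QHolonomic

open LCode

/-! ### Laurent polynomials of bounded degree -/

section Bounded

variable {R : Type*} [CommRing R]

open LaurentPolynomial

/-- All exponents have absolute value at most `W`. -/
def DegBd (W : ℕ) (x : LaurentPolynomial R) : Prop := ∀ e : ℤ, (W : ℤ) < |e| → x.coeff e = 0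

theorem DegBd.mono {W W' : ℕ} {x : LaurentPolynomial R} (h : DegBd W x) (hW : W ≤ W') :
    DegBd W' x := fun e he => h e (lt_of_le_of_lt (by exact_mod_cast hW) he)

theorem degBd_zero (W : ℕ) : DegBd W (0 : LaurentPolynomial R) := fun e _ => by simp

theorem degBd_C_mul_T {W : ℕ} (r : R) {n : ℤ} (h : |n| ≤ W) : DegBd W (C r * T n) := by
  intro e he
  rw [← single_eq_C_mul_T, AddMonoidAlgebra.coeff_single, Finsupp.single_apply, if_neg]
  rintro rfl
  exact absurd h (not_le.2 he)

theorem degBd_one : DegBd 0 (1 : LaurentPolynomial R) := by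
  simpa using degBd_C_mul_T (W := 0) (1 : R) (n := 0) (by simp)

theorem DegBd.add {W : ℕ} {x y : LaurentPolynomial R} (hx : DegBd W x) (hy : DegBd W y) :
    DegBd W (x + y) := fun e he => by simp [hx e he, hy e he]

theorem DegBd.sub {W : ℕ} {x y : LaurentPolynomial R} (hx : DegBd W x) (hy : DegBd W y) :
    DegBd W (x - y) := fun e he => by simp [hx e he, hy e he]

theorem DegBd.smul {W : ℕ} {x : LaurentPolynomial R} (r : R) (hx : DegBd W x) :
    DegBd W (r • x) := fun e he => by simp [hx e he]

theorem degBd_sum {ι : Type*} (s : Finset ι) {W : ℕ} {x : ι → LaurentPolynomial R}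
    (h : ∀ i ∈ s, DegBd W (x i)) : DegBd W (∑ i ∈ s, x i) := by
  classical
  induction s using Finset.induction_on with
  | empty => simpa using degBd_zero W
  | insert i s hi ih =>
    rw [Finset.sum_insert hi]
    exact (h i (by simp)).add (ih fun j hj => h j (by simp [hj]))

theorem DegBd.eq_sum {W : ℕ} {x : LaurentPolynomial R} (hx : DegBd W x) :
    x = ∑ e ∈ Finset.Icc (-W : ℤ) W, C (x.coeff e) * T e := by
  ext d
  rw [AddMonoidAlgebra.coeff_sum, Finset.sum_apply']
  simp only [← single_eq_C_mul_T, AddMonoidAlgebra.coeff_single, Finsupp.single_apply]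
  rw [Finset.sum_ite_eq']
  split_ifs with h
  · rfl
  · apply hx
    rw [Finset.mem_Icc, ← abs_le] at h
    exact not_le.1 h

theorem DegBd.mul {W W' : ℕ} {x y : LaurentPolynomial R} (hx : DegBd W x) (hy : DegBd W' y) :
    DegBd (W + W') (x * y) := by
  rw [hx.eq_sum, hy.eq_sum, Finset.sum_mul_sum]
  refine degBd_sum _ fun a ha => degBd_sum _ fun b hb => ?_
  rw [Finset.mem_Icc, ← abs_le] at ha hb
  have e : C (x.coeff a) * T a * (C (y.coeff b) * T b) =
      C (x.coeff a * y.coeff b) * (T (a + b) : LaurentPolynomial R) := by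
    rw [map_mul, T_add]
    ring
  rw [e]
  refine degBd_C_mul_T _ ((abs_add_le a b).trans ?_)
  push_cast
  exact add_le_add ha hb

theorem DegBd.pow_zero {x : LaurentPolynomial R} (h : DegBd 0 x) (n : ℕ) : DegBd 0 (x ^ n) := by
  induction n with
  | zero => simpa using degBd_one
  | succ n ih => rw [pow_succ]; simpa using ih.mul h

theorem degBd_list_prod {ι : Type*} (l : List ι) {W : ι → ℕ} {x : ι → LaurentPolynomial R}
    (h : ∀ i ∈ l, DegBd (W i) (x i)) : DegBd (l.map W).sum (l.map x).prod := by
  induction l with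
  | nil => simpa using degBd_one
  | cons i l ih =>
    rw [List.map_cons, List.map_cons, List.prod_cons, List.sum_cons]
    exact (h i (by simp)).mul (ih fun j hj => h j (by simp [hj]))

theorem degBd_coeffEval {W : ℕ} {x : LaurentPolynomial R} (hx : DegBd W x)
    (l : List (LaurentPolynomial R)) (h : ∀ c ∈ l, DegBd 0 c) :
    DegBd (W * l.length) (coeffEval x l) := by
  induction l with
  | nil => exact degBd_zero _
  | cons c l ih =>
    rw [coeffEval_cons, List.length_cons, Nat.mul_succ, add_comm (W * _)]
    exact ((h c (by simp)).mono (by omega)).add (hx.mul (ih fun c hc => h c (by simp [hc])))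

/-- The coefficient functional. -/
noncomputable def coeffFunctional (e : ℤ) : LaurentPolynomial R →ₗ[R] R where
  toFun x := x.coeff e
  map_add' x y := by simp
  map_smul' r x := by simp

/-- The unknowns are the `α i j` and the coefficients of cofactors `β l` of degree at most `W - g`;
the conditions are the coefficients of degree at most `W` for each `j`. A linear map from a free
module to one of smaller rank over a nontrivial commutative ring is not injective, so a solution
exists over `R` itself. -/
theorem exists_recurrence [IsDomain R] {N m W g i₀ : ℕ} (w p : ℕ → ℕ → LaurentPolynomial R)
    (hw : ∀ i j, i < N + 1 → j < N + 1 → DegBd W (w i j)) (hp : ∀ l i, DegBd g (p l i))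
    (hi₀ : i₀ < m) (hp₀ : ∀ l, p l i₀ ≠ 0) (hp₁ : ∀ l, ∀ i < i₀, p l i = 0) (hg : g ≤ W)
    (hcard : (N + 1) * (2 * W + 1) < (N + 1) * (N + 1) + (N + 2 - m) * (2 * (W - g) + 1)) :
    ∃ (α : ℕ → ℕ → R) (β : ℕ → LaurentPolynomial R),
      (∃ i < N + 1, ∃ j < N + 1, α i j ≠ 0) ∧
      ∀ j < N + 1, ∑ i ∈ Finset.range (N + 1), C (α i j) * w i j =
        ∑ l ∈ Finset.range (N + 2 - m), if l ≤ j then β l * p l (j - l) else 0 := by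
  classical
  let I := (Fin (N + 1) × Fin (N + 1)) ⊕ (Fin (N + 2 - m) × Fin (2 * (W - g) + 1))
  let shift : Fin (2 * (W - g) + 1) → ℤ := fun a => (a : ℤ) - ((W - g : ℕ) : ℤ)
  let E : ℕ → (I → R) →ₗ[R] LaurentPolynomial R := fun j =>
    (∑ i : Fin (N + 1), if hj : j < N + 1 then
      (LinearMap.proj (Sum.inl (i, ⟨j, hj⟩)) : (I → R) →ₗ[R] R).smulRight (w i j) else 0) -
    ∑ l : Fin (N + 2 - m), ∑ a : Fin (2 * (W - g) + 1), if (l : ℕ) ≤ j then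
      (LinearMap.proj (Sum.inr (l, a)) : (I → R) →ₗ[R] R).smulRight
        (T (shift a) * p l (j - l)) else 0
  let β : (I → R) → Fin (N + 2 - m) → LaurentPolynomial R := fun v l =>
    ∑ a : Fin (2 * (W - g) + 1), C (v (Sum.inr (l, a))) * T (shift a)
  have hE : ∀ v : I → R, ∀ j : Fin (N + 1), E j v =
      (∑ i : Fin (N + 1), C (v (Sum.inl (i, j))) * w i j) -
      ∑ l : Fin (N + 2 - m), if (l : ℕ) ≤ j then β v l * p l (j - l) else 0 := by
    intro v j
    simp only [E, LinearMap.sub_apply, LinearMap.sum_apply]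
    congr 1
    · refine Finset.sum_congr rfl fun i _ => ?_
      rw [dif_pos j.2]
      simp [smul_eq_C_mul]
    · refine Finset.sum_congr rfl fun l _ => ?_
      split_ifs with h
      · rw [Finset.sum_mul]
        refine Finset.sum_congr rfl fun a _ => ?_
        rw [LinearMap.smulRight_apply, LinearMap.proj_apply, smul_eq_C_mul]
        ring
      · simp
  have hshift : ∀ a, |shift a| ≤ ((W - g : ℕ) : ℤ) := by
    intro a
    have := a.2
    simp only [shift]
    rw [abs_le]
    omega
  have hEbd : ∀ v j, DegBd W (E j v) := by
    intro v j
    simp only [E, LinearMap.sub_apply, LinearMap.sum_apply]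
    refine (degBd_sum _ fun i _ => ?_).sub (degBd_sum _ fun l _ => degBd_sum _ fun a _ => ?_)
    · split_ifs with hj
      · exact (hw i j i.2 hj).smul _
      · exact degBd_zero _
    · split_ifs
      · refine DegBd.smul _ (DegBd.mono (W := (W - g) + g) (DegBd.mul ?_ (hp _ _)) (by omega))
        simpa using degBd_C_mul_T (1 : R) (hshift a)
      · exact degBd_zero _
  let f : (I → R) →ₗ[R] (Fin (N + 1) × Fin (2 * W + 1) → R) :=
    LinearMap.pi fun je => (coeffFunctional ((je.2 : ℤ) - W)).comp (E je.1)
  have hf : ¬ Function.Injective f := by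
    intro hf
    have := card_le_of_injective R f hf
    simp only [I, Fintype.card_sum, Fintype.card_prod, Fintype.card_fin] at this
    omega
  obtain ⟨v, hv, hv0⟩ : ∃ v, f v = 0 ∧ v ≠ 0 := by
    rw [← LinearMap.ker_eq_bot, LinearMap.ker_eq_bot'] at hf
    push Not at hf
    exact hf
  have hE0 : ∀ j : Fin (N + 1), E j v = 0 := by
    intro j
    ext e
    by_cases he : (W : ℤ) < |e|
    · rw [hEbd v j e he]
      simp
    · have he' := abs_le.1 (not_lt.1 he)
      have h := congrFun hv (j, ⟨(e + W).toNat, by omega⟩)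
      have e1 : (((e + W).toNat : ℕ) : ℤ) - W = e := by omega
      simp only [f, LinearMap.pi_apply, LinearMap.comp_apply, coeffFunctional, LinearMap.coe_mk,
        AddHom.coe_mk, Pi.zero_apply, e1] at h
      rw [h]
      simp
  -- If `α = 0`, the system for `β` is triangular: the relation at `j = l + i₀` contains only `β l p
  -- l i₀` and terms with earlier `β`, because `p` vanishes below `i₀`.
  have hβ : (∀ i j, v (Sum.inl (i, j)) = 0) → ∀ l, β v l = 0 := by
    intro hα l
    obtain ⟨l, hl⟩ := l
    induction l using Nat.strong_induction_on with
    | _ l ih =>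
      have h := hE0 ⟨l + i₀, by omega⟩
      rw [hE] at h
      simp only [hα, map_zero, zero_mul, Finset.sum_const_zero, zero_sub, neg_eq_zero] at h
      rw [Finset.sum_eq_single ⟨l, hl⟩] at h
      · rw [if_pos (by simp), Nat.add_sub_cancel_left] at h
        exact (mul_eq_zero.1 h).resolve_right (hp₀ _)
      · intro l' _ hne
        have hne' : (l' : ℕ) ≠ l := fun h => hne (Fin.ext h)
        split_ifs with hle
        · rcases lt_or_gt_of_ne hne' with hlt | hgt
          · rw [ih l' hlt l'.2, zero_mul]
          · rw [hp₁ _ _ (by omega), mul_zero]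
        · rfl
      · simp
  have hαne : ∃ i j, v (Sum.inl (i, j)) ≠ 0 := by
    by_contra hcon
    push Not at hcon
    apply hv0
    funext x
    rcases x with ⟨i, j⟩ | ⟨l, a⟩
    · exact hcon i j
    · have h := congrArg (fun x => x.coeff (shift a)) (hβ hcon l)
      simp only [β, AddMonoidAlgebra.coeff_sum, Finset.sum_apply', ← single_eq_C_mul_T,
        AddMonoidAlgebra.coeff_single, Finsupp.single_apply] at h
      rw [Finset.sum_eq_single a] at h
      · simpa using h
      · intro b _ hb
        rw [if_neg]
        intro hs
        apply hb
        simp only [shift] at hs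
        exact Fin.ext (by omega)
      · simp
  obtain ⟨i, j, hij⟩ := hαne
  refine ⟨fun i j => if h : i < N + 1 ∧ j < N + 1 then v (Sum.inl (⟨i, h.1⟩, ⟨j, h.2⟩)) else 0,
    fun l => if h : l < N + 2 - m then β v ⟨l, h⟩ else 0, ⟨i, i.2, j, j.2, ?_⟩, ?_⟩
  · beta_reduce
    rwa [dif_pos ⟨i.2, j.2⟩]
  · intro j hj
    have h := hE0 ⟨j, hj⟩
    rw [hE, sub_eq_zero] at h
    rw [Finset.sum_range, Finset.sum_range]
    refine (Finset.sum_congr rfl fun i _ => ?_).trans (h.trans (Finset.sum_congr rfl fun l _ => ?_))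
    · beta_reduce
      rw [dif_pos (⟨i.2, hj⟩ : (i : ℕ) < N + 1 ∧ j < N + 1)]
    · beta_reduce
      rw [dif_pos l.2]

end Bounded

/-- Common factors `X - 1` are removed until some value at `1` is nonzero; the degree of the nonzero
`p i₁` bounds the number of steps. -/
theorem exists_factor_X_sub_one {A : Type*} [CommRing A] [IsDomain A] {N i₁ : ℕ}
    (p : ℕ → Polynomial A) (hi₁ : i₁ < N) (hp : p i₁ ≠ 0) :
    ∃ (e : ℕ) (a : ℕ → A) (b : ℕ → Polynomial A),
      (∀ i < N, p i = (Polynomial.X - 1) ^ e *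
        (Polynomial.C (a i) + (Polynomial.X - 1) * b i)) ∧ ∃ i < N, a i ≠ 0 := by
  induction hn : (p i₁).natDegree using Nat.strong_induction_on generalizing p with
  | _ n ih =>
    have hdiv : ∀ i, ∃ b, p i = Polynomial.C ((p i).eval 1) + (Polynomial.X - 1) * b := by
      intro i
      obtain ⟨b, hb⟩ := Polynomial.X_sub_C_dvd_sub_C_eval (a := 1) (p := p i)
      exact ⟨b, by rw [Polynomial.C_1] at hb; rw [← hb]; ring⟩
    choose b hb using hdiv
    by_cases h : ∃ i < N, (p i).eval 1 ≠ 0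
    · exact ⟨0, fun i => (p i).eval 1, b, fun i _ => by rw [pow_zero, one_mul]; exact hb i, h⟩
    · push Not at h
      have hb' : ∀ i < N, p i = (Polynomial.X - 1) * b i := by
        intro i hi
        have := hb i
        rwa [h i hi, map_zero, zero_add] at this
      have hb1 : b i₁ ≠ 0 := by
        intro h0
        apply hp
        rw [hb' i₁ hi₁, h0, mul_zero]
      have hX : (Polynomial.X - 1 : Polynomial A) ≠ 0 := by
        simpa using Polynomial.X_sub_C_ne_zero (1 : A)
      have hd : (b i₁).natDegree < n := by
        rw [← hn, hb' i₁ hi₁, Polynomial.natDegree_mul hX hb1]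
        have : (Polynomial.X - 1 : Polynomial A).natDegree = 1 := by
          simpa using Polynomial.natDegree_X_sub_C (1 : A)
        omega
      obtain ⟨e, a, b', h1, h2⟩ := ih _ hd b hb1 rfl
      refine ⟨e + 1, a, b', fun i hi => ?_, h2⟩
      rw [hb' i hi, h1 i hi]
      ring

end QHolonomic

namespace QHolonomic

open LCode

/-! ### Degrees in `K` of the codes -/

theorem degBd_monK (x a b c : ℤ) {d : ℤ} {W : ℕ} (h : |d| ≤ W) : DegBd W (monK x a b c d) :=
  degBd_C_mul_T _ h

theorem degBd_intCode (l : List ℤ) : DegBd 0 (intCode l).val := by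
  rw [intCode, val_horner]
  have h := degBd_coeffEval (W := 0) (x := (mono 1 0 0 0).val)
    (by rw [val_mono]; exact degBd_monK _ _ _ _ (by simp)) ((l.map const).map val) (by
      simp only [List.map_map, List.mem_map, Function.comp_apply, forall_exists_index, and_imp,
        forall_apply_eq_imp_iff₂, val_const, ← monK_int]
      exact fun c _ => degBd_monK _ _ _ _ (by simp))
  simpa using h

theorem degBd_intCode₂ {W : ℕ} {x : LCode} (hx : DegBd W x.val) (l : List (List ℤ)) :
    DegBd (W * l.length) (intCode₂ x l).val := by
  rw [intCode₂, val_horner]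
  have h := degBd_coeffEval hx ((l.map intCode).map val) (by
    simp only [List.map_map, List.mem_map, Function.comp_apply, forall_exists_index, and_imp,
      forall_apply_eq_imp_iff₂]
    exact fun c _ => degBd_intCode c)
  simpa using h

theorem degBd_fracHorner {W : ℕ} {x : LCode} (hx : DegBd W x.val) (l : List (LCode × LCode))
    (hl : ∀ c ∈ l, DegBd 0 c.1.val ∧ DegBd 0 c.2.val) :
    DegBd (W * l.length) (fracHorner x l).1.val ∧ DegBd 0 (fracHorner x l).2.val := by
  induction l with
  | nil => exact ⟨degBd_zero _, by simpa [fracHorner] using degBd_one⟩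
  | cons c l ih =>
    obtain ⟨h1, h2⟩ := ih fun c hc => hl c (by simp [hc])
    obtain ⟨hc1, hc2⟩ := hl c (by simp)
    have e : fracHorner x (c :: l) = (mul c.1 (fracHorner x l).2 ++
      mul x (mul (fracHorner x l).1 c.2), mul c.2 (fracHorner x l).2) := rfl
    rw [e, List.length_cons, Nat.mul_succ, add_comm (W * _)]
    refine ⟨?_, ?_⟩
    · rw [val_append, val_mul, val_mul, val_mul]
      exact ((hc1.mul h2).mono (by omega)).add (hx.mul (by simpa using h1.mul hc2))
    · rw [val_mul]
      simpa using hc2.mul h2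

theorem degBd_polyCode (p : List (List RatCode)) (i j : ℕ) :
    DegBd p.length (polyCode p i j).1.val := by
  have h := (degBd_fracHorner (W := 1) (x := mono j 0 0 1)
    (by rw [val_mono]; exact degBd_monK _ _ _ _ (by simp)) (p.map (polyRow (mono i 0 1 0))) (by
      simp only [List.mem_map, forall_exists_index, and_imp, forall_apply_eq_imp_iff₂]
      intro l _
      have := degBd_fracHorner (W := 0) (x := mono i 0 1 0)
        (by rw [val_mono]; exact degBd_monK _ _ _ _ (by simp))
        (l.map fun r => (intCode (ratNum r), intCode (ratDen r))) (by
          simp only [List.mem_map, forall_exists_index, and_imp, forall_apply_eq_imp_iff₂]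
          exact fun r _ => ⟨degBd_intCode _, degBd_intCode _⟩)
      rw [Nat.zero_mul] at this
      exact this)).1
  rw [Nat.one_mul, List.length_map] at h
  exact h

theorem degBd_quadCode (e : QuadForm) {N i j : ℕ} (hi : i ≤ N) (hj : j ≤ N) :
    DegBd ((e.nk.natAbs + e.kk.natAbs) * N) (quadCode e i j).val := by
  rw [quadCode, val_mono]
  refine degBd_monK _ _ _ _ ((abs_add_le _ _).trans ?_)
  rw [abs_mul, abs_mul, Nat.abs_cast, Nat.abs_cast]
  push_cast
  rw [add_mul]
  gcongr

theorem degBd_elemFactor (e : Elem) (t : ℤ) :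
    DegBd e.2.2.1.2.1.natAbs (elemFactor e t).val := by
  rw [elemFactor, val_sub, val_mul, val_mono]
  refine ((degBd_intCode _).mono (Nat.zero_le _)).sub ?_
  simpa using (degBd_intCode (ratNum e.1)).mul
    (degBd_monK 1 _ _ _ (Int.natCast_natAbs e.2.2.1.2.1).ge)

theorem degBd_elemCode (N i j : ℕ) (e : Elem) :
    DegBd (2 * (e.2.2.1.1.natAbs + e.2.2.1.2.1.natAbs) * e.2.2.1.2.1.natAbs * N)
      (elemCode N i j e).val := by
  rw [elemCode, val_prod, List.map_map]
  refine (degBd_list_prod (W := fun _ => e.2.2.1.2.1.natAbs) _ fun t _ => ?_).mono ?_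
  · rw [Function.comp_apply]
    split_ifs
    · exact degBd_elemFactor _ _
    · exact (degBd_intCode _).mono (Nat.zero_le _)
  · simp only [List.map_const', List.length_range, List.sum_replicate, elemRange, smul_eq_mul]
    apply le_of_eq
    ring

/-- Only linear growth in `N` is essential. The quadratic exponent contributes linearly, since its
second differences are constant, and each linear form needs `O(N)` factors of bounded degree. -/
theorem exists_degBd_termCode (T : TermCode) :
    ∃ c, ∀ N i j, i ≤ N → j ≤ N → DegBd (c * (N + 1)) (termCode T N i j).val := by
  let d : Elem → ℕ := fun e =>
    2 * (e.2.2.1.1.natAbs + e.2.2.1.2.1.natAbs) * e.2.2.1.2.1.natAbs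
  refine ⟨T.poly.length + (T.quad.nk.natAbs + T.quad.kk.natAbs) + ((elems T).map d).sum,
    fun N i j hi hj => ?_⟩
  have hE : DegBd (((elems T).map d).sum * N) (prod ((elems T).map (elemCode N i j))).val := by
    rw [val_prod, List.map_map, ← List.sum_map_mul_right]
    exact degBd_list_prod _ fun e _ => degBd_elemCode N i j e
  have hpow : ∀ (l : List ℤ) (n : ℕ), DegBd 0 ((intCode l).val ^ n) := fun l n =>
    (degBd_intCode l).pow_zero n
  have h := (degBd_polyCode T.poly i j).mul ((hpow T.ξ.1 i).mul ((hpow T.ξ.2 (N - i)).mul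
    ((hpow T.η.1 j).mul ((hpow T.η.2 (N - j)).mul
      ((degBd_quadCode T.quad hi hj).mul hE)))))
  rw [termCode, val_prod]
  simp only [List.map_cons, List.map_nil, List.prod_cons, List.prod_nil, mul_one, val_pow]
  refine h.mono ?_
  simp only [zero_add, add_mul, mul_add, mul_one]
  omega

theorem exists_degBd_eqCoeff (P : EqCode) :
    ∃ g, ∀ l i : ℕ, DegBd g (eqCoeff P (mono (l : ℤ) 0 0 1) i).val := by
  have hx : ∀ l : ℕ, DegBd 1 (mono (l : ℤ) 0 0 1).val := fun l => by
    rw [val_mono]; exact degBd_monK _ _ _ _ (by simp)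
  let D : ℕ → ℕ := fun i => (eqDen (eqEntry P i)).length
  let G : ℕ → ℕ := fun i => (eqNum (eqEntry P i)).length
  have hG : ∀ i, G i ≤ ∑ i ∈ Finset.range P.length, G i := by
    intro i
    by_cases hi : i < P.length
    · exact Finset.single_le_sum (fun _ _ => Nat.zero_le _) (Finset.mem_range.2 hi)
    · have : G i = 0 := by simp [G, eqEntry, List.getD, not_lt.1 hi, eqNum]
      omega
  refine ⟨(∑ i ∈ Finset.range P.length, G i) + (((List.range P.length).map D).sum +
    (((List.range P.length).map D).sum + ((List.range P.length).map fun _ => 1).sum)),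
    fun l i => ?_⟩
  have hden : ∀ l' : ℕ, DegBd (D l') (intCode₂ (mono (l : ℤ) 0 0 1) (eqDen (eqEntry P l'))).val :=
    fun l' => by simpa using degBd_intCode₂ (hx l) (eqDen (eqEntry P l'))
  have hnum : DegBd (G i) (intCode₂ (mono (l : ℤ) 0 0 1) (eqNum (eqEntry P i))).val := by
    simpa using degBd_intCode₂ (hx l) (eqNum (eqEntry P i))
  have h1 : DegBd 0 (const 1).val := by simpa using degBd_one
  rw [eqCoeff, val_prod]
  simp only [List.map_cons, List.map_nil, List.prod_cons, List.prod_nil, mul_one, val_prod,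
    List.map_map]
  refine (hnum.mono (hG i)).mul ((degBd_list_prod _ fun t _ => ?_).mul
    ((degBd_list_prod _ fun t _ => hden t).mul (degBd_list_prod _ fun t _ => ?_)))
  · rw [Function.comp_apply]
    split_ifs
    · exact h1.mono (Nat.zero_le _)
    · exact hden t
  · rw [Function.comp_apply, val_sub, val_mul, val_mono]
    exact (h1.mono (Nat.zero_le _)).sub ((degBd_monK _ _ _ _ (by simp) : DegBd 0 _).mul (hx l))

/-! ### The lowest coefficient of an equation -/

theorem eqPoly_eq_zero_iff (P : EqCode) (i : ℕ) :
    eqPoly P i = 0 ↔ poly₂ (eqNum (eqEntry P i)) = 0 := by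
  refine ⟨fun h => (mul_eq_zero.1 h).resolve_right (mul_ne_zero ?_ (mul_ne_zero ?_ ?_)),
    fun h => by rw [eqPoly, h, zero_mul]⟩
  · refine Finset.prod_ne_zero_iff.2 fun l _ => ?_
    split_ifs
    · exact one_ne_zero
    · exact eqDen_ne_zero _
  · exact Finset.prod_ne_zero_iff.2 fun l _ => eqDen_ne_zero _
  · refine Finset.prod_ne_zero_iff.2 fun l _ h1 => ?_
    simpa using congrArg (Polynomial.eval 0) h1

theorem eqCoeff_eq_zero {P : EqCode} {i : ℕ} (h : eqPoly P i = 0) (x : LCode) :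
    (eqCoeff P x i).val = 0 := by
  have h0 : AllZero₂ (eqNum (eqEntry P i)) := by
    rwa [← poly₂_eq_zero_iff, ← eqPoly_eq_zero_iff]
  have h1 : ∀ l : List ℤ, AllZero l → (intCode l).val = 0 := by
    intro l hl
    rw [intCode, val_horner]
    refine coeffEval_eq_zero _ _ fun c hc => ?_
    rw [List.map_map] at hc
    obtain ⟨a, ha, rfl⟩ := List.mem_map.1 hc
    simp [hl a ha]
  have h2 : (intCode₂ x (eqNum (eqEntry P i))).val = 0 := by
    rw [intCode₂, val_horner]
    refine coeffEval_eq_zero _ _ fun c hc => ?_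
    rw [List.map_map] at hc
    obtain ⟨a, ha, rfl⟩ := List.mem_map.1 hc
    exact h1 a (h0 a ha)
  rw [eqCoeff, val_prod, List.map_cons, List.prod_cons, h2, zero_mul]

/-- If the code had value zero, evaluation at the lattice points would give `eqPoly P i` the
infinitely many roots `q^(k+l)`. -/
theorem eqCoeff_ne_zero {P : EqCode} {i : ℕ} (h : eqPoly P i ≠ 0) (l : ℕ) :
    (eqCoeff P (mono (l : ℤ) 0 0 1) i).val ≠ 0 := by
  intro h0
  apply h
  refine Polynomial.eq_zero_of_infinite_isRoot _ (Set.Infinite.mono ?_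
    (Set.infinite_range_of_injective (f := fun k : ℕ => q ^ (k + l)) fun a b hab => ?_))
  · rintro _ ⟨k, rfl⟩
    have := ev_eqCoeff (RingHom.id Kq) 1 0 k P l i
    rw [h0, map_zero, RingHom.id_apply] at this
    exact_mod_cast this.symm
  · have := q_pow_injective hab
    omega

theorem exists_eqPoly_ne_zero {P : EqCode} (h : IsNontrivial P.toEq) :
    ∃ i < P.length, eqPoly P i ≠ 0 := by
  obtain ⟨a, ha, ha0⟩ := h
  obtain ⟨c, hc, rfl⟩ := List.mem_map.1 ha
  obtain ⟨i, hi, rfl⟩ := List.mem_iff_getElem.1 hc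
  refine ⟨i, hi, fun h0 => ha0 ?_⟩
  have : eqEntry P i = P[i] := by simp [eqEntry, List.getD, hi]
  rw [eqNum_div_eqDen, ← this, (eqPoly_eq_zero_iff P i).1 h0, map_zero, zero_div]

theorem exists_termRelation {P : EqCode} (hP : IsNontrivial P.toEq) (T : TermCode) :
    ∃ (N : ℕ) (α : ℕ → ℕ → LR) (β : ℕ → LK), (∃ i < N + 1, ∃ j < N + 1, α i j ≠ 0) ∧
      ∀ j < N + 1, ∑ i ∈ Finset.range (N + 1),
          LaurentPolynomial.C (α i j) * (termCode T N i j).val =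
        ∑ l ∈ Finset.range (N + 2 - P.length),
          if l ≤ j then β l * (eqCoeff P (mono (l : ℤ) 0 0 1) (j - l)).val else 0 := by
  classical
  obtain ⟨c, hc⟩ := exists_degBd_termCode T
  obtain ⟨g, hg⟩ := exists_degBd_eqCoeff P
  have hex := exists_eqPoly_ne_zero hP
  -- The lowest nonzero coefficient of the equation makes the system for the cofactors triangular.
  obtain ⟨hi₀, hi₁⟩ := Nat.find_spec hex
  have hmin : ∀ i < Nat.find hex, eqPoly P i = 0 := by
    intro i hi
    by_contra h
    exact Nat.find_min hex hi ⟨hi.trans hi₀, h⟩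
  obtain ⟨m, hm⟩ : ∃ m, P.length = m + 1 := ⟨P.length - 1, by omega⟩
  let d := c + g
  -- With `M = N + 1` and `W = d M`, unknowns minus conditions is `M^2 - 2 m d M - 2 g M + 2 m g -
  -- m`. For this `N` it is positive, as `key` shows.
  obtain ⟨N, hN⟩ : ∃ N, N = (m + 1) * (2 * d + 1) + 2 * g := ⟨_, rfl⟩
  refine ⟨N, exists_recurrence (W := d * (N + 1)) (g := g) (fun i j => (termCode T N i j).val)
    (fun l i => (eqCoeff P (mono (l : ℤ) 0 0 1) i).val) (fun i j hi hj => ?_) hg hi₀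
    (eqCoeff_ne_zero hi₁) (fun l i hi => eqCoeff_eq_zero (hmin i hi) _) ?_ ?_⟩
  · exact (hc N i j (by omega) (by omega)).mono (Nat.mul_le_mul_right _ (Nat.le_add_right _ _))
  · exact (Nat.le_add_left g c).trans (Nat.le_mul_of_pos_right _ (Nat.succ_pos _))
  · have hgW : g ≤ d * (N + 1) :=
      (Nat.le_add_left g c).trans (Nat.le_mul_of_pos_right _ (Nat.succ_pos _))
    have hmN : m ≤ N + 1 := by
      have : m + 1 ≤ (m + 1) * (2 * d + 1) := Nat.le_mul_of_pos_right _ (Nat.succ_pos _)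
      omega
    obtain ⟨x, hx⟩ := Nat.exists_eq_add_of_le hgW
    obtain ⟨y, hy⟩ := Nat.exists_eq_add_of_le hmN
    rw [hm, show N + 2 - (m + 1) = y by omega, show d * (N + 1) - g = x by omega]
    replace hN : N + 1 = (m + 1) * (2 * d + 1) + 2 * g + 1 := by rw [hN]
    generalize N + 1 = M at *
    zify at hx hy hN ⊢
    have hx' : (x : ℤ) = d * M - g := by linarith
    have hy' : (y : ℤ) = M - m := by linarith
    have key : (M : ℤ) * M + y * (2 * x + 1) = M * (2 * (d * M) + 1) +
        (M * (2 * d + 1) + (M + 2 * m * g) + m * (M - 1)) := by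
      rw [hx', hy']
      linear_combination (M : ℤ) * hN
    have hM : (1 : ℤ) ≤ M := by
      have : (0 : ℤ) ≤ (m + 1) * (2 * d + 1) + 2 * g := by positivity
      linarith
    have : (0 : ℤ) ≤ m * (M - 1) := mul_nonneg (by positivity) (by linarith)
    have : (0 : ℤ) ≤ M * (2 * d + 1) := by positivity
    have : (0 : ℤ) ≤ 2 * m * g := by positivity
    linarith

end QHolonomic

namespace QHolonomic

open LCode

/-! ### Existence of certificates -/

theorem monR_pow (a b c : ℤ) (n : ℕ) : monR 1 a b c ^ n = monR 1 (n * a) (n * b) (n * c) := by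
  simp [monR, AddMonoidAlgebra.single_pow]

theorem monR_ne_zero (a b c : ℤ) : monR 1 a b c ≠ 0 := by
  simp [monR]

/-- The nonzero polynomial `∑ α_j X^j` over a domain cannot vanish at all of the distinct points
`z^Y`. -/
theorem exists_weight {N : ℕ} {α : ℕ → LR} (h : ∃ j < N + 1, α j ≠ 0) :
    ∃ Y : ℕ, ∑ j ∈ Finset.range (N + 1), α j * monR 1 0 ((Y * j : ℕ) : ℤ) 0 ≠ 0 := by
  by_contra! hcon
  obtain ⟨j, hj, hα⟩ := h
  let p : Polynomial LR := ∑ j ∈ Finset.range (N + 1), Polynomial.monomial j (α j)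
  have hp : p = 0 := by
    refine Polynomial.eq_zero_of_infinite_isRoot _ (Set.Infinite.mono ?_
      (Set.infinite_range_of_injective (f := fun Y : ℕ => monR 1 0 Y 0) fun a b hab => ?_))
    · rintro _ ⟨Y, rfl⟩
      refine Eq.trans ?_ (hcon Y)
      simp only [p, Polynomial.eval_finsetSum, Polynomial.eval_monomial, monR_pow]
      refine Finset.sum_congr rfl fun j _ => ?_
      push_cast
      rw [mul_zero, mul_comm (Y : ℤ)]
    · have := (AddMonoidAlgebra.single_left_inj (one_ne_zero : (1 : ℤ) ≠ 0)).1 hab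
      simpa using this
  apply hα
  have := congrArg (fun p => Polynomial.coeff p j) hp
  simpa [p, Polynomial.finsetSum_coeff, Polynomial.coeff_monomial, Nat.lt_succ_iff.1 hj]
    using this

/-- The map from `ℤ[q][Q][z]` to Laurent polynomials. -/
noncomputable def polyHom : Polynomial (Polynomial (Polynomial ℤ)) →+* LR :=
  Polynomial.eval₂RingHom (Polynomial.eval₂RingHom
    (Polynomial.eval₂RingHom (Int.castRingHom LR) (monR 1 1 0 0)) (monR 1 0 0 1)) (monR 1 0 1 0)

theorem polyHom_q : polyHom (Polynomial.C (Polynomial.C Polynomial.X)) = monR 1 1 0 0 := by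
  simp [polyHom]

theorem polyHom_Q : polyHom (Polynomial.C Polynomial.X) = monR 1 0 0 1 := by
  simp [polyHom]

theorem polyHom_z : polyHom Polynomial.X = monR 1 0 1 0 := by
  simp [polyHom]

theorem map_X_sub_one {A B : Type*} [CommRing A] [CommRing B] (f : Polynomial A →+* B) :
    f (Polynomial.X - 1) = f Polynomial.X - 1 := by
  rw [map_sub, map_one]

theorem polyHom_X_sub_one : polyHom (Polynomial.X - 1) = monR 1 0 1 0 - 1 :=
  (map_X_sub_one polyHom).trans (by rw [polyHom_z])

theorem exists_polyHom_eq_monR (x : ℤ) (a b c : ℕ) : ∃ p, polyHom p = monR x a b c := by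
  have hx : polyHom (Polynomial.C (Polynomial.C (Polynomial.C x))) = monR x 0 0 0 := by
    simp [polyHom, monR_int]
  refine ⟨Polynomial.C (Polynomial.C (Polynomial.C x)) *
    Polynomial.C (Polynomial.C Polynomial.X) ^ a * Polynomial.X ^ b *
    Polynomial.C Polynomial.X ^ c, ?_⟩
  rw [map_mul, map_mul, map_mul, map_pow, map_pow, map_pow, hx, polyHom_q, polyHom_Q,
    polyHom_z, monR_pow, monR_pow, monR_pow, monR_mul, monR_mul, monR_mul]
  simp

/-- Negative exponents are cleared by a monomial. The bound holds for all larger `s`, so one `s`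
serves finitely many elements. -/
theorem exists_mul_eq_polyHom (r : LR) :
    ∃ s₀ : ℕ, ∀ s : ℕ, s₀ ≤ s → ∃ p, polyHom p = monR 1 s s s * r := by
  induction r using AddMonoidAlgebra.induction_linear with
  | zero => exact ⟨0, fun s _ => ⟨0, by simp⟩⟩
  | add r r' hr hr' =>
    obtain ⟨s₁, h₁⟩ := hr
    obtain ⟨s₂, h₂⟩ := hr'
    refine ⟨s₁ + s₂, fun s hs => ?_⟩
    obtain ⟨p, hp⟩ := h₁ s (by omega)
    obtain ⟨p', hp'⟩ := h₂ s (by omega)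
    exact ⟨p + p', by rw [map_add, hp, hp', mul_add]⟩
  | single m x =>
    obtain ⟨a, b, c⟩ := m
    refine ⟨a.natAbs + b.natAbs + c.natAbs, fun s hs => ?_⟩
    obtain ⟨p, hp⟩ := exists_polyHom_eq_monR x (s + a).toNat (s + b).toNat (s + c).toNat
    refine ⟨p, hp.trans ?_⟩
    have : (AddMonoidAlgebra.single (a, b, c) x : LR) = monR x a b c := rfl
    rw [this, monR_mul, one_mul, Int.toNat_of_nonneg (by omega), Int.toNat_of_nonneg (by omega),
      Int.toNat_of_nonneg (by omega)]

/-- The element of `ℤ[q][Q]` with the given list of coefficients. -/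
noncomputable def listPoly₂ (L : List (List ℤ)) : Polynomial (Polynomial ℤ) :=
  coeffEval Polynomial.X ((L.map fun l =>
    coeffEval Polynomial.X (l.map Polynomial.C)).map Polynomial.C)

theorem exists_listPoly₂_eq (a : Polynomial (Polynomial ℤ)) : ∃ L, listPoly₂ L = a := by
  obtain ⟨l, rfl⟩ := exists_coeffEval_X_eq a
  choose f hf using fun p : Polynomial ℤ => exists_coeffEval_X_eq p
  refine ⟨l.map f, ?_⟩
  rw [listPoly₂]
  have : ((fun l : List ℤ => coeffEval Polynomial.X (l.map Polynomial.C)) ∘ f) = id :=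
    funext fun p => (hf p).symm
  rw [List.map_map (l := l), this, List.map_id]

theorem not_allZero₂_of_listPoly₂_ne_zero {L : List (List ℤ)} (h : listPoly₂ L ≠ 0) :
    ¬ AllZero₂ L := by
  intro h0
  apply h
  refine coeffEval_eq_zero _ _ fun c hc => ?_
  rw [List.map_map] at hc
  obtain ⟨l, hl, rfl⟩ := List.mem_map.1 hc
  rw [Function.comp_apply, coeffEval_eq_zero, map_zero]
  intro c hc
  obtain ⟨x, hx, rfl⟩ := List.mem_map.1 hc
  rw [h0 l hl x hx, map_zero]

theorem val_intCode₂_eq (L : List (List ℤ)) :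
    (intCode₂ (mono 0 0 1 0) L).val =
      LaurentPolynomial.C (polyHom (Polynomial.C (listPoly₂ L))) := by
  have h1 : ∀ l : List ℤ, (intCode l).val = LaurentPolynomial.C
      (polyHom (Polynomial.C (Polynomial.C (coeffEval Polynomial.X (l.map Polynomial.C))))) := by
    intro l
    rw [intCode, val_horner, map_coeffEval, map_coeffEval, map_coeffEval, map_coeffEval]
    simp only [List.map_map]
    congr 1
    · simp [polyHom_q, monK]
    · refine List.map_congr_left fun c _ => ?_
      simp
  rw [intCode₂, val_horner, listPoly₂, map_coeffEval, map_coeffEval, map_coeffEval]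
  simp only [List.map_map]
  congr 1
  · simp [polyHom_Q, monK]
  · exact List.map_congr_left fun l _ => h1 l

theorem getD_map_range {β : Type*} (f : ℕ → β) {n i : ℕ} (h : i < n) (d : β) :
    ((List.range n).map f).getD i d = f i := by
  simp [List.getD, h]

/-- All relations are multiplied by the same `(q z Q)^s`, which puts the summed coefficients into
`ℤ[q][Q][z]`. There the powers of `z - 1` can be divided out, and the values at `z = 1` give the
coefficients of the output. -/
theorem exists_isValid {P : EqCode} (hP : IsNontrivial P.toEq) (T : TermCode) :
    ∃ c : Cert, c.IsValid P T := by
  obtain ⟨N, α, β, ⟨i₁, hi₁, hα⟩, hrel⟩ := exists_termRelation hP T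
  obtain ⟨Y, hY⟩ := exists_weight hα
  choose s₀ hs₀ using fun i =>
    exists_mul_eq_polyHom (∑ j ∈ Finset.range (N + 1), α i j * monR 1 0 ((Y * j : ℕ) : ℤ) 0)
  let s := ∑ i ∈ Finset.range (N + 1), s₀ i
  have hp : ∀ i, ∃ p, i < N + 1 → polyHom p = monR 1 s s s *
      ∑ j ∈ Finset.range (N + 1), α i j * monR 1 0 ((Y * j : ℕ) : ℤ) 0 := by
    intro i
    by_cases hi : i < N + 1
    · obtain ⟨p, hp⟩ := hs₀ i s
        (Finset.single_le_sum (fun _ _ => Nat.zero_le _) (Finset.mem_range.2 hi))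
      exact ⟨p, fun _ => hp⟩
    · exact ⟨0, fun h => absurd h hi⟩
  choose p hp using hp
  have hp₁ : p i₁ ≠ 0 := by
    intro h0
    have := hp i₁ hi₁
    rw [h0, map_zero] at this
    exact mul_ne_zero (monR_ne_zero _ _ _) hY this.symm
  obtain ⟨e, a, b, hab, i₂, hi₂, ha⟩ := exists_factor_X_sub_one p hi₁ hp₁
  choose A hA using fun i => exists_listPoly₂_eq (a i)
  choose cα hcα hcα' using fun i j => exists_val_eq_C (monR 1 s s s * α i j)
  choose cβ hcβ using fun l => exists_val_eq (LaurentPolynomial.C (monR 1 s s s) * β l)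
  choose B hB using fun i => exists_val_eq (LaurentPolynomial.C (polyHom (b i)))
  let c : Cert := (N, Y, e,
    (List.range (N + 1)).map fun j => (List.range (N + 1)).map fun i => cα i j,
    (List.range (N + 2 - P.length)).map cβ, (List.range (N + 1)).map A,
    (List.range (N + 1)).map B)
  have horder : c.order = N := rfl
  have halpha : ∀ i < N + 1, ∀ j < N + 1,
      (c.alpha i j).val = LaurentPolynomial.C (monR 1 s s s * α i j) := by
    intro i hi j hj
    have : c.alpha i j = cα i j := by
      simp only [Cert.alpha, c]
      rw [getD_map_range _ hj, getD_map_range _ hi, hcα]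
    rw [this, hcα']
  have hbeta : ∀ l < N + 2 - P.length,
      (c.beta l).val = LaurentPolynomial.C (monR 1 s s s) * β l := by
    intro l hl
    have : c.beta l = cβ l := getD_map_range _ hl _
    rw [this, hcβ]
  have hresult : ∀ i < N + 1, c.result i = A i := fun i hi => getD_map_range _ hi _
  have hrem : ∀ i < N + 1, c.remainder i = B i := fun i hi => getD_map_range _ hi _
  refine ⟨c, fun j hj => ?_, fun i hi => ?_, i₂, hi₂, ?_⟩
  · rw [isZero_iff, val_termRelation, horder, sub_eq_zero]
    rw [horder] at hj
    have h := congrArg (fun x => LaurentPolynomial.C (monR 1 s s s) * x) (hrel j hj)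
    simp only [Finset.mul_sum] at h
    refine (Finset.sum_congr rfl fun i hi => ?_).trans
      (h.trans (Finset.sum_congr rfl fun l hl => ?_))
    · rw [halpha i (Finset.mem_range.1 hi) j hj, map_mul, mul_assoc]
    · rw [hbeta l (Finset.mem_range.1 hl)]
      split_ifs
      · rw [mul_assoc]
      · rw [mul_zero]
  · rw [isZero_iff, val_sumRelation, horder, hresult i hi, hrem i hi, val_intCode₂_eq, hA, hB,
      sub_eq_zero]
    have h := congrArg (fun x => LaurentPolynomial.C (polyHom x)) (hab i hi)
    have hz : monK 1 0 1 0 0 - 1 = LaurentPolynomial.C (polyHom (Polynomial.X - 1)) := by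
      rw [polyHom_X_sub_one, map_sub, map_one]
      simp [monK]
    simp only [map_mul, map_pow, map_add, ← hz] at h
    refine Eq.trans ?_ h
    rw [hp i hi, Finset.mul_sum, map_sum]
    refine Finset.sum_congr rfl fun j hj => ?_
    rw [halpha i hi j (Finset.mem_range.1 hj), ← mul_assoc, map_mul _ (_ * _)]
    simp [monK, c, Cert.weight]
  · rw [hresult i₂ hi₂]
    exact not_allZero₂_of_listPoly₂_ne_zero (by rwa [hA])

end QHolonomic

namespace QHolonomic

/-! ### Every equation has a code -/

section Fractions

variable {R F : Type*} [CommRing R] [Field F]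

/-- The map `R[X] → F(X)` induced by a map `R → F`. -/
noncomputable def polyToRatFunc (ι : R →+* F) : Polynomial R →+* RatFunc F :=
  (algebraMap (Polynomial F) (RatFunc F)).comp (Polynomial.mapRingHom ι)

theorem polyToRatFunc_injective {ι : R →+* F} (hι : Function.Injective ι) :
    Function.Injective (polyToRatFunc ι) :=
  (RatFunc.algebraMap_injective F).comp (Polynomial.map_injective ι hι)

/-- Clearing denominators of coefficients. It serves twice, to pass from `ℚ` to `ℚ(q)` and from
there to `ℚ(q)(Q)`, always with numerators and denominators over `ℤ`. -/
theorem exists_C_mul_eq_map [IsDomain R] {ι : R →+* F} (h : ∀ x, ∃ a b, b ≠ 0 ∧ ι b * x = ι a)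
    (p : Polynomial F) :
    ∃ (P : Polynomial R) (b : R), b ≠ 0 ∧ Polynomial.C (ι b) * p = P.map ι := by
  induction p using Polynomial.induction_on' with
  | add p₁ p₂ h₁ h₂ =>
    obtain ⟨P₁, b₁, hb₁, e₁⟩ := h₁
    obtain ⟨P₂, b₂, hb₂, e₂⟩ := h₂
    refine ⟨Polynomial.C b₂ * P₁ + Polynomial.C b₁ * P₂, b₁ * b₂, mul_ne_zero hb₁ hb₂, ?_⟩
    rw [Polynomial.map_add, Polynomial.map_mul, Polynomial.map_mul, ← e₁, ← e₂,
      Polynomial.map_C, Polynomial.map_C, map_mul, map_mul]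
    ring
  | monomial n x =>
    obtain ⟨a, b, hb, e⟩ := h x
    exact ⟨Polynomial.monomial n a, b, hb, by
      rw [Polynomial.C_mul_monomial, e, Polynomial.map_monomial]⟩

theorem exists_polyToRatFunc_mul_eq [IsDomain R] {ι : R →+* F} (hι : Function.Injective ι)
    (h : ∀ x, ∃ a b, b ≠ 0 ∧ ι b * x = ι a) (x : RatFunc F) :
    ∃ a b, b ≠ 0 ∧ polyToRatFunc ι b * x = polyToRatFunc ι a := by
  obtain ⟨P₁, b₁, hb₁, e₁⟩ := exists_C_mul_eq_map h x.num
  obtain ⟨P₂, b₂, hb₂, e₂⟩ := exists_C_mul_eq_map h x.denom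
  have hden : algebraMap (Polynomial F) (RatFunc F) x.denom ≠ 0 :=
    (map_ne_zero_iff _ (RatFunc.algebraMap_injective F)).2 x.denom_ne_zero
  have hι' : ∀ b, b ≠ 0 → Polynomial.C (ι b) ≠ 0 := fun b hb =>
    Polynomial.C_ne_zero.2 ((map_ne_zero_iff ι hι).2 hb)
  refine ⟨Polynomial.C b₂ * P₁, Polynomial.C b₁ * P₂,
    mul_ne_zero (Polynomial.C_ne_zero.2 hb₁) ?_, ?_⟩
  · rintro rfl
    rw [Polynomial.map_zero] at e₂
    exact mul_ne_zero (hι' b₂ hb₂) x.denom_ne_zero e₂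
  · have hx : algebraMap (Polynomial F) (RatFunc F) x.denom * x =
        algebraMap (Polynomial F) (RatFunc F) x.num := by
      rw [mul_comm, ← eq_div_iff hden, RatFunc.num_div_denom]
    simp only [polyToRatFunc, RingHom.comp_apply, Polynomial.coe_mapRingHom, Polynomial.map_C,
      ← e₁, ← e₂, map_mul]
    linear_combination algebraMap (Polynomial F) (RatFunc F) (Polynomial.C (ι b₁)) *
      algebraMap (Polynomial F) (RatFunc F) (Polynomial.C (ι b₂)) * hx

end Fractions

theorem polyToRatFunc_listPoly₂ (L : List (List ℤ)) :
    polyToRatFunc (polyToRatFunc (Int.castRingHom ℚ)) (listPoly₂ L) = intPoly₂ L := by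
  have h1 : ∀ l : List ℤ, polyToRatFunc (Int.castRingHom ℚ)
      (coeffEval Polynomial.X (l.map Polynomial.C)) = intPoly l := by
    intro l
    rw [map_coeffEval, intPoly_eq, List.map_map]
    congr 1
    · simp [polyToRatFunc, q]
    · refine List.map_congr_left fun c _ => ?_
      simp [polyToRatFunc]
  rw [listPoly₂, map_coeffEval, intPoly₂, List.map_map, List.map_map]
  congr 1
  · simp [polyToRatFunc]
  · refine List.map_congr_left fun l _ => ?_
    rw [Function.comp_apply, Function.comp_apply, ← h1]
    simp [polyToRatFunc]

theorem exists_toEq_eq (L : List KqQ) : ∃ P : EqCode, P.toEq = L := by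
  have hι : Function.Injective (polyToRatFunc (Int.castRingHom ℚ)) :=
    polyToRatFunc_injective (RingHom.injective_int _)
  have h : ∀ x : KqQ, ∃ c : CoeffCode, intPoly₂ c.1 / intPoly₂ c.2 = x := by
    intro x
    obtain ⟨a, b, hb, e⟩ := exists_polyToRatFunc_mul_eq hι
      (exists_polyToRatFunc_mul_eq (RingHom.injective_int (Int.castRingHom ℚ)) fun x =>
        ⟨x.num, x.den, by simp, by simp [Rat.den_mul_eq_num]⟩) x
    obtain ⟨A, rfl⟩ := exists_listPoly₂_eq a
    obtain ⟨B, rfl⟩ := exists_listPoly₂_eq b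
    refine ⟨(A, B), ?_⟩
    have hB := (map_ne_zero_iff _ (polyToRatFunc_injective hι)).2 hb
    rw [polyToRatFunc_listPoly₂] at hB e
    rw [polyToRatFunc_listPoly₂] at e
    rw [div_eq_iff hB, ← e, mul_comm]
  choose f hf using h
  refine ⟨L.map f, ?_⟩
  rw [EqCode.toEq, List.map_map]
  exact (List.map_congr_left fun x _ => hf x).trans (List.map_id _)

/-! ### Correctness of the search and the theorem -/

theorem kernelSum_congr {c c' : ℕ → ℕ → Kq} (h : ∀ n k : ℕ, k ≤ n → c n k = c' n k)
    (J : ℕ → Kq) : kernelSum c J = kernelSum c' J := by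
  funext n
  refine Finset.sum_congr rfl fun k hk => ?_
  rw [h n k (Nat.lt_succ_iff.1 (Finset.mem_range.1 hk))]

theorem certSearch_spec {P : EqCode} {T : TermCode} (hP : IsNontrivial P.toEq) (hT : T.IsValid) :
    ∃ A ∈ certSearch (P, T), IsNontrivial (EqCode.toEq A) ∧
      ∀ J : ℕ → Kq, Satisfies J P.toEq → Satisfies (kernelSum T.val J) (EqCode.toEq A) := by
  obtain ⟨c, hc, hmem⟩ := exists_mem_certSearch (exists_isValid hP T)
  exact ⟨c.output, hmem, isNontrivial_output hc, fun J hJ => satisfies_output hT hc hJ⟩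

end QHolonomic

open QHolonomic in
theorem theorem5p1 :
    (∀ (c : ℕ → ℕ → Kq) (Jhat : ℕ → Kq),
      IsProperQHypergeometric c → IsQHolonomic Jhat → IsQHolonomic (kernelSum c Jhat)) ∧
    (∃ construct : EqCode × TermCode →. EqCode, Partrec construct ∧
      ∀ (P : EqCode) (T : TermCode), IsNontrivial P.toEq → T.IsValid →
        ∃ A ∈ construct (P, T), IsNontrivial A.toEq ∧
          ∀ Jhat : ℕ → Kq, Satisfies Jhat P.toEq → Satisfies (kernelSum T.val Jhat) A.toEq) := by
  refine ⟨?_, certSearch, partrec_certSearch, fun P T hP hT => certSearch_spec hP hT⟩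
  rintro c J ⟨T, hT, hc⟩ ⟨L, hL, hJ⟩
  obtain ⟨P, rfl⟩ := exists_toEq_eq L
  obtain ⟨A, -, hA, h⟩ := certSearch_spec hL hT
  rw [kernelSum_congr hc]
  exact ⟨A.toEq, hA, h J hJ⟩
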